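/- **Setting.** Fix $n$. A *lower subinterval* is $I=(a,a+1,\dots,m)$ with $1\le a\le m\le n$; $a$ is its head, $m$ its tail (its *right endpoint*). A *cascading $n$-sequence* $\beta$ is a finite sequence of lower subintervals whose tails are nonincreasing and in which intervals with equal tail come in order of nonincreasing length. Write $\beta[j]$ for its first $j$ intervals and $B_v$ for the set of its intervals with head $v$. The *corresponding rigged configuration* $R=(\mu_1,\dots,\mu_n)$ is obtained by letting the letters of $\beta$, from left to right, act by the $A_n$ Kashiwara operators $f_a$ of $RC(\infty)$ on the empty rigged configuration; $\mu_{n+1}=\emptyset$. Rows are counted from the top; a row below the last one is an empty row of length and rigging $0$. *Lanes.* Process the intervals from left to right and the entries of each interval from head to tail; entries of value $v$ are distributed into lanes $L_1(v),L_2(v),\dots$. A head $v$ starts the lane $L_{d+1}(v)$, where $d$ is the number of existing $v$-lanes. If the preceding entry of the same interval was put in lane number $d+1$, the next entry $v$ is appended to $L_{d'+1}(v)$, where $d'\le d$ is maximal with $|L_{d'}(v)|>|L_{d'+1}(v)|$ ($d'=0$ if there is none). The first entry of a lane is its head; the $s$-th entry has depth $s$. A nonexistent lane has length $0$. A lane *ends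 at a right endpoint* if its last entry is the tail of some interval. *Plateaus.* For $q,r\in\mathbb Z_{\ge0}\cup\{\infty\}$, $\beta$ is a *$(p,q,r)$-plateau* if (i) $|L_i(p-1)|=|L_i(p)|-1$ for every $i$ for which $L_i(p)$ exists and $|L_i(p-1)|<q$; (ii) no lane $L_i(p-1)$ with $|L_i(p-1)|\le r$ ends at a right endpoint; (iii) for $k<p-1$ no $k$-lane ends at a right endpoint. It is a *$p^*$-plateau* if it is an $(m,\infty,\infty)$-plateau for all $2\le m\le p$. *Stretches.* The stretch of height $h\ge1$ of $\mu_{p-1}$ consists of its columns of height $h$; if $|\mu_p^1|>|\mu_{p-1}^1|$ (top rows) there is also an invisible stretch of height $0$ and length $|\mu_p^1|-|\mu_{p-1}^1|$. Adding a box beneath a stretch of height $h$ means adding it to row $h+1$. A *noncontributing box* changes no rigging. A *contributing box* added to a row of length $s$ of $\mu_l$ adds $-1$ to the rigging of that row and of every longer row of $\mu_l$, and $+1$ to the rigging of every row of $\mu_{l+1}$ longer than $s$. *The procedure $\beta\mapsto\beta^@$ for a height $h$ and a number $k$.* Put $C^{(0)}=B_{p-h-1}$, listed from left to right. For $c=0,1,\dots,h$: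 go through the list $C^{(c)}$ and for each of its elements delete from $B_{p-h+c}$ the nearest not yet deleted element to its left (if there is none, nothing is deleted); $C^{(c+1)}$ is the list of the elements deleted, in this order, and $\overline B_{p-h+c}$ is what remains. Finally replace each of the first $k$ elements $(a,\dots,m)$ of $\overline B_{p-h+c}$ by $(a-1,a,\dots,m)$, for $c=0,\dots,h$. The procedure is *executable* if, for the letters $p-h,\dots,p-1$, a deletion is made for every listed element, and $|\overline B_{p-h+c}|\ge k$ for $0\le c\le h$. **Lemma.** Let $2\le p\le n+1$, let $\beta$ be a cascading $n$-sequence that is both a $(p-1)^*$-plateau and a $(p,q,r)$-plateau, with rigged configuration $(\mu_1,\dots,\mu_n)$. Let $z$ be a (nonempty) stretch of $\mu_{p-1}$ of height $h<\min(n-p+2,\,p-1)$ and length $|z|$. 1. Suppose $h<\min(q,r)$ and $0\le k\le|z|$. Then the procedure is executable; $\beta^@$ is a cascading sequence, a $(p-1)^*$-plateau and a $(p,h,r)$-plateau; in its rigged configuration the $(p-1)$-st partition is $\mu_{p-1}$ with $k$ noncontributing boxes added beneath $z$, and the $x$-th one is $\mu_x$ (with its riggings) for all $x\ge p$. 2.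 Suppose $h<\min(q,r)$. (a) There are $j_1\le j_2\le\dots\le j_h$ such that $j_1$ is the least $j$ for which $\beta[j]$ contains all intervals with head $p-1$ that contain the head of some $p$-lane and $\beta[j]$ has no more intervals with head $p-1$ than with head $p-2$; and for $2\le d\le h$, $j_d$ is the least $j\ge j_{d-1}$ for which $\beta[j]$ has no more intervals with head $p-d$ than with head $p-d-1$. (b) If $1\le d\le h$ and $I\in B_{p-d}$ lies outside $\beta[j_d]$, then $I$ contains $p$, its entries $p$ and $p-1$ have depths $d+1$ and $d$, and all its entries not exceeding $p$ have the same lane number. (c) If $\widehat I\in B_{p-1}$ contains the head of some $p$-lane, then all elements of $B_p$ left of $\widehat I$ belong to the deleted elements $C^{(h+1)}$. 3. (a) Suppose $h<r$ and $0\le k\le|z|$. Append $k$ copies of $(p-h-1,p-h,\dots,p-1)$ at the right end of $\beta$. The result $\beta^!$ is a cascading sequence, a $(p-1)^*$-plateau and a $(p,\min(q,h+1),h)$-plateau (so a $(p,q,h)$-plateau if $q\le h+1$), and, for the given $q$, condition (i) still holds for every $i$ for which $L_i(p-1)$ does not end at a right endpoint. For $x\ge p-1$ the $x$-th rigged partition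 of $\beta^!$ is the one obtained from $R$ by adding $k$ contributing boxes beneath $z$ in $\mu_{p-1}$; in particular $\mu_x$ is fixed for $x>p$ and the shape of $\mu_p$ is fixed. (b) For any $N\ge0$ (and without any condition on stretches or on $r$), append $N$ copies of $(p-1)$ at the right end of $\beta$. The result $\beta^!$ is a cascading sequence, a $(p-1)^*$-plateau and a $(p,\min(q,1),0)$-plateau, and a $(p,q,0)$-plateau if $|\mu_p^1|\le|\mu_{p-1}^1|$; for the given $q$, condition (i) still holds for every $i$ for which $L_i(p-1)$ does not end at a right endpoint. For $x\ge p-1$ the $x$-th rigged partition of $\beta^!$ is the one obtained from $R$ by adding $N$ contributing boxes to the top row of $\mu_{p-1}$; in particular $\mu_x$ is fixed for $x>p$ and the shape of $\mu_p$ is fixed. -/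

import Mathlib

/-!  Type `A_n` rigged configurations, cascading sequences, lanes and plateaus. -/

/-! ### Rigged configurations and Kashiwara operators -/

/-- A rigged partition: a multiset of strings `(length, rigging)`. -/
abbrev RiggedPartition := Multiset (ℕ × ℤ)

/-- A tuple of rigged partitions, indexed by the letters `1, …, n`
(the components at all other indices stay empty). -/
abbrev RiggedConfig := ℕ → RiggedPartition

/-- Entry `(a, b)` of the Cartan matrix of type `A`. -/
def cartanA (a b : ℕ) : ℤ :=
  if a = b then 2 else if a + 1 = b ∨ b + 1 = a then -1 else 0

/-- The vacancy number `p_i^{(a)}(ν) = -∑_{(b,j)} A_{ab} min(i,j) m_j^{(b)}`. -/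
def vacancy (n : ℕ) (ν : RiggedConfig) (a i : ℕ) : ℤ :=
  -∑ b ∈ Finset.Icc 1 n, ((ν b).map fun s => cartanA a b * (min i s.1 : ℕ)).sum

/-- The minimum of `0` and all riggings: the smallest rigging if that is nonpositive,
and `0` if all riggings are positive or the partition is empty. -/
def lowLabel (μ : RiggedPartition) : ℤ := (μ.map Prod.snd).fold min 0

/-- The greatest length of a string with rigging `lowLabel μ`. It is `0` when there is no such
string, that is, when all riggings are positive or the partition is empty. -/
def growLength (μ : RiggedPartition) : ℕ :=
  ((μ.filter fun s => s.2 = lowLabel μ).map Prod.fst).sup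

/-- The Kashiwara operator `f_a`: with `x = lowLabel` and `l = growLength`, the string `(l, x)` is
replaced by `(l + 1, x - 1)` (if `l = 0`, nothing is erased and the string `(1, -1)` is added);
every other rigging changes by the change of the vacancy number, so that all colabels
`p_i^{(b)} - x` of the other strings are preserved. -/
def kashiwaraF (n a : ℕ) (ν : RiggedConfig) : RiggedConfig :=
  let x := lowLabel (ν a)
  let l := growLength (ν a)
  let rest := (ν a).erase (l, x)
  let ν' : RiggedConfig := Function.update ν a ((l + 1, x - 1) ::ₘ rest)
  let relabel := fun (b : ℕ) (s : ℕ × ℤ) =>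
    (s.1, s.2 + (vacancy n ν' b s.1 - vacancy n ν b s.1))
  fun b => if b = a then (l + 1, x - 1) ::ₘ rest.map (relabel b) else (ν b).map (relabel b)

/-- The `b`-th row (`b = 1, 2, …`, from the top) of a rigged partition, the strings being sorted in
decreasing lexicographic order. A row below the last one is the empty row `(0, 0)`. -/
def row (μ : RiggedPartition) (b : ℕ) : ℕ × ℤ :=
  (((μ.map toLex).sort (· ≥ ·)).map ofLex).getD (b - 1) (0, 0)

/-- Add a noncontributing box to the `b`-th row: no rigging changes. -/
def addNoncontributingBox (b : ℕ) (μ : RiggedPartition) : RiggedPartition :=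
  ((row μ b).1 + 1, (row μ b).2) ::ₘ μ.erase (row μ b)

/-- Add a contributing box to the `b`-th row of the `l`-th partition: it contributes `-1` to the
rigging of that row and of every longer row of the `l`-th partition, and `+1` to the rigging of
every longer row of the `(l+1)`-st partition. -/
def addContributingBox (l b : ℕ) (R : RiggedConfig) : RiggedConfig :=
  let s := row (R l) b
  fun j =>
    if j = l then
      (s.1 + 1, s.2 - 1) ::ₘ
        ((R l).erase s).map fun t => if s.1 < t.1 then (t.1, t.2 - 1) else t
    else if j = l + 1 then
      (R j).map fun t => if s.1 < t.1 then (t.1, t.2 + 1) else t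
    else R j

/-! ### Cascading sequences -/

/-- The lower subinterval `(a, a+1, …, m)`, given by its head `a` and its tail `m`. -/
abbrev LowerInterval := ℕ × ℕ

/-- `β`, a list of lower subintervals of `[n]`, is a cascading `n`-sequence: the tails are
nonincreasing, and intervals with equal tail come in order of nonincreasing length. -/
def IsCascading (n : ℕ) (β : List LowerInterval) : Prop :=
  (∀ I ∈ β, 1 ≤ I.1 ∧ I.1 ≤ I.2 ∧ I.2 ≤ n) ∧
    β.Pairwise fun I J => J.2 < I.2 ∨ (J.2 = I.2 ∧ I.1 ≤ J.1)

/-- The integer sequence formed by concatenating the lower subintervals. -/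
def toSeq (β : List LowerInterval) : List ℕ :=
  β.flatMap fun I => List.range' I.1 (I.2 + 1 - I.1)

/-- The rigged configuration corresponding to `β`: the letters of `β`, from left to right, act on
the empty rigged configuration by Kashiwara operators. -/
def riggedConfig (n : ℕ) (β : List LowerInterval) : RiggedConfig :=
  (toSeq β).foldl (fun R a => kashiwaraF n a R) fun _ => 0

/-! ### Lanes -/

/-- `S u v` is the lane `L_u(v)`, for `u = 1, 2, …`. A lane is recorded as the list of the positions
in `β` (counted from `0`) of the lower subintervals to which its entries belong. -/
abbrev Lanes := ℕ → ℕ → List ℕ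

/-- Append the entry `v` of the lower subinterval at position `b` to the lane `L_u(v)`. -/
def Lanes.append (S : Lanes) (u v b : ℕ) : Lanes :=
  fun u' v' => if u' = u ∧ v' = v then S u' v' ++ [b] else S u' v'

/-- Insert the non-head entries `vs` of the lower subinterval at position `b`, where `d` is the
number `d_{k-1}` chosen for the preceding entry: `d_k` is the maximal `t ≤ d` with
`|L_t(v)| > |L_{t+1}(v)|`, or `0` if there is none, and `v` is appended to `L_{d_k+1}(v)`. -/
def Lanes.insertTail (b : ℕ) : List ℕ → ℕ → Lanes → Lanes
  | [], _, S => S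
  | v :: vs, d, S =>
    let d' := Nat.findGreatest (fun t => (S (t + 1) v).length < (S t v).length) d
    Lanes.insertTail b vs d' (S.append (d' + 1) v b)

/-- Insert the lower subinterval `I` at position `b`: the head starts a new lane after the last
existing one. There are at most `b` lanes for each letter at this stage. -/
def Lanes.insert (S : Lanes) (b : ℕ) (I : LowerInterval) : Lanes :=
  let d := Nat.findGreatest (fun t => S t I.1 ≠ []) b
  Lanes.insertTail b (List.range' (I.1 + 1) (I.2 - I.1)) d (S.append (d + 1) I.1 b)

/-- The lanes of `β`, by the lane forming procedure. -/
def lanes (β : List LowerInterval) : Lanes :=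
  β.zipIdx.foldl (fun S x => S.insert x.2 x.1) fun _ _ => []

/-- The lane `L_u(v)` of `β` (exists and) ends at a right endpoint: its last entry is the tail of
the lower subinterval containing it. -/
def EndsAtRightEndpoint (β : List LowerInterval) (u v : ℕ) : Prop :=
  ∃ b I, (lanes β u v).getLast? = some b ∧ β[b]? = some I ∧ I.2 = v

/-! ### Plateaus -/

/-- `(p,q,r)`-plateau, with `q, r ∈ ℕ ∪ {∞}`. A lane that does not exist has length `0`. -/
def IsPlateau (β : List LowerInterval) (p : ℕ) (q r : ℕ∞) : Prop :=
  (∀ i, 1 ≤ i → lanes β i p ≠ [] → ((lanes β i (p - 1)).length : ℕ∞) < q →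
    (lanes β i (p - 1)).length + 1 = (lanes β i p).length) ∧
  (∀ i, 1 ≤ i → lanes β i (p - 1) ≠ [] → ((lanes β i (p - 1)).length : ℕ∞) ≤ r →
    ¬ EndsAtRightEndpoint β i (p - 1)) ∧
  (∀ k, 1 ≤ k → k < p - 1 → ∀ i, 1 ≤ i → ¬ EndsAtRightEndpoint β i k)

/-- `p^*`-plateau: an `m`-plateau, i.e. an `(m,∞,∞)`-plateau, for every `2 ≤ m ≤ p`. -/
def IsStarPlateau (β : List LowerInterval) (p : ℕ) : Prop :=
  ∀ m, 2 ≤ m → m ≤ p → IsPlateau β m ⊤ ⊤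

/-- The first condition of a `(p,q,r)`-plateau, required only for those `i` for which
`L_i(p-1)` does not end at a right endpoint. -/
def NoncontributingFree (β : List LowerInterval) (p : ℕ) (q : ℕ∞) : Prop :=
  ∀ i, 1 ≤ i → lanes β i p ≠ [] → ¬ EndsAtRightEndpoint β i (p - 1) →
    ((lanes β i (p - 1)).length : ℕ∞) < q →
    (lanes β i (p - 1)).length + 1 = (lanes β i p).length

/-! ### Stretches -/

/-- `maxr_l = min(n-l+1, l)`. -/
def maxRows (n l : ℕ) : ℕ := min (n - l + 1) l

/-- The length of the stretch of height `h` of the `(p-1)`-st partition of `R`: the number of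
columns of height `h` if `h > 0`; for `h = 0`, the length `|μ_p^1| - |μ_{p-1}^1|` of the
"invisible" stretch to the right of the top row. It is `0` when there is no such stretch. -/
def stretchLength (R : RiggedConfig) (p : ℕ) : ℕ → ℕ
  | 0 => (row (R p) 1).1 - (row (R (p - 1)) 1).1
  | h + 1 => (row (R (p - 1)) (h + 1)).1 - (row (R (p - 1)) (h + 2)).1

/-! ### The procedure for adding noncontributing boxes -/

/-- The positions, from left to right, of the lower subintervals with head `v` (the set `B_v`). -/
def headPositions (β : List LowerInterval) (v : ℕ) : List ℕ :=
  (List.range β.length).filter fun i => (β.map Prod.fst)[i]? = some v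

/-- Deletion step. For each position `j` of the first list, in the order of that list, delete from
`avail` the element nearest to `j` left of `j`, if there is one. Returns the deleted positions in
the order of their deletion, and the remaining positions. -/
def pairLeft : List ℕ → List ℕ → List ℕ × List ℕ
  | [], avail => ([], avail)
  | j :: js, avail =>
    match (avail.filter fun i => decide (i < j)).getLast? with
    | none => pairLeft js avail
    | some i =>
      let res := pairLeft js (avail.erase i)
      (i :: res.1, res.2)

/-- The deleted (fixed) elements with head `p - h - 1 + c`, for `c = 0, …, h + 1`. -/
def fixedElements (β : List LowerInterval) (p h : ℕ) : ℕ → List ℕ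
  | 0 => headPositions β (p - h - 1)
  | c + 1 => (pairLeft (fixedElements β p h c) (headPositions β (p - h + c))).1

/-- The elements of `B_{p-h+d}` that remain after the deletions, for `d = 0, …, h`. -/
def remainingElements (β : List LowerInterval) (p h d : ℕ) : List ℕ :=
  (pairLeft (fixedElements β p h d) (headPositions β (p - h + d))).2

/-- Lengthen the first `k` remaining elements of `B_{p-h+d}`, for `d = 0, …, h`. -/
def addNoncontributing (β : List LowerInterval) (p h k : ℕ) : List LowerInterval :=
  β.zipIdx.map fun x =>
    if ∃ d ∈ Finset.range (h + 1), x.2 ∈ (remainingElements β p h d).take k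
    then (x.1.1 - 1, x.1.2) else x.1

/-- The procedure can be carried out for `k` boxes: at every letter below `p` each deletion finds an
element to delete, and at least `k` elements remain at every letter `p - h, …, p`. -/
def Executable (β : List LowerInterval) (p h k : ℕ) : Prop :=
  (∀ c ≤ h, (fixedElements β p h c).length = (headPositions β (p - h - 1)).length) ∧
    ∀ d ≤ h, k ≤ (remainingElements β p h d).length

/-! ### The procedure for adding contributing boxes -/

/-- Append `k` copies of the lower subinterval `(a, …, m)`. -/
def appendCopies (β : List LowerInterval) (a m k : ℕ) : List LowerInterval :=
  β ++ List.replicate k (a, m)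

/-! ### Initial segments and heads of lanes -/

/-- The number of lower subintervals with head `v` in the initial segment `β[j]`. -/
def headCount (β : List LowerInterval) (j v : ℕ) : ℕ :=
  ((β.take j).filter fun I => decide (I.1 = v)).length

/-- The lower subinterval at position `b` has head `p - 1` and contains the head of a `p`-lane. -/
def StartsLane (β : List LowerInterval) (p b : ℕ) : Prop :=
  b ∈ headPositions β (p - 1) ∧ ∃ u, 1 ≤ u ∧ (lanes β u p).head? = some b

/-!
Throughout, `β` is a cascading sequence, `κ` and `λ` denote the row lengths of the partitions
`μ_{p-1}` and `μ_p`, and the head count of a letter `v` is the number of intervals with head `v`.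

The first step removes the rigged configurations and the lanes from the problem. Inserting an
interval adds a box to the top row of the partition of its head and then, letter by letter, to the
topmost row that is not longer than the row just lengthened was before (`insertRow`). The lanes
follow this rule by construction: they are the columns of the partitions (`lanes_areColumns`). The
Kashiwara operators follow it, too, because in the rigged configuration of a cascading sequence
all rows of equal length have equal riggings, and an interval changes riggings only through its
tail (`riggedConfig_eq`). Hence the whole statement concerns the row lengths `rows β`, together
with the rows and the slots (the former lengths of these rows) into which the tails go.

For sequences all of whose intervals reach `p - 1`, being a `(p - 1)^*`-plateau is a ballot
condition: every initial segment has at least as many heads `v + 1` as heads `v`, for `v < p - 1`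
(`IsStarPlateau.isBallot`, `IsBallot.isStarPlateau`). For ballot sequences `κ_s` is the head count
of `p - s`, and an interval with head `p - s` has its entry `p - 1` in the row `s`. Its entry `p`
therefore goes into the row `s`, if `λ_s = κ_s` at that time, and into the row `s + 1` otherwise
(`Setup.rowAt_cases`). Counting the intervals of the first kind gives an exact balance between `λ`
and the head counts (`Setup.rows_add_levelCount`). A nonempty stretch of height `h < min q r`
forces `λ_{s+1} = κ_s` for `1 ≤ s ≤ h` in the complete sequence (`IsPlateau.stretchSetup`), and
with the balance this determines from which time on `λ_{s+1} = κ_s` holds for good: that time is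
`levelTime`, the positions `j_d` of the statement are found there, and later intervals with head
`p - d` have their entries `p` in the row `d + 1` (`Setup.exists_initial_segments`).

The deletions of the procedure `β ↦ β^@` amount to matching parentheses: each element of one list
is matched with the nearest free element of another list to its left. The deleted elements do not
depend on the order in which the list is processed (`pairLeft_perm`), and to the left of a remaining
element there are as many deleted elements as elements that have deleted them (`exists_isMatching`).
At the letters below `p` the ballot condition lets everything be matched; at the letter `p` exactly
the intervals that start a lane of `p` stay without a partner
(`StretchSetup.exists_isMatching_zero`). In consequence, in every initial segment the number of
remaining elements weakly increases with the letter (`StretchSetup.below_remainingAt_anti`), so that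
lengthening the first `k` of them at each letter preserves the ballot condition. Moreover, just
before each interval the new head counts compare with `λ` in such a way that its entry `p` goes into
the same row as before (`StretchSetup.rowAt_addNoncontributing`). Thus the partitions from the
`p`-th on do not change, while among the head counts of the letters below `p` only that of
`p - h - 1` changes: it gains `k`. These are the new boxes in the row `h + 1` of `μ_{p-1}`; they do
not contribute because no tail moves to another slot.

An interval `(p - b, …, p - 1)` appended at the end adds a box to the row `b` of `μ_{p-1}`, at a
slot that is the former length of this row, and its tail `p - 1` makes this box contributing
(`AppendSetup.riggedConfig_append_singleton`). The columns that receive such boxes end at right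
endpoints, and the others are unchanged.
-/

/-! ### Row lengths and the insertion of an interval -/

/-- `ρ v s` is the length of the `s`-th row (`s ≥ 1`) of the `v`-th partition. The columns of the
partition are the lanes of the letter `v`. -/
abbrev RowLengths := ℕ → ℕ → ℕ

/-- The topmost row of length at most `d`. -/
noncomputable def firstRow (f : ℕ → ℕ) (d : ℕ) : ℕ := sInf {s | 1 ≤ s ∧ f s ≤ d}

/-- The length, before the insertion, of the row of the `v`-th partition to which the entry `v` of
an interval with head `a ≤ v` is added: the entry `v + 1` goes into the topmost row not longer than
the one that received the entry `v`. At letters below `a` the value is the length of the top row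
of the `a`-th partition, so that the head obeys the same rule as the other entries. -/
noncomputable def slot (ρ : RowLengths) (a : ℕ) : ℕ → ℕ
  | 0 => ρ a 1
  | v + 1 => if a ≤ v then ρ (v + 1) (firstRow (ρ (v + 1)) (slot ρ a v)) else ρ a 1

/-- The index of the row to which the entry `v` of an interval with head `a ≤ v` is added. -/
noncomputable def slotRow (ρ : RowLengths) (a v : ℕ) : ℕ := firstRow (ρ v) (slot ρ a (v - 1))

/-- The row lengths after the insertion of the interval `I`. -/
noncomputable def insertRow (ρ : RowLengths) (I : LowerInterval) : RowLengths := fun v s =>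
  if I.1 ≤ v ∧ v ≤ I.2 ∧ s = slotRow ρ I.1 v then ρ v s + 1 else ρ v s

/-- The row lengths of a sequence of intervals. -/
noncomputable def rows (β : List LowerInterval) : RowLengths := β.foldl insertRow fun _ _ => 0

@[simp] lemma rows_nil : rows [] = fun _ _ => 0 := rfl

lemma rows_append_singleton (β : List LowerInterval) (I : LowerInterval) :
    rows (β ++ [I]) = insertRow (rows β) I := by
  simp [rows, List.foldl_append]

/-- Rows of a partition: weakly decreasing, with finitely many nonzero rows. -/
structure IsRowSystem (ρ : RowLengths) : Prop where
  anti : ∀ v s, 1 ≤ s → ρ v (s + 1) ≤ ρ v s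
  fin : ∀ v, ∃ K, ∀ s, K < s → ρ v s = 0

lemma IsRowSystem.anti_le {ρ : RowLengths} (h : IsRowSystem ρ) (v : ℕ) {s t : ℕ} (hs : 1 ≤ s)
    (hst : s ≤ t) : ρ v t ≤ ρ v s := by
  induction t, hst using Nat.le_induction with
  | base => exact le_rfl
  | succ t hst ih => exact (h.anti v t (hs.trans hst)).trans ih

lemma firstRow_le {f : ℕ → ℕ} {d s : ℕ} (hs : 1 ≤ s) (h : f s ≤ d) : firstRow f d ≤ s :=
  Nat.sInf_le ⟨hs, h⟩

lemma lt_of_lt_firstRow {f : ℕ → ℕ} {d s : ℕ} (hs : 1 ≤ s) (h : s < firstRow f d) : d < f s := by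
  by_contra hc
  exact absurd (firstRow_le hs (not_lt.1 hc)) (not_le.2 h)

lemma IsRowSystem.firstRow_mem {ρ : RowLengths} (h : IsRowSystem ρ) (v d : ℕ) :
    1 ≤ firstRow (ρ v) d ∧ ρ v (firstRow (ρ v) d) ≤ d := by
  obtain ⟨K, hK⟩ := h.fin v
  exact Nat.sInf_mem (s := {s | 1 ≤ s ∧ ρ v s ≤ d})
    ⟨K + 1, by omega, by rw [hK (K + 1) (by omega)]; omega⟩

lemma slot_of_le (ρ : RowLengths) {a v : ℕ} (h : v ≤ a) : slot ρ a v = ρ a 1 := by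
  cases v with
  | zero => rfl
  | succ v => rw [slot, if_neg (by omega)]

lemma slotRow_self {ρ : RowLengths} (h : IsRowSystem ρ) (a : ℕ) : slotRow ρ a a = 1 := by
  have h1 : slotRow ρ a a ≤ 1 :=
    firstRow_le le_rfl (slot_of_le ρ (show a - 1 ≤ a by omega)).ge
  have h2 := (h.firstRow_mem a (slot ρ a (a - 1))).1
  unfold slotRow at *
  omega

lemma slot_eq {ρ : RowLengths} (h : IsRowSystem ρ) {a v : ℕ} (hv : a ≤ v) :
    slot ρ a v = ρ v (slotRow ρ a v) := by
  rcases hv.eq_or_lt with rfl | hlt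
  · rw [slotRow_self h, slot_of_le ρ le_rfl]
  · obtain ⟨w, rfl⟩ : ∃ w, v = w + 1 := ⟨v - 1, by omega⟩
    rw [slot, if_pos (by omega)]
    rfl

lemma one_le_slotRow {ρ : RowLengths} (h : IsRowSystem ρ) (a v : ℕ) : 1 ≤ slotRow ρ a v :=
  (h.firstRow_mem v _).1

lemma slot_le {ρ : RowLengths} (h : IsRowSystem ρ) {a v : ℕ} (hv : a ≤ v) :
    slot ρ a v ≤ slot ρ a (v - 1) := by
  rw [slot_eq h hv]
  exact (h.firstRow_mem v _).2

lemma slot_lt_of_lt_slotRow {ρ : RowLengths} {a v s : ℕ} (hs : 1 ≤ s) (h : s < slotRow ρ a v) :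
    slot ρ a (v - 1) < ρ v s :=
  lt_of_lt_firstRow hs h

lemma slotRow_le {ρ : RowLengths} {a v s : ℕ} (hs : 1 ≤ s) (h : ρ v s ≤ slot ρ a (v - 1)) :
    slotRow ρ a v ≤ s :=
  firstRow_le hs h

lemma insertRow_same {ρ : RowLengths} {I : LowerInterval} {v : ℕ} (h1 : I.1 ≤ v) (h2 : v ≤ I.2) :
    insertRow ρ I v (slotRow ρ I.1 v) = ρ v (slotRow ρ I.1 v) + 1 := by
  simp [insertRow, h1, h2]

lemma insertRow_of_ne {ρ : RowLengths} {I : LowerInterval} {v s : ℕ} (h : s ≠ slotRow ρ I.1 v) :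
    insertRow ρ I v s = ρ v s := by
  simp [insertRow, h]

lemma insertRow_of_lt {ρ : RowLengths} {I : LowerInterval} {v s : ℕ} (h : v < I.1) :
    insertRow ρ I v s = ρ v s := by
  simp [insertRow, not_le.2 h]

lemma insertRow_of_gt {ρ : RowLengths} {I : LowerInterval} {v s : ℕ} (h : I.2 < v) :
    insertRow ρ I v s = ρ v s := by
  simp [insertRow, not_le.2 h]

lemma le_insertRow (ρ : RowLengths) (I : LowerInterval) (v s : ℕ) :
    ρ v s ≤ insertRow ρ I v s := by
  unfold insertRow; split_ifs <;> omega

lemma IsRowSystem.insertRow {ρ : RowLengths} (h : IsRowSystem ρ) (I : LowerInterval) :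
    IsRowSystem (insertRow ρ I) where
  anti v s hs := by
    have h0 := h.anti v s hs
    have h3 := le_insertRow ρ I v s
    by_cases hc : I.1 ≤ v ∧ v ≤ I.2 ∧ s + 1 = slotRow ρ I.1 v
    · have h1 := slot_lt_of_lt_slotRow hs (show s < slotRow ρ I.1 v by omega)
      have h2 := slot_le h hc.1
      rw [slot_eq h hc.1, ← hc.2.2] at h2
      have : _root_.insertRow ρ I v (s + 1) = ρ v (s + 1) + 1 := by
        rw [_root_.insertRow, if_pos hc]
      omega
    · have : _root_.insertRow ρ I v (s + 1) = ρ v (s + 1) := by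
        rw [_root_.insertRow, if_neg hc]
      omega
  fin v := by
    obtain ⟨K, hK⟩ := h.fin v
    refine ⟨max K (slotRow ρ I.1 v), fun s hs => ?_⟩
    rw [insertRow_of_ne (by omega), hK s (by omega)]

lemma isRowSystem_rows (β : List LowerInterval) : IsRowSystem (rows β) := by
  induction β using List.reverseRecOn with
  | nil => exact ⟨fun _ _ _ => le_rfl, fun _ => ⟨0, fun _ _ => rfl⟩⟩
  | append_singleton β I ih => rw [rows_append_singleton]; exact ih.insertRow I

lemma rows_le_length (β : List LowerInterval) (v s : ℕ) : rows β v s ≤ β.length := by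
  induction β using List.reverseRecOn with
  | nil => exact le_rfl
  | append_singleton β I ih =>
    rw [rows_append_singleton, List.length_append, List.length_singleton, insertRow]
    split_ifs <;> omega

/-- Removing the top row of the `(v + 1)`-st partition leaves a partition contained in the
`v`-th one. -/
lemma rows_succ_succ_le (β : List LowerInterval) (v : ℕ) {s : ℕ} (hs : 1 ≤ s) :
    rows β (v + 1) (s + 1) ≤ rows β v s := by
  induction β using List.reverseRecOn generalizing s with
  | nil => exact le_rfl
  | append_singleton β I ih =>
    have H := isRowSystem_rows β
    rw [rows_append_singleton]
    set ρ := rows β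
    have h0 := ih hs
    have h3 := le_insertRow ρ I v s
    by_cases hc : I.1 ≤ v + 1 ∧ v + 1 ≤ I.2 ∧ s + 1 = slotRow ρ I.1 (v + 1)
    · have e : insertRow ρ I (v + 1) (s + 1) = ρ (v + 1) (s + 1) + 1 := by
        rw [insertRow, if_pos hc]
      rcases hc.1.eq_or_lt with h1 | h1
      · rw [h1, slotRow_self H] at hc; omega
      · have h1 : I.1 ≤ v := by omega
        have h4 := slot_le H hc.1
        rw [slot_eq H hc.1, ← hc.2.2, Nat.add_sub_cancel] at h4
        have h5 : slotRow ρ I.1 (v + 1) ≤ slotRow ρ I.1 v + 1 := by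
          refine slotRow_le (by omega) ?_
          rw [Nat.add_sub_cancel, slot_eq H h1]
          exact ih (one_le_slotRow H _ _)
        rcases (show s ≤ slotRow ρ I.1 v by omega).eq_or_lt with h6 | h6
        · have := insertRow_same (ρ := ρ) h1 (show v ≤ I.2 by omega)
          rw [← h6] at this
          omega
        · have := slot_lt_of_lt_slotRow hs h6
          have := slot_le H h1
          omega
    · have : insertRow ρ I (v + 1) (s + 1) = ρ (v + 1) (s + 1) := by
        rw [insertRow, if_neg hc]
      omega

/-- As long as all intervals reach the letter `v + 1`, the `v`-th partition is contained in the
`(v + 1)`-st one. -/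
lemma rows_le_succ {β : List LowerInterval} {v : ℕ} (hβ : ∀ I ∈ β, v + 1 ≤ I.2) {s : ℕ}
    (hs : 1 ≤ s) : rows β v s ≤ rows β (v + 1) s := by
  induction β using List.reverseRecOn generalizing s with
  | nil => exact le_rfl
  | append_singleton β I ih =>
    have H := isRowSystem_rows β
    have ih := fun {s} => @ih (fun J hJ => hβ J (by simp [hJ])) s
    have hI : v + 1 ≤ I.2 := hβ I (by simp)
    rw [rows_append_singleton]
    set ρ := rows β
    have h0 := ih hs
    have h3 := le_insertRow ρ I (v + 1) s
    by_cases hc : I.1 ≤ v ∧ v ≤ I.2 ∧ s = slotRow ρ I.1 v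
    · have e : insertRow ρ I v s = ρ v s + 1 := by
        rw [insertRow, if_pos hc]
      have h4 := slot_eq H hc.1
      rw [← hc.2.2] at h4
      rcases lt_trichotomy (slotRow ρ I.1 (v + 1)) s with h5 | h5 | h5
      · have h6 := slot_lt_of_lt_slotRow (one_le_slotRow H I.1 (v + 1)) (hc.2.2 ▸ h5)
        have h7 := slot_le H (show I.1 ≤ v + 1 by omega)
        rw [slot_eq H (show I.1 ≤ v + 1 by omega), Nat.add_sub_cancel] at h7
        have h8 := ih (one_le_slotRow H I.1 (v + 1))
        have := slot_le H hc.1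
        omega
      · have := insertRow_same (ρ := ρ) (show I.1 ≤ v + 1 by omega) hI
        rw [h5] at this
        omega
      · have := slot_lt_of_lt_slotRow hs h5
        rw [Nat.add_sub_cancel] at this
        omega
    · have : insertRow ρ I v s = ρ v s := by
        rw [insertRow, if_neg hc]
      omega

/-! ### Lanes are the columns of the partitions -/

lemma lanes_append_singleton (β : List LowerInterval) (I : LowerInterval) :
    lanes (β ++ [I]) = (lanes β).insert β.length I := by
  simp [lanes, List.zipIdx_append, List.foldl_append]

/-- The lanes in `S` are the columns of the partitions with row lengths `ρ`. -/
def AreColumns (S : Lanes) (ρ : RowLengths) : Prop :=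
  ∀ v i s, 1 ≤ i → 1 ≤ s → (s ≤ (S i v).length ↔ i ≤ ρ v s)

lemma AreColumns.findGreatest_eq {S : Lanes} {ρ : RowLengths} (hS : AreColumns S ρ)
    (H : IsRowSystem ρ) (v d : ℕ) :
    Nat.findGreatest (fun t => (S (t + 1) v).length < (S t v).length) d =
      ρ v (firstRow (ρ v) d) := by
  obtain ⟨h1, h2⟩ := H.firstRow_mem v d
  set r := firstRow (ρ v) d
  rw [Nat.findGreatest_eq_iff]
  refine ⟨h2, fun h0 => ?_, fun m hm hmd hlt => ?_⟩
  · have h3 := (hS v (ρ v r) r (by omega) h1).2 le_rfl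
    have h4 := mt (hS v (ρ v r + 1) r (by omega) h1).1 (by omega)
    omega
  · have h3 := (hS v m (S m v).length (by omega) (by omega)).1 le_rfl
    have h4 := mt (hS v (m + 1) (S m v).length (by omega) (by omega)).2 (by omega)
    have h5 : r ≤ (S m v).length := firstRow_le (by omega) (by omega)
    have := H.anti_le v h1 h5
    omega

lemma AreColumns.insertTail_apply {S : Lanes} {ρ : RowLengths} (hS : AreColumns S ρ)
    (H : IsRowSystem ρ) (b a k : ℕ) : ∀ (w : ℕ) (S' : Lanes), a ≤ w →
    (∀ v, w < v → ∀ u, S' u v = S u v) → ∀ u v,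
    Lanes.insertTail b (List.range' (w + 1) k) (slot ρ a w) S' u v =
      if w < v ∧ v ≤ w + k ∧ u = slot ρ a v + 1 then S' u v ++ [b] else S' u v := by
  induction k with
  | zero =>
    intro w S' _ _ u v
    rw [if_neg (by omega)]
    rfl
  | succ k ih =>
    intro w S' haw hS' u v
    have e : Nat.findGreatest (fun t => (S' (t + 1) (w + 1)).length < (S' t (w + 1)).length)
        (slot ρ a w) = slot ρ a (w + 1) := by
      simp only [hS' (w + 1) (by omega)]
      rw [hS.findGreatest_eq H, slot, if_pos haw]
    rw [List.range'_succ, Lanes.insertTail, e]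
    rw [ih (w + 1) _ (by omega)]
    · unfold Lanes.append
      by_cases hv : v = w + 1
      · subst hv
        by_cases hu : u = slot ρ a (w + 1) + 1
        · simp [hu]
        · simp [hu]
      · have h2 : (w + 1 < v ∧ v ≤ w + 1 + k ∧ u = slot ρ a v + 1) ↔
            w < v ∧ v ≤ w + (k + 1) ∧ u = slot ρ a v + 1 := by omega
        simp only [h2, hv, and_false, if_false]
    · intro v' hv' u'
      unfold Lanes.append
      rw [if_neg (by omega), hS' v' (by omega)]

lemma AreColumns.insert_apply {S : Lanes} {ρ : RowLengths} (hS : AreColumns S ρ)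
    (H : IsRowSystem ρ) {b : ℕ} (hb : ∀ v, ρ v 1 ≤ b) {I : LowerInterval}
    (hI : I.1 ≤ I.2) (u v : ℕ) :
    S.insert b I u v =
      if I.1 ≤ v ∧ v ≤ I.2 ∧ u = slot ρ I.1 v + 1 then S u v ++ [b] else S u v := by
  have e : Nat.findGreatest (fun t => S t I.1 ≠ []) b = slot ρ I.1 I.1 := by
    rw [slot_of_le ρ le_rfl, Nat.findGreatest_eq_iff]
    refine ⟨hb _, fun h => ?_, fun m hm _ hne => ?_⟩
    · have := (hS I.1 (ρ I.1 1) 1 (by omega) le_rfl).2 le_rfl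
      rintro hc; rw [hc] at this; simp at this
    · have := (hS I.1 m 1 (by omega) le_rfl).1 (List.length_pos_iff.2 hne)
      omega
  rw [Lanes.insert]
  simp only [e]
  rw [hS.insertTail_apply H b I.1 _ I.1 _ le_rfl]
  · unfold Lanes.append
    by_cases hv : v = I.1
    · subst hv; simp [hI]
    · have h2 : (I.1 < v ∧ v ≤ I.1 + (I.2 - I.1) ∧ u = slot ρ I.1 v + 1) ↔
          I.1 ≤ v ∧ v ≤ I.2 ∧ u = slot ρ I.1 v + 1 := by omega
      simp only [h2, hv, and_false, if_false]
  · intro v' hv' u'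
    unfold Lanes.append
    rw [if_neg (by omega)]

/-- Lists of nonempty intervals. -/
def AreIntervals (β : List LowerInterval) : Prop := ∀ I ∈ β, I.1 ≤ I.2

lemma IsCascading.areIntervals {n : ℕ} {β : List LowerInterval} (h : IsCascading n β) :
    AreIntervals β := fun I hI => (h.1 I hI).2.1

lemma lanes_areColumns {β : List LowerInterval} (hβ : AreIntervals β) :
    (∀ v, lanes β 0 v = []) ∧ AreColumns (lanes β) (rows β) := by
  induction β using List.reverseRecOn with
  | nil =>
    refine ⟨fun _ => rfl, fun v i s hi hs => ?_⟩
    simp [lanes]; omega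
  | append_singleton β I ih =>
    obtain ⟨h0, hS⟩ := ih fun J hJ => hβ J (by simp [hJ])
    have H := isRowSystem_rows β
    have hI : I.1 ≤ I.2 := hβ I (by simp)
    rw [lanes_append_singleton, rows_append_singleton]
    have key := hS.insert_apply H (b := β.length) (fun v => rows_le_length β v 1) hI
    refine ⟨fun v => ?_, fun v i s hi hs => ?_⟩
    · rw [key, if_neg (by omega), h0]
    · rw [key]
      have hc := hS v i s hi hs
      by_cases h1 : I.1 ≤ v ∧ v ≤ I.2
      · have e := slot_eq H h1.1
        set r := slotRow (rows β) I.1 v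
        have hr : 1 ≤ r := one_le_slotRow H _ _
        have hcr := hS v i r hi hr
        have key2 : i = slot (rows β) I.1 v + 1 → (lanes β i v).length + 1 = r := by
          intro hi'
          have h2 := mt hcr.1 (by omega)
          rcases hr.eq_or_lt with h3 | h3
          · omega
          · have h4 := slot_lt_of_lt_slotRow (ρ := rows β) (a := I.1) (v := v) (s := r - 1)
              (by omega) (by omega)
            have h5 := slot_le H h1.1
            have := (hS v i (r - 1) hi (by omega)).2 (by omega)
            omega
        by_cases h3 : i = slot (rows β) I.1 v + 1
        · rw [if_pos ⟨h1.1, h1.2, h3⟩, List.length_append, List.length_singleton]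
          have h4 := key2 h3
          by_cases hs' : s = r
          · subst hs'
            rw [insertRow_same h1.1 h1.2]
            simp only [r] at *
            omega
          · rw [insertRow_of_ne hs', ← hc]
            omega
        · rw [if_neg (by tauto), hc]
          by_cases hs' : s = r
          · subst hs'
            rw [insertRow_same h1.1 h1.2]
            simp only [r] at *
            omega
          · rw [insertRow_of_ne hs']
      · rw [if_neg (by tauto), hc, insertRow, if_neg (by tauto)]

lemma le_length_lane_iff {β : List LowerInterval} (hβ : AreIntervals β) {v i s : ℕ} (hi : 1 ≤ i)
    (hs : 1 ≤ s) : s ≤ (lanes β i v).length ↔ i ≤ rows β v s :=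
  (lanes_areColumns hβ).2 v i s hi hs

lemma lane_ne_nil_iff {β : List LowerInterval} (hβ : AreIntervals β) {v i : ℕ} (hi : 1 ≤ i) :
    lanes β i v ≠ [] ↔ i ≤ rows β v 1 := by
  rw [← le_length_lane_iff hβ hi le_rfl, ← List.length_pos_iff]
  rfl

lemma lanes_append_singleton_apply {β : List LowerInterval} (hβ : AreIntervals β)
    {I : LowerInterval} (hI : I.1 ≤ I.2) (u v : ℕ) :
    lanes (β ++ [I]) u v =
      if I.1 ≤ v ∧ v ≤ I.2 ∧ u = slot (rows β) I.1 v + 1 then lanes β u v ++ [β.length]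
      else lanes β u v := by
  rw [lanes_append_singleton]
  exact (lanes_areColumns hβ).2.insert_apply (isRowSystem_rows β)
    (fun v => rows_le_length β v 1) hI u v

/-! ### Rigged partitions given by row lengths -/

/-- The strings of a partition with row lengths `f`, among its first `K` rows, in which every row
of length `l` has rigging `g l`. -/
def riggedRows (K : ℕ) (f : ℕ → ℕ) (g : ℕ → ℤ) : RiggedPartition :=
  ((Multiset.range K).map fun s => (f (s + 1), g (f (s + 1)))).filter fun x => 0 < x.1

/-- The rigged partition with row lengths `f` in which every row of length `l` has rigging `g l`:
in the rigged configurations of cascading sequences, rows of equal length have equal riggings. -/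
noncomputable def riggedPartition (f : ℕ → ℕ) (g : ℕ → ℤ) : RiggedPartition :=
  riggedRows (firstRow f 0) f g

lemma riggedRows_add {K : ℕ} {f : ℕ → ℕ} (hf : ∀ s, K < s → f s = 0) (g : ℕ → ℤ) (j : ℕ) :
    riggedRows (K + j) f g = riggedRows K f g := by
  induction j with
  | zero => rfl
  | succ j ih =>
    rw [← ih, riggedRows, ← add_assoc, Multiset.range_succ, Multiset.map_cons,
      Multiset.filter_cons_of_neg, riggedRows]
    simp [hf (K + j + 1) (by omega)]

lemma riggedRows_eq_of_bounds {K K' : ℕ} {f : ℕ → ℕ} (hf : ∀ s, K < s → f s = 0)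
    (hf' : ∀ s, K' < s → f s = 0) (g : ℕ → ℤ) : riggedRows K f g = riggedRows K' f g := by
  rcases le_total K K' with h | h
  · obtain ⟨j, rfl⟩ := Nat.exists_eq_add_of_le h
    exact (riggedRows_add hf g j).symm
  · obtain ⟨j, rfl⟩ := Nat.exists_eq_add_of_le h
    exact riggedRows_add hf' g j

/-- Row lengths of one partition: weakly decreasing and eventually zero. -/
structure IsRowList (f : ℕ → ℕ) : Prop where
  anti : ∀ s t, 1 ≤ s → s ≤ t → f t ≤ f s
  fin : ∃ K, ∀ s, K < s → f s = 0

lemma IsRowSystem.isRowList {ρ : RowLengths} (h : IsRowSystem ρ) (v : ℕ) : IsRowList (ρ v) :=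
  ⟨fun _ _ hs hst => h.anti_le v hs hst, h.fin v⟩

lemma IsRowList.eq_zero {f : ℕ → ℕ} (h : IsRowList f) {s : ℕ} (hs : firstRow f 0 < s) :
    f s = 0 := by
  obtain ⟨K, hK⟩ := h.fin
  have := Nat.sInf_mem (s := {s | 1 ≤ s ∧ f s ≤ 0})
    ⟨K + 1, by omega, by rw [hK (K + 1) (by omega)]⟩
  have h2 := h.anti (firstRow f 0) s this.1 hs.le
  have h3 : f (firstRow f 0) ≤ 0 := this.2
  omega

lemma riggedPartition_eq {K : ℕ} {f : ℕ → ℕ} (h : IsRowList f) (hf : ∀ s, K < s → f s = 0)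
    (g : ℕ → ℤ) : riggedPartition f g = riggedRows K f g :=
  riggedRows_eq_of_bounds (fun _ hs => h.eq_zero hs) hf g

lemma mem_riggedPartition {f : ℕ → ℕ} (h : IsRowList f) {g : ℕ → ℤ} {y : ℕ × ℤ} :
    y ∈ riggedPartition f g ↔ ∃ s, 1 ≤ s ∧ 0 < f s ∧ y = (f s, g (f s)) := by
  simp only [riggedPartition, riggedRows, Multiset.mem_filter, Multiset.mem_map,
    Multiset.mem_range]
  constructor
  · rintro ⟨⟨s, _, rfl⟩, h2⟩
    exact ⟨s + 1, by omega, h2, rfl⟩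
  · rintro ⟨s, h1, h2, rfl⟩
    refine ⟨⟨s - 1, ?_, by rw [Nat.sub_add_cancel h1]⟩, h2⟩
    have := mt (h.eq_zero (s := s)) (by omega)
    omega

lemma map_riggedPartition (f : ℕ → ℕ) {g g' : ℕ → ℤ} {φ : ℕ × ℤ → ℕ × ℤ}
    (hφ : ∀ s, 1 ≤ s → 0 < f s → φ (f s, g (f s)) = (f s, g' (f s))) :
    (riggedPartition f g).map φ = riggedPartition f g' := by
  rw [riggedPartition, riggedPartition, riggedRows, riggedRows, Multiset.filter_map,
    Multiset.filter_map, Multiset.map_map]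
  refine Multiset.map_congr rfl fun s hs => ?_
  exact hφ (s + 1) (by omega) (Multiset.mem_filter.1 hs).2

lemma riggedPartition_congr (f : ℕ → ℕ) {g g' : ℕ → ℤ}
    (h : ∀ s, 1 ≤ s → 0 < f s → g (f s) = g' (f s)) :
    riggedPartition f g = riggedPartition f g' := by
  rw [← map_riggedPartition f (φ := id) (g := g) (g' := g'), Multiset.map_id]
  intro s h1 h2
  simp [h s h1 h2]

lemma map_fst_riggedPartition (f : ℕ → ℕ) (g g' : ℕ → ℤ) :
    (riggedPartition f g).map Prod.fst = (riggedPartition f g').map Prod.fst := by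
  rw [← map_riggedPartition f (φ := fun x => (x.1, g' x.1)) (g := g) (g' := g')
    fun _ _ _ => rfl, Multiset.map_map]
  rfl

/-- Adding a box to the row `r` of a partition. -/
lemma cons_map_erase_riggedPartition {f : ℕ → ℕ} (h : IsRowList f) {g g' : ℕ → ℤ} {r : ℕ}
    (hr : 1 ≤ r) {φ : ℕ × ℤ → ℕ × ℤ} {x y : ℤ} (hx : x = g (f r))
    (hφ : ∀ s, 1 ≤ s → s ≠ r → 0 < f s → φ (f s, g (f s)) = (f s, g' (f s)))
    (hy : y = g' (f r + 1)) {f' : ℕ → ℕ} (hf' : IsRowList f')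
    (hff' : ∀ s, 1 ≤ s → f' s = if s = r then f r + 1 else f s) :
    (f r + 1, y) ::ₘ ((riggedPartition f g).erase (f r, x)).map φ = riggedPartition f' g' := by
  obtain ⟨K0, hK0⟩ := h.fin
  set K := max K0 r
  have hK : ∀ s, K < s → f s = 0 := fun s hs => hK0 s (by omega)
  have hK' : ∀ s, K < s → f' s = 0 := fun s hs => by
    rw [hff' s (by omega), if_neg (by omega), hK s hs]
  rw [riggedPartition_eq h hK, riggedPartition_eq hf' hK']
  have hrK : r - 1 ∈ Multiset.range K := Multiset.mem_range.2 (by omega)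
  have hrange := Multiset.cons_erase hrK
  have hnot : r - 1 ∉ (Multiset.range K).erase (r - 1) := by
    rw [(Multiset.nodup_range K).mem_erase_iff]; simp
  have hne : ∀ s ∈ (Multiset.range K).erase (r - 1), s + 1 ≠ r := by
    intro s hs he
    exact hnot (by rwa [show s = r - 1 by omega] at hs)
  set rest := (Multiset.range K).erase (r - 1)
  have e1 : (riggedRows K f g).erase (f r, x) =
      ((rest.map fun s => (f (s + 1), g (f (s + 1)))).filter fun x => 0 < x.1) := by
    rw [riggedRows, ← hrange, Multiset.map_cons, Nat.sub_add_cancel hr, hx]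
    by_cases h0 : 0 < f r
    · rw [Multiset.filter_cons_of_pos _ (by exact h0), Multiset.erase_cons_head]
    · rw [Multiset.filter_cons_of_neg _ (by exact h0), Multiset.erase_of_notMem]
      exact fun hm => h0 (Multiset.mem_filter.1 hm).2
  rw [e1, riggedRows, ← hrange, Multiset.map_cons, Nat.sub_add_cancel hr, hff' r hr, if_pos rfl,
    Multiset.filter_cons_of_pos _ (by simp), hy]
  congr 1
  rw [Multiset.filter_map, Multiset.filter_map, Multiset.map_map]
  have e2 : ∀ s ∈ rest, f' (s + 1) = f (s + 1) := fun s hs => by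
    rw [hff' _ (by omega), if_neg (hne s hs)]
  have e3 : rest.filter ((fun x : ℕ × ℤ => 0 < x.1) ∘ fun s => (f' (s + 1), g' (f' (s + 1)))) =
      rest.filter ((fun x : ℕ × ℤ => 0 < x.1) ∘ fun s => (f (s + 1), g (f (s + 1)))) :=
    Multiset.filter_congr fun s hs => by simp [e2 s hs]
  rw [e3]
  refine Multiset.map_congr rfl fun s hs => ?_
  obtain ⟨h1, h2⟩ := Multiset.mem_filter.1 hs
  rw [e2 s h1]
  exact hφ (s + 1) (by omega) (hne s h1) h2

lemma row_riggedPartition {f : ℕ → ℕ} (h : IsRowList f) {g : ℕ → ℤ} (hg : g 0 = 0) {b : ℕ}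
    (hb : 1 ≤ b) : row (riggedPartition f g) b = (f b, g (f b)) := by
  have key : ∀ K, (((List.range K).map fun s => (f (s + 1), g (f (s + 1)))).filter
      fun x => decide (0 < x.1)) = (List.range (min K (firstRow f 0 - 1))).map
        fun s => (f (s + 1), g (f (s + 1))) := by
    intro K
    induction K with
    | zero => simp
    | succ K ih =>
      rw [List.range_succ, List.map_append, List.filter_append, ih]
      by_cases hK : K < firstRow f 0 - 1
      · have h1 : 0 < f (K + 1) := lt_of_lt_firstRow (by omega) (by omega)
        rw [min_eq_left (by omega), min_eq_left (by omega), List.range_succ, List.map_append]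
        simp [h1]
      · have h1 : f (K + 1) = 0 := by
          obtain ⟨K', hK'⟩ := h.fin
          have h3 := Nat.sInf_mem (s := {s | 1 ≤ s ∧ f s ≤ 0})
            ⟨K' + 1, by omega, by rw [hK' (K' + 1) (by omega)]⟩
          have h4 : f (firstRow f 0) ≤ 0 := h3.2
          have h5 : 1 ≤ firstRow f 0 := h3.1
          have := h.anti (firstRow f 0) (K + 1) h5 (by omega)
          omega
        rw [min_eq_right (by omega), min_eq_right (by omega)]
        simp [h1]
  set N := firstRow f 0 - 1
  set L : List (ℕ × ℤ) := (List.range N).map fun s => (f (s + 1), g (f (s + 1)))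
  have e1 : riggedPartition f g = (L : Multiset (ℕ × ℤ)) := by
    rw [riggedPartition, riggedRows, ← Multiset.coe_range, Multiset.map_coe, Multiset.filter_coe,
      key, min_eq_right (by omega)]
  have hsorted : (L.map toLex).Pairwise (· ≥ ·) := by
    rw [List.pairwise_map, List.pairwise_map]
    refine List.pairwise_lt_range.imp fun {s t} hst => ?_
    have := h.anti (s + 1) (t + 1) (by omega) (by omega)
    rcases this.eq_or_lt with h1 | h1
    · rw [h1]
    · exact (Prod.Lex.toLex_lt_toLex.2 (Or.inl h1)).le
  have e2 : ((riggedPartition f g).map toLex).sort (· ≥ ·) = L.map toLex := by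
    rw [e1, Multiset.map_coe]
    refine List.Perm.eq_of_pairwise' (r := (· ≥ ·)) (Multiset.pairwise_sort _ _) hsorted ?_
    rw [← Multiset.coe_eq_coe, Multiset.sort_eq]
  rw [row, e2, List.map_map]
  have e3 : L.map (ofLex ∘ toLex) = L := by
    rw [show (ofLex ∘ toLex : ℕ × ℤ → ℕ × ℤ) = id from rfl, List.map_id]
  rw [e3, List.getD_eq_getElem?_getD, List.getElem?_map]
  by_cases hbN : b - 1 < N
  · rw [List.getElem?_range hbN]
    simp [Nat.sub_add_cancel hb]
  · rw [List.getElem?_eq_none (by simpa using hbN)]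
    have h1 : f b = 0 := by
      obtain ⟨K', hK'⟩ := h.fin
      have h3 := Nat.sInf_mem (s := {s | 1 ≤ s ∧ f s ≤ 0})
        ⟨K' + 1, by omega, by rw [hK' (K' + 1) (by omega)]⟩
      have h4 : f (firstRow f 0) ≤ 0 := h3.2
      have := h.anti (firstRow f 0) b h3.1 (by omega)
      omega
    simp [h1, hg]

/-! ### The Kashiwara operators on rigged partitions given by row lengths -/

lemma fold_min_eq {μ : Multiset ℤ} {x : ℤ} (hx : x ≤ 0) (hle : ∀ y ∈ μ, x ≤ y)
    (hmem : x = 0 ∨ x ∈ μ) : μ.fold min 0 = x := by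
  have h1 : ∀ ν : Multiset ℤ, (∀ y ∈ ν, x ≤ y) → x ≤ ν.fold min 0 := by
    intro ν
    induction ν using Multiset.induction with
    | empty => intro _; simpa using hx
    | cons a ν ih =>
      intro h
      rw [Multiset.fold_cons_left]
      exact le_min (h a (by simp)) (ih fun y hy => h y (by simp [hy]))
  have h2 : ∀ ν : Multiset ℤ, ν.fold min 0 ≤ 0 ∧ ∀ y ∈ ν, ν.fold min 0 ≤ y := by
    intro ν
    induction ν using Multiset.induction with
    | empty => simp
    | cons a ν ih =>
      rw [Multiset.fold_cons_left]
      refine ⟨(min_le_right _ _).trans ih.1, fun y hy => ?_⟩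
      rcases Multiset.mem_cons.1 hy with rfl | hy
      · exact min_le_left _ _
      · exact (min_le_right _ _).trans (ih.2 y hy)
  refine le_antisymm ?_ (h1 μ hle)
  rcases hmem with rfl | hm
  · exact (h2 μ).1
  · exact (h2 μ).2 x hm

lemma cartanA_comm (a b : ℕ) : cartanA a b = cartanA b a := by
  unfold cartanA
  by_cases h : a = b
  · simp [h]
  · simp only [h, Ne.symm h, if_false, or_comm]

/-- The change of the vacancy numbers caused by a new box in a row of length `l` of the `a`-th
partition. -/
lemma vacancy_update_sub {n a : ℕ} (ha : a ∈ Finset.Icc 1 n) (R : RiggedConfig) {l : ℕ} {x y : ℤ}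
    (hl : l = 0 ∨ (l, x) ∈ R a) (b i : ℕ) :
    vacancy n (Function.update R a ((l + 1, y) ::ₘ (R a).erase (l, x))) b i - vacancy n R b i =
      -(cartanA a b * if l < i then 1 else 0) := by
  unfold vacancy
  rw [neg_sub_neg, ← Finset.sum_sub_distrib, Finset.sum_eq_single a]
  · rw [Function.update_self, Multiset.map_cons, Multiset.sum_cons, cartanA_comm b a]
    have e : ((min i (l + 1) : ℕ) : ℤ) = (min i l : ℕ) + if l < i then 1 else 0 := by
      split_ifs <;> omega
    by_cases hm : (l, x) ∈ R a
    · conv_lhs => rw [← Multiset.cons_erase hm]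
      rw [Multiset.map_cons, Multiset.sum_cons, Multiset.erase_cons_head]
      simp only [e]
      ring
    · obtain rfl : l = 0 := hl.resolve_right hm
      rw [Multiset.erase_of_notMem hm]
      simp only [e]
      simp
  · intro c _ hc
    rw [Function.update_of_ne hc, sub_self]
  · exact fun h => absurd ha h

/-- One application of a Kashiwara operator. The row `r` of the `a`-th partition, of length `d`,
is the topmost row of its length; its rigging `x` is minimal, and all longer rows have rigging
`x + 1`. Then `f_a` adds a box to the row `r`. -/
theorem kashiwaraF_riggedPartition {n a : ℕ} (ha : a ∈ Finset.Icc 1 n) {R : RiggedConfig}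
    {ρ : RowLengths} {g : ℕ → ℕ → ℤ} (hR : ∀ v, R v = riggedPartition (ρ v) (g v))
    (H : IsRowSystem ρ) {r : ℕ} (hr : 1 ≤ r) {d : ℕ} (hd : ρ a r = d)
    (htop : ∀ s, 1 ≤ s → s < r → d < ρ a s) {x : ℤ} (hx : g a d = x) (hx0 : x ≤ 0)
    (hzero : d = 0 → x = 0) (hgt : ∀ s, 1 ≤ s → d < ρ a s → g a (ρ a s) = x + 1)
    (hle : ∀ s, 1 ≤ s → 0 < ρ a s → ρ a s ≤ d → x ≤ g a (ρ a s)) (v : ℕ) :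
    kashiwaraF n a R v =
      riggedPartition (fun s => if v = a ∧ s = r then ρ v s + 1 else ρ v s)
        (fun l => if v = a then (if d < l then x - 1 else g v l)
          else if v = a + 1 ∨ a = v + 1 then (if d < l then g v l + 1 else g v l) else g v l) := by
  have hlow : lowLabel (R a) = x := by
    refine fold_min_eq hx0 ?_ ?_
    · intro y hy
      obtain ⟨z, hz, rfl⟩ := Multiset.mem_map.1 hy
      rw [hR, mem_riggedPartition (H.isRowList a)] at hz
      obtain ⟨s, hs, hpos, rfl⟩ := hz
      by_cases h : d < ρ a s
      · simp only [hgt s hs h]; omega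
      · exact hle s hs hpos (not_lt.1 h)
    · rcases Nat.eq_zero_or_pos d with h | h
      · exact Or.inl (hzero h)
      · refine Or.inr (Multiset.mem_map.2 ⟨(d, x), ?_, rfl⟩)
        rw [hR, mem_riggedPartition (H.isRowList a)]
        exact ⟨r, hr, by omega, by rw [hd, hx]⟩
  have hgrow : growLength (R a) = d := by
    rw [growLength, hlow]
    refine le_antisymm (Multiset.sup_le.2 fun l hl => ?_) ?_
    · obtain ⟨z, hz, rfl⟩ := Multiset.mem_map.1 hl
      obtain ⟨hz, hzx⟩ := Multiset.mem_filter.1 hz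
      rw [hR, mem_riggedPartition (H.isRowList a)] at hz
      obtain ⟨s, hs, hpos, rfl⟩ := hz
      by_contra hc
      have := hgt s hs (not_le.1 hc)
      simp only [this] at hzx
      omega
    · rcases Nat.eq_zero_or_pos d with h | h
      · omega
      · refine Multiset.le_sup (Multiset.mem_map.2 ⟨(d, x), Multiset.mem_filter.2 ⟨?_, rfl⟩, rfl⟩)
        rw [hR, mem_riggedPartition (H.isRowList a)]
        exact ⟨r, hr, by omega, by rw [hd, hx]⟩
  have hmem : d = 0 ∨ (d, x) ∈ R a := by
    rcases Nat.eq_zero_or_pos d with h | h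
    · exact Or.inl h
    · rw [hR, mem_riggedPartition (H.isRowList a)]
      exact Or.inr ⟨r, hr, by omega, by rw [hd, hx]⟩
  rw [kashiwaraF]
  simp only [hlow, hgrow, vacancy_update_sub ha R hmem]
  by_cases hv : v = a
  · subst hv
    simp only [if_true, true_and]
    have hf' : IsRowList fun s => if s = r then ρ v s + 1 else ρ v s := by
      refine ⟨fun s t hs hst => ?_, ?_⟩
      · have h1 := H.anti_le v hs hst
        by_cases ht : t = r
        · by_cases hs' : s = r
          · simp [ht, hs']
          · have := htop s hs (by omega)
            simp only [ht, hs', if_true, if_false]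
            omega
        · simp only [ht, if_false]
          split_ifs <;> omega
      · obtain ⟨K, hK⟩ := H.fin v
        refine ⟨max K r, fun s hs => ?_⟩
        rw [if_neg (by omega), hK s (by omega)]
    have := cons_map_erase_riggedPartition (H.isRowList v) (g := g v)
      (g' := fun l => if d < l then x - 1 else g v l) (x := x) (y := x - 1) hr
      (φ := fun s => (s.1, s.2 + -(cartanA v v * if d < s.1 then 1 else 0)))
      (by rw [hd, hx]) ?_ (by simp [hd]) hf' ?_
    · rw [← hR v, hd] at this
      exact this
    · intro s hs _ _
      by_cases h : d < ρ v s
      · simp only [h, if_true, hgt s hs h, cartanA]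
        ext <;> simp
        ring
      · simp [h]
    · intro s _
      by_cases hs : s = r
      · simp [hs]
      · simp [hs]
  · simp only [hv, if_false, false_and]
    rw [hR v]
    refine map_riggedPartition _ fun s _ _ => ?_
    unfold cartanA
    simp only [Ne.symm hv, if_false]
    by_cases h1 : v = a + 1 ∨ a = v + 1
    · rw [if_pos h1, if_pos (by omega)]
      by_cases h : d < ρ v s <;> simp [h]
    · rw [if_neg h1, if_neg (by omega)]
      simp

/-! ### The rigged configuration of a cascading sequence -/

/-- The head of the interval at position `t`. -/
def headAt (β : List LowerInterval) (t : ℕ) : ℕ := (β.getD t (0, 0)).1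

/-- The tail of the interval at position `t`. -/
def tailAt (β : List LowerInterval) (t : ℕ) : ℕ := (β.getD t (0, 0)).2

/-- The length of the row that receives the entry `v` of the interval at position `t`, before the
insertion of this interval. The entry belongs to the lane with the next number. -/
noncomputable def slotAt (β : List LowerInterval) (t v : ℕ) : ℕ :=
  slot (rows (β.take t)) (headAt β t) v

/-- The rigging of the rows of length `l` of the `v`-th partition: an interval contributes only
through its tail, namely `-1` to the rows of the partition of the tail, and `+1` to the rows of the
next partition, that are longer than the slot of the tail. -/
noncomputable def rigging (β : List LowerInterval) (v l : ℕ) : ℤ :=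
  ∑ t ∈ Finset.range β.length,
    ((if tailAt β t + 1 = v ∧ slotAt β t (tailAt β t) < l then 1 else 0) -
      if tailAt β t = v ∧ slotAt β t (tailAt β t) < l then 1 else 0)

section append

variable (β γ : List LowerInterval) {t : ℕ}

lemma headAt_append (ht : t < β.length) : headAt (β ++ γ) t = headAt β t := by
  rw [headAt, headAt, List.getD_append _ _ _ _ ht]

lemma tailAt_append (ht : t < β.length) : tailAt (β ++ γ) t = tailAt β t := by
  rw [tailAt, tailAt, List.getD_append _ _ _ _ ht]

lemma slotAt_append (ht : t < β.length) (v : ℕ) : slotAt (β ++ γ) t v = slotAt β t v := by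
  rw [slotAt, slotAt, headAt_append β γ ht, List.take_append_of_le_length ht.le]

lemma headAt_length (I : LowerInterval) : headAt (β ++ [I]) β.length = I.1 := by
  simp [headAt]

lemma tailAt_length (I : LowerInterval) : tailAt (β ++ [I]) β.length = I.2 := by
  simp [tailAt]

lemma slotAt_length (I : LowerInterval) (v : ℕ) :
    slotAt (β ++ [I]) β.length v = slot (rows β) I.1 v := by
  rw [slotAt, headAt_length, List.take_left]

end append

lemma getElem?_eq_some_headAt_tailAt {β : List LowerInterval} {t : ℕ} (ht : t < β.length) :
    β[t]? = some (headAt β t, tailAt β t) := by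
  rw [List.getElem?_eq_getElem ht, headAt, tailAt, List.getD_eq_getElem _ _ ht]

lemma headAt_tailAt_mem {β : List LowerInterval} {t : ℕ} (ht : t < β.length) :
    (headAt β t, tailAt β t) ∈ β :=
  List.mem_of_getElem? (getElem?_eq_some_headAt_tailAt ht)

lemma rigging_append_singleton (β : List LowerInterval) (I : LowerInterval) (v l : ℕ) :
    rigging (β ++ [I]) v l = rigging β v l +
      ((if I.2 + 1 = v ∧ slot (rows β) I.1 I.2 < l then 1 else 0) -
        if I.2 = v ∧ slot (rows β) I.1 I.2 < l then 1 else 0) := by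
  rw [rigging, List.length_append, List.length_singleton, Finset.sum_range_succ, tailAt_length,
    slotAt_length]
  congr 1
  refine Finset.sum_congr rfl fun t ht => ?_
  have ht := Finset.mem_range.1 ht
  rw [tailAt_append β _ ht, slotAt_append β _ ht]

lemma IsCascading.of_append {n : ℕ} {β γ : List LowerInterval} (h : IsCascading n (β ++ γ)) :
    IsCascading n β :=
  ⟨fun I hI => h.1 I (List.mem_append_left _ hI), (List.pairwise_append.1 h.2).1⟩

lemma IsCascading.lt_or_of_append {n : ℕ} {β : List LowerInterval} {I : LowerInterval}
    (h : IsCascading n (β ++ [I])) {J : LowerInterval} (hJ : J ∈ β) :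
    I.2 < J.2 ∨ (I.2 = J.2 ∧ J.1 ≤ I.1) :=
  (List.pairwise_append.1 h.2).2.2 J hJ I (by simp)

lemma slot_lt_slot_insertRow {ρ : RowLengths} (H : IsRowSystem ρ) {a b m : ℕ} (hab : a ≤ b) :
    ∀ v, b ≤ v → v ≤ m → slot ρ a v < slot (insertRow ρ (a, m)) b v := by
  have H' := H.insertRow (a, m)
  intro v hv
  induction v, hv using Nat.le_induction with
  | base =>
    intro hm
    have h1 := insertRow_same (ρ := ρ) (I := (a, m)) hab hm
    have h2 := H'.anti_le b le_rfl (one_le_slotRow H a b)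
    have h3 := slot_eq H hab
    simp only [] at h1 h2
    rw [slot_of_le _ le_rfl]
    omega
  | succ v hv ih =>
    intro hm
    have ih := ih (by omega)
    have h1 := insertRow_same (ρ := ρ) (I := (a, m)) (v := v + 1) (by simp; omega) hm
    have h3 := slot_eq H (show a ≤ v + 1 by omega)
    have h4 := slot_le H (show a ≤ v + 1 by omega)
    simp only [Nat.add_sub_cancel] at h1 h4
    have h5 : slotRow (insertRow ρ (a, m)) b (v + 1) ≤ slotRow ρ a (v + 1) :=
      slotRow_le (one_le_slotRow H _ _) (by rw [Nat.add_sub_cancel]; omega)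
    have h6 := H'.anti_le (v + 1) (one_le_slotRow H' b (v + 1)) h5
    rw [slot_eq H' (show b ≤ v + 1 by omega)]
    omega

/-- The slots of intervals with equal tail increase from left to right. -/
lemma IsCascading.slotAt_lt {n : ℕ} {β : List LowerInterval} {I : LowerInterval}
    (h : IsCascading n (β ++ [I])) {t : ℕ} (ht : t < β.length) (htail : tailAt β t = I.2) :
    slotAt β t (tailAt β t) < slot (rows β) I.1 I.2 := by
  induction β using List.reverseRecOn generalizing I with
  | nil => simp at ht
  | append_singleton β J ih =>
    have hlast := h.lt_or_of_append (J := J) (by simp)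
    have hI := h.1 I (by simp)
    have H := isRowSystem_rows β
    rw [List.length_append, List.length_singleton] at ht
    have hJI : I.2 = J.2 → J.1 ≤ I.1 → slot (rows β) J.1 J.2 < slot (rows (β ++ [J])) I.1 I.2 := by
      intro h1 h2
      rw [rows_append_singleton, h1]
      exact slot_lt_slot_insertRow H (m := J.2) h2 J.2 (by omega) le_rfl
    rcases (show t ≤ β.length by omega).eq_or_lt with rfl | ht'
    · rw [tailAt_length] at htail
      rw [tailAt_length, slotAt_length]
      exact hJI htail.symm (by omega)
    · rw [tailAt_append β _ ht'] at htail
      rw [tailAt_append β _ ht', slotAt_append β _ ht']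
      have h3 := h.of_append.lt_or_of_append (headAt_tailAt_mem ht')
      simp only [htail] at h3
      have h4 := ih h.of_append ht' (by omega)
      exact h4.trans (hJI (by omega) (by omega))

lemma rigging_eq_neg_sum {β : List LowerInterval} {v : ℕ} (hβ : ∀ I ∈ β, v ≤ I.2) (l : ℕ) :
    rigging β v l = -∑ t ∈ Finset.range β.length,
      if tailAt β t = v ∧ slotAt β t (tailAt β t) < l then 1 else 0 := by
  rw [rigging, ← Finset.sum_neg_distrib]
  refine Finset.sum_congr rfl fun t ht => ?_
  have := hβ _ (headAt_tailAt_mem (Finset.mem_range.1 ht))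
  rw [if_neg (by simp only [] at this; omega), zero_sub]

lemma rigging_zero_right (β : List LowerInterval) (v : ℕ) : rigging β v 0 = 0 := by
  simp [rigging]

lemma rigging_nonpos {β : List LowerInterval} {v : ℕ} (hβ : ∀ I ∈ β, v ≤ I.2) (l : ℕ) :
    rigging β v l ≤ 0 := by
  rw [rigging_eq_neg_sum hβ, neg_nonpos]
  exact Finset.sum_nonneg fun t _ => by split_ifs <;> simp

lemma rigging_anti {β : List LowerInterval} {v : ℕ} (hβ : ∀ I ∈ β, v ≤ I.2) {l l' : ℕ}
    (h : l ≤ l') : rigging β v l' ≤ rigging β v l := by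
  rw [rigging_eq_neg_sum hβ, rigging_eq_neg_sum hβ, neg_le_neg_iff]
  refine Finset.sum_le_sum fun t _ => ?_
  split_ifs <;> omega

/-- The rigging is constant above the slots of all intervals with tail `v`. -/
lemma rigging_eq_of_le {β : List LowerInterval} {v d : ℕ} (hβ : ∀ I ∈ β, v ≤ I.2)
    (hd : ∀ t < β.length, tailAt β t = v → slotAt β t (tailAt β t) < d) {l : ℕ} (h : d ≤ l) :
    rigging β v l = rigging β v d := by
  rw [rigging_eq_neg_sum hβ, rigging_eq_neg_sum hβ]
  congr 1
  refine Finset.sum_congr rfl fun t ht => ?_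
  have := hd t (Finset.mem_range.1 ht)
  split_ifs <;> first | rfl | omega

lemma toSeq_append_singleton (β : List LowerInterval) (I : LowerInterval) :
    toSeq (β ++ [I]) = toSeq β ++ List.range' I.1 (I.2 + 1 - I.1) := by
  simp [toSeq]

/-- A single letter of an interval acts by adding a box to the row of length `slot ρ a v`. -/
lemma kashiwaraF_entry {n : ℕ} {β : List LowerInterval} {a m : ℕ}
    (h : IsCascading n (β ++ [(a, m)])) {v : ℕ} (hav : a ≤ v) (hvm : v ≤ m) {R : RiggedConfig}
    {ρ : RowLengths} {g : ℕ → ℕ → ℤ} (hR : ∀ w, R w = riggedPartition (ρ w) (g w))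
    (H : IsRowSystem ρ) (hρ : ρ v = rows β v)
    (hg : ∀ s, 1 ≤ s → g v (rows β v s) = rigging β v (rows β v s) +
      if slot (rows β) a (v - 1) < rows β v s then 1 else 0) (w : ℕ) :
    kashiwaraF n v R w =
      riggedPartition (fun s => if w = v ∧ s = slotRow (rows β) a v then ρ w s + 1 else ρ w s)
        (fun l => if w = v then rigging β v l - (if slot (rows β) a v < l then 1 else 0)
          else if w = v + 1 ∨ v = w + 1 then g w l + (if slot (rows β) a v < l then 1 else 0)
          else g w l) := by
  have Hβ := isRowSystem_rows β
  have hI := h.1 (a, m) (by simp)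
  simp only [] at hI
  have hβ : ∀ I ∈ β, v ≤ I.2 := fun I hI => by
    have := h.lt_or_of_append hI
    simp only [] at this
    omega
  have hslots : ∀ t < β.length, tailAt β t = v → slotAt β t (tailAt β t) < slot (rows β) a v := by
    intro t ht htv
    have h1 := h.lt_or_of_append (headAt_tailAt_mem ht)
    simp only [htv] at h1
    obtain rfl : v = m := by omega
    exact h.slotAt_lt ht htv
  set d := slot (rows β) a v with hd
  set d' := slot (rows β) a (v - 1) with hd'
  have hdd' : d ≤ d' := slot_le Hβ hav
  have hdr : rows β v (slotRow (rows β) a v) = d := (slot_eq Hβ hav).symm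
  set r := slotRow (rows β) a v with hr
  have h1r : 1 ≤ r := one_le_slotRow Hβ a v
  have hlt : ∀ s, 1 ≤ s → s < r → d' < rows β v s := fun s hs hsr => slot_lt_of_lt_slotRow hs hsr
  have hlong : ∀ s, 1 ≤ s → d < rows β v s → d' < rows β v s := fun s hs hsd => by
    refine hlt s hs (not_le.1 fun hc => ?_)
    have := Hβ.anti_le v h1r hc
    omega
  have hgd : g v d = rigging β v d := by
    have := hg r h1r
    rw [hdr, if_neg (by omega), add_zero] at this
    exact this
  rw [kashiwaraF_riggedPartition (a := v) (Finset.mem_Icc.2 ⟨by omega, by omega⟩) hR H h1r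
    (by rw [hρ, hdr])
    (fun s hs hsr => by rw [hρ]; exact hdd'.trans_lt (hlt s hs hsr)) hgd (rigging_nonpos hβ d)
    (fun h0 => by rw [h0, rigging_zero_right])
    (fun s hs hsd => by
      rw [hρ] at hsd ⊢
      rw [hg s hs, if_pos (hlong s hs hsd), rigging_eq_of_le hβ hslots hsd.le])
    (fun s hs _ hsd => by
      rw [hρ] at hsd ⊢
      rw [hg s hs, if_neg (by omega), add_zero]
      exact rigging_anti hβ hsd) w]
  refine riggedPartition_congr _ fun s hs _ => ?_
  by_cases hw : w = v
  · subst hw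
    simp only [if_true, true_and]
    by_cases hsr : s = r
    · rw [if_pos hsr, hρ, hsr, hdr, if_pos (by omega), if_pos (by omega),
        rigging_eq_of_le hβ hslots (Nat.le_succ d)]
    · rw [if_neg hsr, hρ]
      by_cases hsd : d < rows β w s
      · rw [if_pos hsd, if_pos hsd, rigging_eq_of_le hβ hslots hsd.le]
      · rw [if_neg hsd, if_neg hsd, hg s hs, if_neg (by omega)]
        ring
  · simp only [hw, if_false, false_and]
    by_cases hw' : w = v + 1 ∨ v = w + 1
    · rw [if_pos hw', if_pos hw']
      split_ifs <;> simp
    · rw [if_neg hw', if_neg hw']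

lemma foldl_kashiwaraF_interval {n : ℕ} {β : List LowerInterval} {a m : ℕ}
    (h : IsCascading n (β ++ [(a, m)])) {R : RiggedConfig}
    (hR : ∀ w, R w = riggedPartition (rows β w) (rigging β w)) (k : ℕ) : a + k ≤ m → ∀ w,
    (List.range' a (k + 1)).foldl (fun R a => kashiwaraF n a R) R w =
      riggedPartition (rows (β ++ [(a, a + k)]) w) (rigging (β ++ [(a, a + k)]) w) := by
  have Hβ := isRowSystem_rows β
  have htails : ∀ I ∈ β, m ≤ I.2 := fun I hI => by
    have := h.lt_or_of_append hI
    simp only [] at this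
    omega
  have ha1 : 1 ≤ a := (h.1 (a, m) (by simp)).1
  induction k with
  | zero =>
    intro ham w
    have hself := slotRow_self Hβ a
    have hsl := slot_of_le (rows β) (le_refl a)
    have hsl' := slot_of_le (rows β) (show a - 1 ≤ a by omega)
    rw [List.range'_one, List.foldl_cons, List.foldl_nil,
      kashiwaraF_entry h le_rfl (by omega) hR Hβ rfl (fun s hs => by
        rw [hsl', if_neg (by have := Hβ.anti_le a le_rfl hs; omega), add_zero]), hself, hsl]
    have e : (fun s => if w = a ∧ s = 1 then rows β w s + 1 else rows β w s) =
        rows (β ++ [(a, a + 0)]) w := by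
      funext s
      rw [rows_append_singleton, insertRow]
      by_cases hw : w = a
      · subst hw; simp [hself]
      · rw [if_neg (by tauto), if_neg (by simp; omega)]
    rw [e]
    refine riggedPartition_congr _ fun s hs _ => ?_
    rw [rigging_append_singleton]
    simp only [Nat.add_zero, hsl]
    generalize hl : rows (β ++ [(a, a + 0)]) w s = l
    by_cases hw : w = a
    · subst hw
      simp
      ring
    · rw [if_neg hw]
      by_cases hw' : w = a + 1
      · subst hw'; simp
      · by_cases hw2 : a = w + 1
        · have hle : l ≤ rows β a 1 := by
            rw [← hl, rows_append_singleton, insertRow_of_lt (by simp; omega), hw2]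
            exact (Hβ.anti_le w le_rfl hs).trans
              (rows_le_succ (fun I hI => by have := htails I hI; omega) le_rfl)
          rw [if_pos (Or.inr hw2), if_neg (by omega), if_neg (by omega), if_neg (by omega)]
          simp
        · rw [if_neg (by omega), if_neg (by omega), if_neg (by omega)]
          simp
  | succ k ih =>
    intro hkm w
    have ih := ih (by omega)
    rw [List.range'_concat, List.foldl_append, List.foldl_cons, List.foldl_nil, one_mul]
    have e0 : rows (β ++ [(a, a + k)]) (a + (k + 1)) = rows β (a + (k + 1)) := by
      funext s
      rw [rows_append_singleton, insertRow_of_gt (by simp)]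
    rw [kashiwaraF_entry h (by omega) hkm ih (isRowSystem_rows _) e0 (fun s hs => by
      rw [rigging_append_singleton]
      simp only []
      rw [show a + (k + 1) - 1 = a + k by omega]
      congr 1
      simp [add_assoc])]
    have e : (fun s => if w = a + (k + 1) ∧ s = slotRow (rows β) a (a + (k + 1))
          then rows (β ++ [(a, a + k)]) w s + 1 else rows (β ++ [(a, a + k)]) w s) =
        rows (β ++ [(a, a + (k + 1))]) w := by
      funext s
      rw [rows_append_singleton, rows_append_singleton, insertRow, insertRow]
      by_cases hw : w = a + (k + 1)
      · subst hw
        simp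
      · rw [if_neg (by tauto)]
        congr 1
        simp only [eq_iff_iff]
        omega
    rw [e]
    refine riggedPartition_congr _ fun s hs _ => ?_
    rw [rigging_append_singleton, rigging_append_singleton]
    simp only []
    generalize hl : rows (β ++ [(a, a + (k + 1))]) w s = l
    set d := slot (rows β) a (a + (k + 1)) with hd
    set d' := slot (rows β) a (a + k) with hd'
    by_cases hw : w = a + (k + 1)
    · subst hw
      rw [if_pos rfl]
      simp
      ring
    · rw [if_neg hw]
      by_cases hw' : w = a + (k + 1) + 1
      · subst hw'
        simp
        omega
      · by_cases hw2 : w = a + k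
        · subst hw2
          -- no row has a length between the slots of two consecutive entries
          have hno : d' < l ↔ d < l := by
            have hdd : d ≤ d' := slot_le Hβ (show a ≤ a + (k + 1) by omega)
            refine ⟨fun h => by omega, fun hdl => ?_⟩
            have hr := slot_eq Hβ (show a ≤ a + k by omega)
            have h1r := one_le_slotRow Hβ a (a + k)
            rw [rows_append_singleton, insertRow] at hl
            simp only [] at hl
            set r := slotRow (rows β) a (a + k)
            by_cases hsr : s = r
            · rw [if_pos ⟨by omega, by omega, hsr⟩, hsr] at hl
              omega
            · rw [if_neg (by tauto)] at hl
              rcases lt_or_gt_of_ne hsr with h1 | h1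
              · have := slot_lt_of_lt_slotRow hs h1
                have := slot_le Hβ (show a ≤ a + k by omega)
                omega
              · exfalso
                have h2 := Hβ.anti_le (a + k) (by omega) (show r + 1 ≤ s from h1)
                have h3 := rows_le_succ (β := β) (v := a + k)
                  (fun I hI => by have := htails I hI; omega) (show 1 ≤ r + 1 by omega)
                have h4 := rows_succ_succ_le β (a + k) h1r
                -- the next entry goes into the row `r` or `r + 1`
                have h5 : slotRow (rows β) a (a + k + 1) ≤ r + 1 :=
                  slotRow_le (by omega) (by rw [Nat.add_sub_cancel, hr]; exact h4)
                have h6 := Hβ.anti_le (a + k + 1) (one_le_slotRow Hβ a (a + k + 1)) h5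
                have h7 := slot_eq Hβ (show a ≤ a + k + 1 by omega)
                have h8 : d = slot (rows β) a (a + k + 1) := rfl
                omega
          simp only [hno]
          rw [if_pos (by omega)]
          simp
          omega
        · rw [if_neg (by omega), if_neg (by omega), if_neg (by omega), if_neg (by omega),
            if_neg (by omega)]

/-- The rows of the rigged configuration of a cascading sequence are those given by the lanes, and
the riggings are contributed by the tails of the intervals. -/
theorem riggedConfig_eq {n : ℕ} {β : List LowerInterval} (h : IsCascading n β) (v : ℕ) :
    riggedConfig n β v = riggedPartition (rows β v) (rigging β v) := by
  induction β using List.reverseRecOn generalizing v with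
  | nil =>
    refine (Multiset.eq_zero_of_forall_notMem fun y hy => ?_).symm
    rw [mem_riggedPartition ((isRowSystem_rows []).isRowList v)] at hy
    obtain ⟨s, _, h2, _⟩ := hy
    simp at h2
  | append_singleton β I ih =>
    obtain ⟨a, m⟩ := I
    have hI := h.1 (a, m) (by simp)
    simp only [] at hI
    have := foldl_kashiwaraF_interval h (R := riggedConfig n β) (ih h.of_append) (m - a)
      (by omega) v
    rw [show a + (m - a) = m by omega] at this
    rw [← this, riggedConfig, toSeq_append_singleton, List.foldl_append]
    simp only []
    rw [show m + 1 - a = m - a + 1 by omega]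
    rfl

/-! ### The entries of the lanes -/

/-- The row that receives the entry `v` of the interval at position `t`. -/
noncomputable def rowAt (β : List LowerInterval) (t v : ℕ) : ℕ :=
  slotRow (rows (β.take t)) (headAt β t) v

lemma rowAt_append (β γ : List LowerInterval) {t : ℕ} (ht : t < β.length) (v : ℕ) :
    rowAt (β ++ γ) t v = rowAt β t v := by
  rw [rowAt, rowAt, headAt_append β γ ht, List.take_append_of_le_length ht.le]

lemma rowAt_length (β : List LowerInterval) (I : LowerInterval) (v : ℕ) :
    rowAt (β ++ [I]) β.length v = slotRow (rows β) I.1 v := by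
  rw [rowAt, headAt_length, List.take_left]

lemma take_succ_eq {β : List LowerInterval} {t : ℕ} (ht : t < β.length) :
    β.take (t + 1) = β.take t ++ [(headAt β t, tailAt β t)] := by
  rw [List.take_add_one, getElem?_eq_some_headAt_tailAt ht]
  rfl

lemma rows_take_succ {β : List LowerInterval} {t : ℕ} (ht : t < β.length) :
    rows (β.take (t + 1)) = insertRow (rows (β.take t)) (headAt β t, tailAt β t) := by
  rw [take_succ_eq ht, rows_append_singleton]

/-- The row lengths after one more interval. -/
lemma rows_take_succ_apply {β : List LowerInterval} {t : ℕ} (ht : t < β.length) (v s : ℕ) :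
    rows (β.take (t + 1)) v s =
      if headAt β t ≤ v ∧ v ≤ tailAt β t ∧ s = rowAt β t v then rows (β.take t) v s + 1
      else rows (β.take t) v s := by
  rw [rows_take_succ ht]
  rfl

lemma slotAt_eq {β : List LowerInterval} {t v : ℕ} (hv : headAt β t ≤ v) :
    slotAt β t v = rows (β.take t) v (rowAt β t v) :=
  slot_eq (isRowSystem_rows _) hv

lemma one_le_rowAt (β : List LowerInterval) (t v : ℕ) : 1 ≤ rowAt β t v :=
  one_le_slotRow (isRowSystem_rows _) _ _

lemma rowAt_headAt (β : List LowerInterval) (t : ℕ) : rowAt β t (headAt β t) = 1 :=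
  slotRow_self (isRowSystem_rows _) _

lemma slotAt_headAt (β : List LowerInterval) (t : ℕ) :
    slotAt β t (headAt β t) = rows (β.take t) (headAt β t) 1 :=
  slot_of_le _ le_rfl

lemma rows_take_mono (β : List LowerInterval) {t t' : ℕ} (h : t ≤ t') (v s : ℕ) :
    rows (β.take t) v s ≤ rows (β.take t') v s := by
  induction t', h using Nat.le_induction with
  | base => exact le_rfl
  | succ t' h ih =>
    refine ih.trans ?_
    rcases lt_or_ge t' β.length with hl | hl
    · rw [rows_take_succ_apply hl]
      split_ifs <;> omega
    · rw [List.take_of_length_le hl, List.take_of_length_le (by omega)]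

lemma length_lane_slot {β : List LowerInterval} (hβ : AreIntervals β) {a v : ℕ} (hv : a ≤ v) :
    (lanes β (slot (rows β) a v + 1) v).length + 1 = slotRow (rows β) a v := by
  have H := isRowSystem_rows β
  have e := slot_eq H hv
  have hr := one_le_slotRow H a v
  have h2 := mt (le_length_lane_iff hβ (v := v) (i := slot (rows β) a v + 1) (by omega) hr).1
    (by omega)
  rcases hr.eq_or_lt with h3 | h3
  · omega
  · have h4 := slot_lt_of_lt_slotRow (ρ := rows β) (a := a) (v := v)
      (s := slotRow (rows β) a v - 1) (by omega) (by omega)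
    have h5 := slot_le H hv
    have := (le_length_lane_iff hβ (v := v) (i := slot (rows β) a v + 1)
      (s := slotRow (rows β) a v - 1) (by omega) (by omega)).2 (by omega)
    omega

/-- The entry of depth `s + 1` of the lane `L_u(v)`. -/
lemma lane_getElem?_eq_some_iff {β : List LowerInterval} (hβ : AreIntervals β) {u v s b : ℕ} :
    (lanes β u v)[s]? = some b ↔ b < β.length ∧ headAt β b ≤ v ∧ v ≤ tailAt β b ∧
      u = slotAt β b v + 1 ∧ s + 1 = rowAt β b v := by
  induction β using List.reverseRecOn with
  | nil => simp [lanes]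
  | append_singleton β I ih =>
    have hβ' : AreIntervals β := fun J hJ => hβ J (by simp [hJ])
    have ih := ih hβ'
    have hI : I.1 ≤ I.2 := hβ I (by simp)
    have hold : b < β.length → ((lanes β u v)[s]? = some b ↔
        headAt (β ++ [I]) b ≤ v ∧ v ≤ tailAt (β ++ [I]) b ∧
          u = slotAt (β ++ [I]) b v + 1 ∧ s + 1 = rowAt (β ++ [I]) b v) := by
      intro hb
      rw [headAt_append β _ hb, tailAt_append β _ hb, slotAt_append β _ hb, rowAt_append β _ hb,
        ih]
      tauto
    rw [lanes_append_singleton_apply hβ' hI, List.length_append, List.length_singleton]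
    by_cases hc : I.1 ≤ v ∧ v ≤ I.2 ∧ u = slot (rows β) I.1 v + 1
    · rw [if_pos hc]
      have hlen := length_lane_slot hβ' hc.1
      rw [← hc.2.2] at hlen
      rcases lt_trichotomy s (lanes β u v).length with h1 | h1 | h1
      · rw [List.getElem?_append_left h1]
        rcases lt_trichotomy b β.length with h2 | rfl | h2
        · rw [hold h2]; tauto
        · rw [rowAt_length, ih]
          constructor
          · intro h; omega
          · intro h; omega
        · rw [ih]; constructor <;> intro h <;> omega
      · rw [List.getElem?_append_right h1.ge, h1, Nat.sub_self]
        simp only [List.getElem?_cons_zero, Option.some.injEq]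
        constructor
        · rintro rfl
          rw [headAt_length, tailAt_length, slotAt_length, rowAt_length]
          exact ⟨by omega, hc.1, hc.2.1, hc.2.2, hlen⟩
        · rintro ⟨h3, h4⟩
          by_contra hne
          have hb : b < β.length := by omega
          have := (hold hb).2 (by rwa [← h1] at h4)
          rw [h1, List.getElem?_eq_none le_rfl] at this
          simp at this
      · rw [List.getElem?_eq_none (by simp; omega)]
        simp only [reduceCtorEq, false_iff]
        rintro ⟨h3, h4⟩
        rcases (show b ≤ β.length by omega).eq_or_lt with rfl | hb
        · rw [rowAt_length] at h4
          omega
        · have := (hold hb).2 h4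
          rw [List.getElem?_eq_none (by omega)] at this
          simp at this
    · rw [if_neg hc]
      rcases lt_trichotomy b β.length with h2 | rfl | h2
      · rw [hold h2]
        exact ⟨fun h => ⟨by omega, h⟩, fun h => h.2⟩
      · rw [headAt_length, tailAt_length, slotAt_length, ih]
        constructor
        · intro h; omega
        · tauto
      · rw [ih]; constructor <;> intro h <;> omega

lemma endsAtRightEndpoint_iff {β : List LowerInterval} (hβ : AreIntervals β) {u v : ℕ} :
    EndsAtRightEndpoint β u v ↔ ∃ b < β.length, tailAt β b = v ∧ u = slotAt β b v + 1 ∧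
      (lanes β u v).length = rowAt β b v := by
  unfold EndsAtRightEndpoint
  constructor
  · rintro ⟨b, I, h1, h2, h3⟩
    rw [List.getLast?_eq_getElem?, lane_getElem?_eq_some_iff hβ] at h1
    obtain ⟨hb, h4, h5, h6, h7⟩ := h1
    rw [getElem?_eq_some_headAt_tailAt hb, Option.some.injEq] at h2
    have h8 : tailAt β b = v := by rw [← h3, ← h2]
    refine ⟨b, hb, h8, h6, ?_⟩
    have : 0 < (lanes β u v).length := by
      rw [List.length_pos_iff]
      rw [lane_ne_nil_iff hβ (by omega)]
      have h9 := (isRowSystem_rows (β.take (b + 1))).anti_le v le_rfl (one_le_rowAt β b v)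
      rw [rows_take_succ_apply hb v (rowAt β b v), if_pos ⟨h4, h5, rfl⟩, ← slotAt_eq h4] at h9
      have h10 := rows_take_mono β (show b + 1 ≤ β.length from hb) v 1
      rw [List.take_length] at h10
      omega
    omega
  · rintro ⟨b, hb, h1, h2, h3⟩
    refine ⟨b, _, ?_, getElem?_eq_some_headAt_tailAt hb, h1⟩
    rw [List.getLast?_eq_getElem?, lane_getElem?_eq_some_iff hβ]
    refine ⟨hb, ?_, h1.ge, h2, ?_⟩
    · rw [← h1]; exact hβ _ (headAt_tailAt_mem hb)
    · have := one_le_rowAt β b v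
      omega

lemma IsCascading.tailAt_anti {n : ℕ} {β : List LowerInterval} (h : IsCascading n β) {b c : ℕ}
    (hbc : b ≤ c) (hc : c < β.length) :
    tailAt β c < tailAt β b ∨ (tailAt β c = tailAt β b ∧ headAt β b ≤ headAt β c) := by
  rcases hbc.eq_or_lt with rfl | hbc
  · exact Or.inr ⟨rfl, le_rfl⟩
  · have := List.pairwise_iff_getElem.1 h.2 b c (by omega) hc hbc
    simpa [tailAt, headAt, List.getD_eq_getElem, hc, hbc.trans hc] using this

lemma IsCascading.take {n : ℕ} {β : List LowerInterval} (h : IsCascading n β) (t : ℕ) :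
    IsCascading n (β.take t) := by
  rw [← List.take_append_drop t β] at h
  exact h.of_append

lemma headAt_take {β : List LowerInterval} {b t : ℕ} (h : b < t) :
    headAt (β.take t) b = headAt β b := by
  simp [headAt, List.getD_eq_getElem?_getD, h]

lemma tailAt_take {β : List LowerInterval} {b t : ℕ} (h : b < t) :
    tailAt (β.take t) b = tailAt β b := by
  simp [tailAt, List.getD_eq_getElem?_getD, h]

lemma slotAt_take {β : List LowerInterval} {b t : ℕ} (h : b < t) (v : ℕ) :
    slotAt (β.take t) b v = slotAt β b v := by
  rw [slotAt, slotAt, headAt_take h, List.take_take, min_eq_left h.le]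

lemma IsCascading.slotAt_lt_slotAt {n : ℕ} {β : List LowerInterval} (h : IsCascading n β)
    {b c : ℕ} (hbc : b < c) (hc : c < β.length) {m : ℕ} (hb : tailAt β b = m)
    (hcm : tailAt β c = m) : slotAt β b m < slotAt β c m := by
  have h1 := h.take (c + 1)
  rw [take_succ_eq hc] at h1
  have h2 := h1.slotAt_lt (t := b) (by simp; omega) (by rw [tailAt_take hbc, hb]; exact hcm.symm)
  simp only [] at h2
  rw [slotAt_take hbc, tailAt_take hbc, hcm, hb] at h2
  exact h2

/-- The intervals with tail `v` come in different lanes and are not followed by intervals that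
contain `v` and have a greater tail, so each of them is the end of its `v`-lane. -/
lemma IsCascading.endsAtRightEndpoint_iff {n : ℕ} {β : List LowerInterval} (h : IsCascading n β)
    {u v : ℕ} :
    EndsAtRightEndpoint β u v ↔ ∃ b < β.length, tailAt β b = v ∧ u = slotAt β b v + 1 := by
  rw [_root_.endsAtRightEndpoint_iff h.areIntervals]
  refine exists_congr fun b => and_congr_right fun hb => and_congr_right fun h1 =>
    and_iff_left_of_imp fun h2 => ?_
  have hhead : headAt β b ≤ v := by
    rw [← h1]; exact h.areIntervals _ (headAt_tailAt_mem hb)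
  have hr := one_le_rowAt β b v
  have h3 := (lane_getElem?_eq_some_iff h.areIntervals (u := u) (s := rowAt β b v - 1)).2
    ⟨hb, hhead, h1.ge, h2, by omega⟩
  have h4 : rowAt β b v - 1 < (lanes β u v).length := by
    by_contra hc
    rw [List.getElem?_eq_none (by omega)] at h3
    simp at h3
  by_contra hne
  obtain ⟨c, hc⟩ : ∃ c, (lanes β u v)[rowAt β b v]? = some c :=
    ⟨_, List.getElem?_eq_getElem (by omega)⟩
  obtain ⟨hcl, hc1, hc2, hc3, hc4⟩ := (lane_getElem?_eq_some_iff h.areIntervals).1 hc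
  rcases lt_trichotomy b c with hbc | rfl | hbc
  · have h5 := h.tailAt_anti hbc.le hcl
    have := h.slotAt_lt_slotAt hbc hcl h1 (by omega)
    omega
  · omega
  · have h5 := rows_take_mono β (show c + 1 ≤ b from hbc) v (rowAt β b v + 1)
    rw [rows_take_succ_apply hcl, if_pos ⟨hc1, hc2, hc4⟩, hc4, ← slotAt_eq hc1] at h5
    have h6 := (isRowSystem_rows (β.take b)).anti v (rowAt β b v) hr
    rw [hc4, ← slotAt_eq hhead] at h6
    omega

/-! ### Ballot sequences -/

lemma headCount_zero (β : List LowerInterval) (v : ℕ) : headCount β 0 v = 0 := by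
  simp [headCount]

lemma headCount_succ {β : List LowerInterval} {t : ℕ} (ht : t < β.length) (v : ℕ) :
    headCount β (t + 1) v = headCount β t v + if headAt β t = v then 1 else 0 := by
  rw [headCount, take_succ_eq ht, List.filter_append, List.length_append, headCount]
  by_cases h : headAt β t = v <;> simp [h]

lemma headCount_of_le {β : List LowerInterval} {t : ℕ} (ht : β.length ≤ t) (v : ℕ) :
    headCount β t v = headCount β β.length v := by
  rw [headCount, headCount, List.take_of_length_le ht, List.take_length]

lemma headCount_mono (β : List LowerInterval) {t t' : ℕ} (h : t ≤ t') (v : ℕ) :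
    headCount β t v ≤ headCount β t' v := by
  induction t', h using Nat.le_induction with
  | base => exact le_rfl
  | succ t' h ih =>
    refine ih.trans ?_
    rcases lt_or_ge t' β.length with hl | hl
    · rw [headCount_succ hl]; omega
    · rw [headCount_of_le hl, headCount_of_le (show β.length ≤ t' + 1 by omega)]

/-- All intervals reach the letter `P`, and every initial segment has at least as many heads
`v + 1` as heads `v`, for `v < P`. -/
structure IsBallot (β : List LowerInterval) (P : ℕ) : Prop where
  one_le_head : ∀ I ∈ β, 1 ≤ I.1
  le_tail : ∀ I ∈ β, P ≤ I.2
  headCount_le : ∀ t v, 1 ≤ v → v < P → headCount β t v ≤ headCount β t (v + 1)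

lemma IsBallot.headCount_mono_letter {β : List LowerInterval} {P : ℕ} (h : IsBallot β P) (t : ℕ)
    {v w : ℕ} (hv : 1 ≤ v) (hvw : v ≤ w) (hw : w ≤ P) : headCount β t v ≤ headCount β t w := by
  induction w, hvw using Nat.le_induction with
  | base => exact le_rfl
  | succ w hvw ih => exact (ih (by omega)).trans (h.headCount_le t w (by omega) (by omega))

lemma IsBallot.headCount_zero_letter {β : List LowerInterval} {P : ℕ} (h : IsBallot β P) (t : ℕ) :
    headCount β t 0 = 0 := by
  rw [headCount, List.length_eq_zero_iff, List.filter_eq_nil_iff]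
  intro I hI
  have := h.one_le_head I (List.mem_of_mem_take hI)
  simp
  omega

lemma IsBallot.slotAt_and_rowAt_of_rows {β : List LowerInterval} {P : ℕ} (h : IsBallot β P)
    {t : ℕ} (ht : t < β.length)
    (hrows : ∀ v s, v ≤ P → 1 ≤ s → rows (β.take t) v s = headCount β t (v + 1 - s)) (v : ℕ)
    (hv : headAt β t ≤ v) : v ≤ P →
    slotAt β t v = headCount β t (headAt β t) ∧ rowAt β t v = v + 1 - headAt β t := by
  have ha := h.one_le_head _ (headAt_tailAt_mem ht)
  simp only [] at ha
  induction v, hv using Nat.le_induction with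
  | base =>
    intro hP
    rw [slotAt_headAt, rowAt_headAt, hrows _ _ hP le_rfl]
    constructor
    · simp
    · omega
  | succ v hv ih =>
    intro hP
    obtain ⟨ih1, _⟩ := ih (by omega)
    have e : rowAt β t (v + 1) = v + 1 + 1 - headAt β t := by
      refine le_antisymm (slotRow_le (by omega) ?_) (not_lt.1 fun hlt => ?_)
      · rw [hrows _ _ hP (by omega), Nat.add_sub_cancel]
        rw [show v + 1 + 1 - (v + 1 + 1 - headAt β t) = headAt β t by omega]
        exact ih1.ge
      · have h1 := (isRowSystem_rows (β.take t)).firstRow_mem (v + 1) (slotAt β t v)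
        have h2 : rows (β.take t) (v + 1) (rowAt β t (v + 1)) ≤ slotAt β t v := h1.2
        have h3 := one_le_rowAt β t (v + 1)
        rw [hrows _ _ hP h3, ih1] at h2
        have h4 := h.headCount_mono_letter (t + 1) ha
          (show headAt β t ≤ v + 1 + 1 - rowAt β t (v + 1) by omega) (by omega)
        rw [headCount_succ ht, headCount_succ ht, if_pos rfl, if_neg (by omega)] at h4
        omega
    refine ⟨?_, e⟩
    rw [slotAt_eq (by omega), e, hrows _ _ hP (by omega)]
    congr 1
    omega

/-- In a ballot sequence, the rows of the partitions up to the `P`-th count heads. -/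
lemma IsBallot.rows_take {β : List LowerInterval} {P : ℕ} (h : IsBallot β P) {t : ℕ}
    (ht : t ≤ β.length) : ∀ v s, v ≤ P → 1 ≤ s →
      rows (β.take t) v s = headCount β t (v + 1 - s) := by
  induction t with
  | zero =>
    intro v s _ _
    simp [headCount_zero]
  | succ t ih =>
    have htl : t < β.length := ht
    have ih := ih htl.le
    intro v s hv hs
    have hm := h.le_tail _ (headAt_tailAt_mem htl)
    have ha := h.one_le_head _ (headAt_tailAt_mem htl)
    simp only [] at hm ha
    rw [rows_take_succ_apply htl, headCount_succ htl, ih v s hv hs]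
    by_cases hav : headAt β t ≤ v
    · rw [(h.slotAt_and_rowAt_of_rows htl ih v hav hv).2]
      split_ifs <;> omega
    · rw [if_neg (by tauto), if_neg (by omega), add_zero]

lemma IsBallot.rows_eq {β : List LowerInterval} {P : ℕ} (h : IsBallot β P) {v s : ℕ} (hv : v ≤ P)
    (hs : 1 ≤ s) : rows β v s = headCount β β.length (v + 1 - s) := by
  have := h.rows_take le_rfl v s hv hs
  rwa [List.take_length] at this

/-- In a ballot sequence, the entries up to `P` of an interval have the same lane number: one more
than the number of preceding intervals with the same head. -/
lemma IsBallot.slotAt_eq {β : List LowerInterval} {P : ℕ} (h : IsBallot β P) {t : ℕ}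
    (ht : t < β.length) {v : ℕ} (hv : headAt β t ≤ v) (hvP : v ≤ P) :
    slotAt β t v = headCount β t (headAt β t) :=
  (h.slotAt_and_rowAt_of_rows ht (h.rows_take ht.le) v hv hvP).1

lemma IsBallot.rowAt_eq {β : List LowerInterval} {P : ℕ} (h : IsBallot β P) {t : ℕ}
    (ht : t < β.length) {v : ℕ} (hv : headAt β t ≤ v) (hvP : v ≤ P) :
    rowAt β t v = v + 1 - headAt β t :=
  (h.slotAt_and_rowAt_of_rows ht (h.rows_take ht.le) v hv hvP).2

lemma IsBallot.isStarPlateau {β : List LowerInterval} {P : ℕ} (h : IsBallot β P)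
    (hβ : AreIntervals β) : IsStarPlateau β P := by
  intro m hm hmP
  have hends : ∀ u v, v < P → ¬ EndsAtRightEndpoint β u v := by
    intro u v hv he
    obtain ⟨b, hb, h1, _⟩ := (endsAtRightEndpoint_iff hβ).1 he
    have := h.le_tail _ (headAt_tailAt_mem hb)
    simp only [] at this
    omega
  refine ⟨fun i hi hne _ => ?_, fun i hi _ _ => hends _ _ (by omega),
    fun k _ hk i _ => hends _ _ (by omega)⟩
  have key : ∀ s, 1 ≤ s → (s ≤ (lanes β i (m - 1)).length ↔ s + 1 ≤ (lanes β i m).length) := by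
    intro s hs
    rw [le_length_lane_iff hβ hi hs, le_length_lane_iff hβ hi (by omega),
      h.rows_eq (by omega) hs, h.rows_eq hmP (by omega)]
    rw [show m - 1 + 1 - s = m + 1 - (s + 1) by omega]
  have h1 := List.length_pos_iff.2 hne
  have h2 := key (lanes β i (m - 1)).length
  have h3 := key ((lanes β i (m - 1)).length + 1) (by omega)
  omega

lemma rowAt_succ_le {β : List LowerInterval} {t v : ℕ} (hv : headAt β t ≤ v) :
    rowAt β t (v + 1) ≤ rowAt β t v + 1 := by
  refine slotRow_le (by omega) ?_
  rw [Nat.add_sub_cancel, slot_eq (isRowSystem_rows _) hv]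
  exact rows_succ_succ_le _ v (one_le_rowAt β t v)

lemma rowAt_le_succ {β : List LowerInterval} {t v : ℕ} (hβ : ∀ I ∈ β.take t, v + 1 ≤ I.2)
    (hv : headAt β t ≤ v) : rowAt β t v ≤ rowAt β t (v + 1) := by
  by_contra hc
  have H := isRowSystem_rows (β.take t)
  have h1 := slot_lt_of_lt_slotRow (one_le_rowAt β t (v + 1)) (not_le.1 hc)
  have h2 := rows_le_succ hβ (one_le_rowAt β t (v + 1))
  have h3 := slot_le H hv
  have h4 := slot_le H (show headAt β t ≤ v + 1 by omega)
  have h5 := slotAt_eq (show headAt β t ≤ v + 1 by omega)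
  rw [Nat.add_sub_cancel] at h4
  unfold slotAt at h5
  omega

/-- If finally every row of the `(v + 1)`-st partition but the first is as long as the row above it
in the `v`-th partition, then this holds at all times. Going back in time, an insertion that puts
the entries `v` and `v + 1` into the same row would contradict `rows_succ_succ_le`. -/
lemma rows_shift_of_final {β : List LowerInterval} {v : ℕ}
    (htail : ∀ I ∈ β, v + 1 ≤ I.2)
    (hfin : ∀ s, 1 ≤ s → rows β (v + 1) (s + 1) = rows β v s) {t : ℕ} (ht : t ≤ β.length) :
    (∀ s, 1 ≤ s → rows (β.take t) (v + 1) (s + 1) = rows (β.take t) v s) ∧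
      (t < β.length → headAt β t ≤ v → rowAt β t (v + 1) = rowAt β t v + 1) := by
  have step : ∀ t, t < β.length →
      (∀ s, 1 ≤ s → rows (β.take (t + 1)) (v + 1) (s + 1) = rows (β.take (t + 1)) v s) →
      (∀ s, 1 ≤ s → rows (β.take t) (v + 1) (s + 1) = rows (β.take t) v s) ∧
        (headAt β t ≤ v → rowAt β t (v + 1) = rowAt β t v + 1) := by
    intro t ht h
    have hm := htail _ (headAt_tailAt_mem ht)
    simp only [] at hm
    by_cases ha : headAt β t ≤ v
    · have h1 := rowAt_succ_le ha
      have h2 := rowAt_le_succ (fun I hI => htail I (List.mem_of_mem_take hI)) ha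
      have hr := one_le_rowAt β t v
      have h3 := h _ hr
      have h4 := rows_succ_succ_le (β.take t) v hr
      rw [rows_take_succ_apply ht v, if_pos ⟨ha, by omega, rfl⟩, rows_take_succ_apply ht] at h3
      have e : rowAt β t (v + 1) = rowAt β t v + 1 := by
        by_contra hne
        rw [if_neg (by omega)] at h3
        omega
      refine ⟨fun s hs => ?_, fun _ => e⟩
      have h5 := h s hs
      rw [rows_take_succ_apply ht, rows_take_succ_apply ht, e] at h5
      by_cases hs : s = rowAt β t v
      · rw [if_pos (by omega), if_pos (by omega)] at h5
        omega
      · rw [if_neg (by omega), if_neg (by omega)] at h5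
        exact h5
    · refine ⟨fun s hs => ?_, fun h => absurd h ha⟩
      have h5 := h s hs
      rw [rows_take_succ_apply ht, rows_take_succ_apply ht, if_neg (by tauto) (c := _ ∧ _ ∧ s = _)]
        at h5
      rw [if_neg ?_] at h5
      · exact h5
      · rintro ⟨h6, _, h7⟩
        rw [show v + 1 = headAt β t by omega, rowAt_headAt] at h7
        omega
  have all : ∀ t, t ≤ β.length →
      ∀ s, 1 ≤ s → rows (β.take t) (v + 1) (s + 1) = rows (β.take t) v s := by
    intro t ht
    induction ht using Nat.decreasingInduction with
    | self => rw [List.take_length]; exact hfin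
    | of_succ t ht ih => exact (step t ht ih).1
  exact ⟨all t ht, fun ht' => (step t ht' (all (t + 1) ht')).2⟩

/-- Conversely, a `P^*`-plateau all of whose intervals reach `P` is a ballot sequence. -/
lemma IsStarPlateau.isBallot {n : ℕ} {β : List LowerInterval} (hβ : IsCascading n β) {P : ℕ}
    (htail : ∀ I ∈ β, P ≤ I.2) (h : IsStarPlateau β P) : IsBallot β P := by
  have hint := hβ.areIntervals
  have hshift : ∀ v, v < P → ∀ s, 1 ≤ s → rows β (v + 1) (s + 1) = rows β v s := by
    intro v hv s hs
    refine le_antisymm (rows_succ_succ_le β v hs) ?_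
    rcases Nat.eq_zero_or_pos (rows β v s) with h0 | h0
    · omega
    have hle := rows_le_succ (β := β) (v := v) (fun I hI => by have := htail I hI; omega) le_rfl
    have h1 := (isRowSystem_rows β).anti_le v le_rfl hs
    rcases Nat.eq_zero_or_pos v with rfl | hv0
    · -- there are no entries `0`
      exfalso
      have h2 := (lane_ne_nil_iff hint (v := 0) h0).2 h1
      obtain ⟨b, hb⟩ := List.exists_mem_of_ne_nil _ h2
      obtain ⟨j, hj⟩ := List.mem_iff_getElem?.1 hb
      obtain ⟨hbl, h3, _⟩ := (lane_getElem?_eq_some_iff hint).1 hj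
      have := (hβ.1 _ (headAt_tailAt_mem hbl)).1
      simp only [] at this
      omega
    · have h2 := (h (v + 1) (by omega) (by omega)).1 (rows β v s) h0
        ((lane_ne_nil_iff hint h0).2 (by omega)) (by exact WithTop.coe_lt_top _)
      rw [Nat.add_sub_cancel] at h2
      have h3 := (le_length_lane_iff hint h0 hs).2 (le_refl (rows β v s))
      exact (le_length_lane_iff hint h0 (by omega)).1 (by omega)
  have hrow : ∀ t, t ≤ β.length → ∀ v, 1 ≤ v → v ≤ P → rows (β.take t) v 1 = headCount β t v := by
    intro t
    induction t with
    | zero => intro _ v _ _; simp [headCount_zero]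
    | succ t ih =>
      intro ht v hv hvP
      have htl : t < β.length := ht
      rw [rows_take_succ_apply htl, headCount_succ htl, ih htl.le v hv hvP]
      have hm := htail _ (headAt_tailAt_mem htl)
      simp only [] at hm
      rcases lt_trichotomy (headAt β t) v with h1 | h1 | h1
      · have h2 := (rows_shift_of_final (v := v - 1)
          (fun I hI => by have := htail I hI; omega) (hshift (v - 1) (by omega)) htl.le).2 htl
          (by omega)
        rw [Nat.sub_add_cancel hv] at h2
        have := one_le_rowAt β t (v - 1)
        rw [if_neg (by omega), if_neg (by omega), add_zero]
      · rw [if_pos h1, if_pos ⟨h1.le, by omega, by rw [← h1, rowAt_headAt]⟩]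
      · rw [if_neg (by omega), if_neg (by omega), add_zero]
  have hle : ∀ t, t ≤ β.length → ∀ v, 1 ≤ v → v < P → headCount β t v ≤ headCount β t (v + 1) := by
    intro t ht v hv hvP
    rw [← hrow t ht v hv (by omega), ← hrow t ht (v + 1) (by omega) hvP]
    exact rows_le_succ (fun I hI => by have := htail I (List.mem_of_mem_take hI); omega) le_rfl
  refine ⟨fun I hI => (hβ.1 I hI).1, htail, fun t v hv hvP => ?_⟩
  rcases le_total t β.length with ht | ht
  · exact hle t ht v hv hvP
  · rw [headCount_of_le ht, headCount_of_le ht]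
    exact hle _ le_rfl v hv hvP

/-- The last interval of a cascading sequence is the end of a lane, so that the third condition of a
plateau bounds all tails from below. -/
lemma IsPlateau.le_tail {n : ℕ} {β : List LowerInterval} (hβ : IsCascading n β) {p : ℕ} {q r : ℕ∞}
    (h : IsPlateau β p q r) : ∀ I ∈ β, p - 1 ≤ I.2 := by
  intro I hI
  by_contra hc
  obtain ⟨b, hb⟩ := List.mem_iff_getElem?.1 hI
  have hbl : b < β.length := (List.getElem?_eq_some_iff.1 hb).1
  rw [getElem?_eq_some_headAt_tailAt hbl, Option.some.injEq] at hb
  have h1 := hβ.1 I hI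
  exact h.2.2 I.2 (by omega) (by omega) (slotAt β b I.2 + 1) (by omega)
    (hβ.endsAtRightEndpoint_iff.2 ⟨b, hbl, by rw [← hb], rfl⟩)

/-! ### The entries `p` above a ballot sequence -/

/-- The number of intervals among the first `t` with head `p - s` whose entries `p - 1` and `p` lie
in the same row, which is then the row `s`. -/
noncomputable def levelCount (β : List LowerInterval) (p s t : ℕ) : ℕ :=
  Nat.count (fun b => headAt β b + s = p ∧ p ≤ tailAt β b ∧ rowAt β b p = s) t

lemma levelCount_zero (β : List LowerInterval) (p s : ℕ) : levelCount β p s 0 = 0 :=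
  Nat.count_zero _

lemma levelCount_succ (β : List LowerInterval) (p s t : ℕ) : levelCount β p s (t + 1) =
    levelCount β p s t +
      if headAt β t + s = p ∧ p ≤ tailAt β t ∧ rowAt β t p = s then 1 else 0 := by
  rw [levelCount, Nat.count_succ]
  rfl

lemma levelCount_mono (β : List LowerInterval) (p s : ℕ) {t t' : ℕ} (h : t ≤ t') :
    levelCount β p s t ≤ levelCount β p s t' :=
  Nat.count_monotone _ h

lemma levelCount_zero_row (β : List LowerInterval) (p t : ℕ) : levelCount β p 0 t = 0 := by
  induction t with
  | zero => rfl
  | succ t ih =>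
    have := one_le_rowAt β t p
    rw [levelCount_succ, ih, if_neg (by omega)]

/-- The length of the shortest initial segment that contains all intervals counted by
`levelCount β p s`. -/
noncomputable def levelTime (β : List LowerInterval) (p s : ℕ) : ℕ :=
  sInf {t | levelCount β p s β.length ≤ levelCount β p s t}

lemma levelTime_le_iff {β : List LowerInterval} {p s t : ℕ} :
    levelTime β p s ≤ t ↔ levelCount β p s β.length ≤ levelCount β p s t := by
  constructor
  · intro h
    have : levelCount β p s β.length ≤ levelCount β p s (levelTime β p s) :=
      Nat.sInf_mem (s := {t | levelCount β p s β.length ≤ levelCount β p s t})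
        ⟨β.length, le_rfl (a := levelCount β p s β.length)⟩
    exact this.trans (levelCount_mono β p s h)
  · intro h
    exact Nat.sInf_le h

lemma lt_levelTime {β : List LowerInterval} {p s t : ℕ} (ht : t < β.length)
    (h : headAt β t + s = p ∧ p ≤ tailAt β t ∧ rowAt β t p = s) : t < levelTime β p s := by
  by_contra hc
  have h1 := levelTime_le_iff.1 (not_lt.1 hc)
  have h2 := levelCount_succ β p s t
  rw [if_pos h] at h2
  have := levelCount_mono β p s (show t + 1 ≤ β.length from ht)
  omega

lemma levelTime_le_of_forall {β : List LowerInterval} {p s t : ℕ}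
    (h : ∀ b < β.length, headAt β b + s = p → p ≤ tailAt β b → rowAt β b p = s → b < t) :
    levelTime β p s ≤ t := by
  rw [levelTime_le_iff]
  rcases le_total β.length t with ht | ht
  · exact levelCount_mono β p s ht
  · have : ∀ t', t ≤ t' → t' ≤ β.length → levelCount β p s t' ≤ levelCount β p s t := by
      intro t' htt'
      induction t', htt' using Nat.le_induction with
      | base => intro _; exact le_rfl
      | succ t' htt' ih =>
        intro hl
        rw [levelCount_succ, if_neg, add_zero]
        · exact ih (by omega)
        · rintro ⟨h1, h2, h3⟩
          have := h t' hl h1 h2 h3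
          omega
    exact this _ ht le_rfl

lemma levelCount_levelTime (β : List LowerInterval) (p s : ℕ) :
    levelCount β p s (levelTime β p s) = levelCount β p s β.length := by
  refine le_antisymm (levelCount_mono β p s ?_) (levelTime_le_iff.1 le_rfl)
  exact levelTime_le_iff.2 le_rfl

lemma levelTime_le_length (β : List LowerInterval) (p s : ℕ) : levelTime β p s ≤ β.length :=
  levelTime_le_iff.2 le_rfl

/-- The data of the dynamics of the letter `p`: a cascading ballot sequence, whose intervals with
tail `p - 1` have their last entry below the first `e` rows. -/
structure Setup (n p e : ℕ) (β : List LowerInterval) : Prop where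
  two_le : 2 ≤ p
  casc : IsCascading n β
  ballot : IsBallot β (p - 1)
  short : ∀ t < β.length, tailAt β t = p - 1 → headAt β t + e < p

namespace Setup

variable {n p e : ℕ} {β : List LowerInterval} (S : Setup n p e β)

include S

lemma one_le_headAt {t : ℕ} (ht : t < β.length) : 1 ≤ headAt β t :=
  (S.casc.1 _ (headAt_tailAt_mem ht)).1

lemma le_tailAt {t : ℕ} (ht : t < β.length) : p - 1 ≤ tailAt β t :=
  S.ballot.le_tail _ (headAt_tailAt_mem ht)

lemma le_tailAt_of_le {t s : ℕ} (ht : t < β.length) (hs : headAt β t + s = p) (hse : s ≤ e) :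
    p ≤ tailAt β t := by
  have h1 := S.le_tailAt ht
  have h2 := S.short t ht
  omega

lemma le_tail_take {t : ℕ} (ht : t < β.length) (hm : p ≤ tailAt β t) :
    ∀ I ∈ β.take t, p ≤ I.2 := by
  intro I hI
  obtain ⟨b, hb⟩ := List.mem_iff_getElem?.1 hI
  have hbt : b < t := by
    have := (List.getElem?_eq_some_iff.1 hb).1
    simp at this
    omega
  rw [List.getElem?_take, if_pos hbt, getElem?_eq_some_headAt_tailAt (by omega),
    Option.some.injEq] at hb
  have := S.casc.tailAt_anti hbt.le ht
  rw [← hb]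
  simp only []
  omega

lemma rows_pred {t s : ℕ} (ht : t ≤ β.length) (hs : 1 ≤ s) :
    rows (β.take t) (p - 1) s = headCount β t (p - s) := by
  have := S.two_le
  rw [S.ballot.rows_take ht _ _ le_rfl hs]
  congr 1
  omega

/-- The lane rule at the letter `p`: an interval with head `p - s` has its entry `p` either in the
row `s`, next to the entry `p - 1`, or in the row `s + 1`. -/
lemma rowAt_cases {t s : ℕ} (ht : t < β.length) (hm : p ≤ tailAt β t) (hs : headAt β t + s = p)
    (h1 : 1 ≤ s) :
    (rowAt β t p = s ∧ rows (β.take t) p s = headCount β t (p - s)) ∨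
      (rowAt β t p = s + 1 ∧ headCount β t (p - s) < rows (β.take t) p s) := by
  have hp := S.two_le
  have e1 := S.ballot.rowAt_eq ht (v := p - 1) (by omega) le_rfl
  have e2 := S.ballot.slotAt_eq ht (v := p - 1) (by omega) le_rfl
  rw [show headAt β t = p - s by omega] at e2
  have h2 := rowAt_succ_le (β := β) (t := t) (v := p - 1) (by omega)
  have h3 := rowAt_le_succ (β := β) (t := t) (v := p - 1)
    (fun I hI => by have := S.le_tail_take ht hm I hI; omega) (by omega)
  have h4 := rows_le_succ (β := β.take t) (v := p - 1)
    (fun I hI => by have := S.le_tail_take ht hm I hI; omega) h1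
  rw [S.rows_pred ht.le h1] at h4
  rw [Nat.sub_add_cancel (by omega)] at h2 h3 h4
  rcases (show rowAt β t p = s ∨ rowAt β t p = s + 1 by omega) with h5 | h5
  · refine Or.inl ⟨h5, ?_⟩
    have h6 := slotAt_eq (show headAt β t ≤ p by omega)
    have h7 := slot_le (isRowSystem_rows (β.take t)) (show headAt β t ≤ p by omega)
    rw [h5] at h6
    unfold slotAt at e2 h6
    omega
  · refine Or.inr ⟨h5, ?_⟩
    have h6 := slot_lt_of_lt_slotRow (ρ := rows (β.take t)) (a := headAt β t) (v := p) h1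
      (by unfold rowAt at h5; omega)
    unfold slotAt at e2
    omega

lemma rows_succ_le_headCount {t s : ℕ} (ht : t ≤ β.length) (hs : 1 ≤ s) :
    rows (β.take t) p (s + 1) ≤ headCount β t (p - s) := by
  have := rows_succ_succ_le (β.take t) (p - 1) hs
  rwa [Nat.sub_add_cancel (by have := S.two_le; omega), S.rows_pred ht hs] at this

/-- Every entry `p` is accounted for by a head `p - s` whose entry `p` goes into the row `s + 1`,
or by a head `p - s - 1` whose entry `p` goes into the same row `s + 1`. -/
lemma rows_add_levelCount {t s : ℕ} (ht : t ≤ β.length) (hse : s ≤ e) (hsp : s < p) :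
    rows (β.take t) p (s + 1) + levelCount β p s t =
      headCount β t (p - s) + levelCount β p (s + 1) t := by
  induction t with
  | zero => simp [headCount_zero, levelCount_zero]
  | succ t ih =>
    have htl : t < β.length := ht
    have ih := ih htl.le
    have h1 := S.le_tailAt htl
    have h2 := S.short t htl
    rw [rows_take_succ_apply htl, headCount_succ htl, levelCount_succ, levelCount_succ]
    by_cases hm : p ≤ tailAt β t
    · rcases lt_trichotomy (headAt β t) p with h3 | h3 | h3
      · obtain ⟨σ, hσ⟩ : ∃ σ, headAt β t + σ = p := ⟨p - headAt β t, by omega⟩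
        rcases S.rowAt_cases htl hm hσ (by omega) with ⟨h4, _⟩ | ⟨h4, _⟩ <;>
          split_ifs <;> omega
      · have h4 := rowAt_headAt β t
        rw [h3] at h4
        split_ifs <;> omega
      · rw [if_neg (by omega), if_neg (by omega), if_neg (by omega), if_neg (by omega)]
        omega
    · rw [if_neg (by omega), if_neg (by omega), if_neg (by omega), if_neg (by omega)]
      omega

lemma headCount_le_rows {t s : ℕ} (ht : t ≤ β.length) (hs : 1 ≤ s) (hse : s ≤ e) (hsp : s < p) :
    headCount β t (p - s) ≤ rows (β.take t) p s := by
  induction t with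
  | zero => simp [headCount_zero]
  | succ t ih =>
    have htl : t < β.length := ht
    have ih := ih htl.le
    rw [headCount_succ htl]
    have hmono := rows_take_mono β (Nat.le_succ t) p s
    by_cases h : headAt β t + s = p
    · have hm := S.le_tailAt_of_le htl h hse
      rw [if_pos (by omega)]
      rcases S.rowAt_cases htl hm h hs with ⟨h4, _⟩ | ⟨h4, _⟩
      · rw [rows_take_succ_apply htl, if_pos (by omega)]
        omega
      · exact le_trans (by omega) hmono
    · rw [if_neg (by omega)]
      exact le_trans (by omega) hmono

/-- The number of intervals with head `p - s` whose entry `p` stays in the row `s` decreases with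
`s`. -/
lemma levelCount_succ_le {t s : ℕ} (ht : t ≤ β.length) (hs : 1 ≤ s) (hse : s ≤ e) (hsp : s < p) :
    levelCount β p (s + 1) t ≤ levelCount β p s t := by
  have h1 := S.rows_add_levelCount ht hse hsp
  have h2 := S.rows_succ_le_headCount ht hs
  omega

/-- Just after the last interval counted by `levelCount β p s`, the rows `s` of the partitions of
`p - 1` and `p` are equally long. -/
lemma rows_levelTime {s : ℕ} (hs : 1 ≤ s) :
    rows (β.take (levelTime β p s)) p s = headCount β (levelTime β p s) (p - s) := by
  obtain h0 | ⟨t, h0⟩ : levelTime β p s = 0 ∨ ∃ t, levelTime β p s = t + 1 := by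
    cases levelTime β p s with
    | zero => exact Or.inl rfl
    | succ t => exact Or.inr ⟨t, rfl⟩
  · rw [h0]; simp [headCount_zero]
  · have htl : t < β.length := by
      have := levelTime_le_length β p s
      omega
    have h1 := mt levelTime_le_iff.2 (show ¬ levelTime β p s ≤ t by omega)
    have h2 := levelTime_le_iff.1 h0.le
    rw [levelCount_succ] at h2
    have h3 : headAt β t + s = p ∧ p ≤ tailAt β t ∧ rowAt β t p = s := by
      by_contra hc
      rw [if_neg hc] at h2
      omega
    have h5 : rows (β.take t) p s = headCount β t (p - s) := by
      rcases S.rowAt_cases htl h3.2.1 h3.1 hs with h | h <;> omega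
    rw [h0, rows_take_succ_apply htl, headCount_succ htl, if_pos (by omega), if_pos (by omega), h5]

/-! ### The stretches above a given one -/

section Final

variable {h : ℕ} (hh : h + 1 ≤ e) (hhp : h + 1 < p)
  (hfin : ∀ s, 1 ≤ s → s ≤ h → rows β p (s + 1) = headCount β β.length (p - s))

include hh hhp hfin

lemma levelCount_length_eq {s : ℕ} (hs : 1 ≤ s) (hsh : s ≤ h + 1) :
    levelCount β p s β.length = levelCount β p 1 β.length := by
  induction s, hs using Nat.le_induction with
  | base => rfl
  | succ s hs ih =>
    have h1 := S.rows_add_levelCount le_rfl (show s ≤ e by omega) (by omega)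
    have h2 := hfin s hs (by omega)
    rw [List.take_length] at h1
    have := ih (by omega)
    omega

lemma levelTime_mono {s : ℕ} (hs : 1 ≤ s) (hsh : s ≤ h) :
    levelTime β p s ≤ levelTime β p (s + 1) := by
  rw [levelTime_le_iff, S.levelCount_length_eq hh hhp hfin hs (by omega),
    ← S.levelCount_length_eq hh hhp hfin (show 1 ≤ s + 1 by omega) (by omega),
    ← levelCount_levelTime]
  exact S.levelCount_succ_le (levelTime_le_length β p _) hs (by omega) (by omega)

/-- From the time `levelTime β p (s + 1)` on, the row `s + 1` of the partition of `p` is as long as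
the row `s` of the partition of `p - 1`. -/
lemma rows_eq_of_levelTime_le {s t : ℕ} (hs : 1 ≤ s) (hsh : s ≤ h) (ht : t ≤ β.length)
    (hst : levelTime β p (s + 1) ≤ t) : rows (β.take t) p (s + 1) = headCount β t (p - s) := by
  have h1 := S.rows_add_levelCount ht (show s ≤ e by omega) (by omega)
  have h2 := levelTime_le_iff.1 hst
  have h3 := levelTime_le_iff.1 ((S.levelTime_mono hh hhp hfin hs hsh).trans hst)
  have h4 := levelCount_mono β p s ht
  have h5 := levelCount_mono β p (s + 1) ht
  have h6 := S.levelCount_length_eq hh hhp hfin hs (by omega)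
  have h7 := S.levelCount_length_eq hh hhp hfin (show 1 ≤ s + 1 by omega) (by omega)
  omega

lemma headCount_levelTime {s : ℕ} (hs : 1 ≤ s) (hsh : s ≤ h) :
    headCount β (levelTime β p (s + 1)) (p - s) =
      headCount β (levelTime β p (s + 1)) (p - (s + 1)) := by
  rw [← S.rows_levelTime (show 1 ≤ s + 1 by omega),
    S.rows_eq_of_levelTime_le hh hhp hfin hs hsh (levelTime_le_length β p _) le_rfl]

lemma levelTime_succ_le {s t : ℕ} (hs : 1 ≤ s) (hsh : s ≤ h) (ht : t ≤ β.length)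
    (hst : levelTime β p s ≤ t)
    (hle : headCount β t (p - s) ≤ headCount β t (p - (s + 1))) :
    levelTime β p (s + 1) ≤ t := by
  have h1 := S.rows_add_levelCount ht (show s ≤ e by omega) (by omega)
  have h2 := S.rows_succ_le_headCount ht hs
  have h3 := S.headCount_le_rows ht (show 1 ≤ s + 1 by omega) (by omega) (by omega)
  have h4 := levelTime_le_iff.1 hst
  have h6 := S.levelCount_length_eq hh hhp hfin hs (by omega)
  have h7 := S.levelCount_length_eq hh hhp hfin (show 1 ≤ s + 1 by omega) (by omega)
  rw [levelTime_le_iff]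
  omega

/-- After the time `levelTime β p (s + 1)`, the entries up to `p` of an interval with head `p - s`
have the same lane number. -/
lemma rowAt_and_slotAt_of_levelTime_le {s t : ℕ} (hs : 1 ≤ s) (hsh : s ≤ h) (ht : t < β.length)
    (hst : levelTime β p (s + 1) ≤ t) (ha : headAt β t + s = p) :
    p ≤ tailAt β t ∧ rowAt β t p = s + 1 ∧ slotAt β t p = headCount β t (p - s) := by
  have hm := S.le_tailAt_of_le ht ha (by omega)
  have h1 : rowAt β t p = s + 1 := by
    rcases S.rowAt_cases ht hm ha hs with h1 | h1
    · have := lt_levelTime ht ⟨ha, hm, h1.1⟩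
      have := S.levelTime_mono hh hhp hfin hs hsh
      omega
    · exact h1.1
  refine ⟨hm, h1, ?_⟩
  rw [_root_.slotAt_eq (by omega), h1, S.rows_eq_of_levelTime_le hh hhp hfin hs hsh ht.le hst]

end Final

lemma startsLane_iff {b : ℕ} : StartsLane β p b ↔
    b < β.length ∧ headAt β b + 1 = p ∧ p ≤ tailAt β b ∧ rowAt β b p = 1 := by
  have hp := S.two_le
  unfold StartsLane headPositions
  have hint := S.casc.areIntervals
  constructor
  · rintro ⟨h1, u, hu, h2⟩
    rw [List.head?_eq_getElem?, lane_getElem?_eq_some_iff hint] at h2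
    obtain ⟨hb, h3, h4, h5, h6⟩ := h2
    simp only [List.mem_filter, List.mem_range, List.getElem?_map,
      getElem?_eq_some_headAt_tailAt hb, Option.map_some, Option.some.injEq, decide_eq_true_eq]
      at h1
    omega
  · rintro ⟨hb, h1, h2, h3⟩
    constructor
    · simp only [List.mem_filter, List.mem_range, List.getElem?_map,
        getElem?_eq_some_headAt_tailAt hb, Option.map_some, Option.some.injEq, decide_eq_true_eq]
      omega
    · refine ⟨slotAt β b p + 1, by omega, ?_⟩
      rw [List.head?_eq_getElem?, lane_getElem?_eq_some_iff hint]
      exact ⟨hb, by omega, h2, rfl, by omega⟩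

end Setup

/-! ### The first initial segments with equally many heads -/

lemma mem_headPositions {β : List LowerInterval} {v b : ℕ} :
    b ∈ headPositions β v ↔ b < β.length ∧ headAt β b = v := by
  unfold headPositions
  rw [List.mem_filter, List.mem_range]
  refine and_congr_right fun hb => ?_
  simp [List.getElem?_map, getElem?_eq_some_headAt_tailAt hb]

/-- The positions `j d` are the times `levelTime β p (d + 1)`. -/
theorem Setup.exists_initial_segments {n p e : ℕ} {β : List LowerInterval} (S : Setup n p e β)
    {h : ℕ} (hh : h + 1 ≤ e) (hhp : h + 1 < p)
    (hfin : ∀ s, 1 ≤ s → s ≤ h → rows β p (s + 1) = headCount β β.length (p - s)) :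
    ∃ j : ℕ → ℕ,
      (∀ d, 1 ≤ d → d ≤ h →
        IsLeast {i : ℕ | i ≤ β.length ∧
          (d = 1 → ∀ b, StartsLane β p b → b < i) ∧
          (2 ≤ d → j (d - 1) ≤ i) ∧
          headCount β i (p - d) ≤ headCount β i (p - d - 1)} (j d)) ∧
      ∀ d, 1 ≤ d → d ≤ h → ∀ b ∈ headPositions β (p - d), j d ≤ b →
        ∃ u, 1 ≤ u ∧ (∀ v, p - d ≤ v → v ≤ p → b ∈ lanes β u v) ∧
          (lanes β u p)[d]? = some b ∧ (lanes β u (p - 1))[d - 1]? = some b := by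
  refine ⟨fun d => levelTime β p (d + 1), fun d hd hdh =>
    ⟨⟨levelTime_le_length β p _, ?_, ?_, ?_⟩, ?_⟩, fun d hd hdh b hb hdb => ?_⟩
  · rintro rfl b hb
    obtain ⟨hbl, h1, h2, h3⟩ := S.startsLane_iff.1 hb
    exact (lt_levelTime hbl ⟨h1, h2, h3⟩).trans_le (S.levelTime_mono hh hhp hfin le_rfl hdh)
  · intro hd2
    simp only [Nat.sub_add_cancel hd]
    exact S.levelTime_mono hh hhp hfin hd hdh
  · exact (S.headCount_levelTime hh hhp hfin hd hdh).le
  · rintro i ⟨hi, h1, h2, h3⟩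
    refine S.levelTime_succ_le hh hhp hfin hd hdh hi ?_ h3
    rcases hd.eq_or_lt with rfl | hd2
    · exact levelTime_le_of_forall fun b hb hb1 hb2 hb3 =>
        h1 rfl b (S.startsLane_iff.2 ⟨hb, hb1, hb2, hb3⟩)
    · have := h2 hd2
      simpa only [Nat.sub_add_cancel hd] using this
  · obtain ⟨hbl, hbh⟩ := mem_headPositions.1 hb
    have hint := S.casc.areIntervals
    obtain ⟨hm, h1, h2⟩ := S.rowAt_and_slotAt_of_levelTime_le hh hhp hfin hd hdh hbl hdb (by omega)
    have key : ∀ v, p - d ≤ v → v ≤ p →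
        slotAt β b v = headCount β b (p - d) ∧ rowAt β b v = v + 1 - (p - d) := by
      intro v hv1 hv2
      rcases hv2.eq_or_lt with rfl | hv3
      · exact ⟨h2, by omega⟩
      · rw [S.ballot.slotAt_eq hbl (by omega) (by omega),
          S.ballot.rowAt_eq hbl (by omega) (by omega), hbh]
        exact ⟨rfl, rfl⟩
    have mem : ∀ v, p - d ≤ v → v ≤ p → ∀ s, s + 1 = v + 1 - (p - d) →
        (lanes β (headCount β b (p - d) + 1) v)[s]? = some b := by
      intro v hv1 hv2 s hs
      rw [lane_getElem?_eq_some_iff hint]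
      obtain ⟨h3, h4⟩ := key v hv1 hv2
      exact ⟨hbl, by omega, by omega, by omega, by omega⟩
    refine ⟨headCount β b (p - d) + 1, by omega, fun v hv1 hv2 => ?_, mem p (by omega) le_rfl _
      (by omega), mem (p - 1) (by omega) (by omega) _ (by omega)⟩
    exact List.mem_of_getElem? (mem v hv1 hv2 (v - (p - d)) (by omega))

/-! ### Matching to the left -/

/-- The number of elements of `l` that are less than `t`. -/
def below (l : List ℕ) (t : ℕ) : ℕ := l.countP fun i => decide (i < t)

@[simp] lemma below_nil (t : ℕ) : below [] t = 0 := rfl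

lemma below_cons (a : ℕ) (l : List ℕ) (t : ℕ) :
    below (a :: l) t = below l t + if a < t then 1 else 0 := by
  simp [below, List.countP_cons]

lemma below_zero (l : List ℕ) : below l 0 = 0 := by
  simp [below]

lemma below_eq_of_perm {l l' : List ℕ} (h : l.Perm l') (t : ℕ) : below l t = below l' t :=
  h.countP_eq _

lemma below_append (l l' : List ℕ) (t : ℕ) : below (l ++ l') t = below l t + below l' t :=
  List.countP_append

lemma below_succ {l : List ℕ} (hl : l.Nodup) (t : ℕ) :
    below l (t + 1) = below l t + if t ∈ l then 1 else 0 := by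
  induction l with
  | nil => simp
  | cons a l ih =>
    obtain ⟨h1, h2⟩ := List.nodup_cons.1 hl
    rw [below_cons, below_cons, ih h2]
    by_cases h : t = a
    · subst h; simp [h1]
    · have : a < t + 1 ↔ a < t := by omega
      simp only [this, List.mem_cons, h, false_or]
      omega

lemma below_mono (l : List ℕ) {s t : ℕ} (h : s ≤ t) : below l s ≤ below l t :=
  List.countP_mono_left fun i _ hi => by simp at hi ⊢; omega

lemma below_eq_length {l : List ℕ} {t : ℕ} (h : ∀ i ∈ l, i < t) : below l t = l.length := by
  rw [below, List.countP_eq_length]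
  simpa using h

lemma below_pos_of_mem {l : List ℕ} {i t : ℕ} (hi : i ∈ l) (hit : i < t) : 0 < below l t :=
  List.countP_pos_iff.2 ⟨i, hi, by simpa using hit⟩

lemma below_eq_zero {l : List ℕ} {t : ℕ} (h : ∀ i ∈ l, t ≤ i) : below l t = 0 := by
  rw [below, List.countP_eq_zero]
  simpa using h

/-- The element of `A` nearest to `j` on its left. -/
def nearestLeft (A : List ℕ) (j : ℕ) : Option ℕ := (A.filter fun i => decide (i < j)).getLast?

lemma nearestLeft_eq_none_iff {A : List ℕ} {j : ℕ} :
    nearestLeft A j = none ↔ ∀ x ∈ A, j ≤ x := by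
  simp [nearestLeft]

lemma nearestLeft_eq_some_iff {A : List ℕ} (hA : A.Pairwise (· < ·)) {j i : ℕ} :
    nearestLeft A j = some i ↔ i ∈ A ∧ i < j ∧ ∀ x ∈ A, x < j → x ≤ i := by
  have hmax : ∀ {l : List ℕ}, l.Pairwise (· < ·) → ∀ {i}, l.getLast? = some i →
      i ∈ l ∧ ∀ x ∈ l, x ≤ i := by
    intro l hl i hi
    obtain ⟨ys, rfl⟩ := List.getLast?_eq_some_iff.1 hi
    refine ⟨by simp, fun x hx => ?_⟩
    rcases List.mem_append.1 hx with h | h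
    · exact ((List.pairwise_append.1 hl).2.2 x h i (by simp)).le
    · exact (List.mem_singleton.1 h).le
  have hf := hA.filter fun i => decide (i < j)
  constructor
  · intro h
    obtain ⟨h1, h2⟩ := hmax hf h
    obtain ⟨h3, h4⟩ := List.mem_filter.1 h1
    exact ⟨h3, by simpa using h4, fun x hx hxj => h2 x (List.mem_filter.2 ⟨hx, by simpa using hxj⟩)⟩
  · rintro ⟨h1, h2, h3⟩
    cases h : nearestLeft A j with
    | none =>
      have := nearestLeft_eq_none_iff.1 h i h1
      omega
    | some i' =>
      obtain ⟨h4, h5⟩ := hmax hf h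
      obtain ⟨h6, h7⟩ := List.mem_filter.1 h4
      have h8 := h3 i' h6 (by simpa using h7)
      have h9 := h5 i (List.mem_filter.2 ⟨h1, by simpa using h2⟩)
      rw [le_antisymm h8 h9]

lemma pairLeft_cons_of_none {js A : List ℕ} {j : ℕ} (h : nearestLeft A j = none) :
    pairLeft (j :: js) A = pairLeft js A := by
  unfold nearestLeft at h
  rw [pairLeft, h]

lemma pairLeft_cons_of_some {js A : List ℕ} {j i : ℕ} (h : nearestLeft A j = some i) :
    pairLeft (j :: js) A = (i :: (pairLeft js (A.erase i)).1, (pairLeft js (A.erase i)).2) := by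
  unfold nearestLeft at h
  rw [pairLeft, h]

/-- The elements deleted for two consecutive elements do not depend on the order of the two. -/
lemma pairLeft_swap {A : List ℕ} (hA : A.Pairwise (· < ·)) {j j' : ℕ} (hjj' : j < j')
    (js : List ℕ) : (pairLeft (j :: j' :: js) A).2 = (pairLeft (j' :: j :: js) A).2 ∧
      (pairLeft (j :: j' :: js) A).1.Perm (pairLeft (j' :: j :: js) A).1 := by
  have hnd := hA.imp (S := (· ≠ ·)) fun h => Nat.ne_of_lt h
  have hE : ∀ x, (A.erase x).Pairwise (· < ·) := fun x => hA.sublist List.erase_sublist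
  have hmem : ∀ x y, y ∈ A.erase x ↔ y ≠ x ∧ y ∈ A := fun x y => List.Nodup.mem_erase_iff hnd
  cases h' : nearestLeft A j' with
  | none =>
    have h : nearestLeft A j = none := by
      rw [nearestLeft_eq_none_iff] at h' ⊢
      exact fun x hx => hjj'.le.trans (h' x hx)
    rw [pairLeft_cons_of_none h, pairLeft_cons_of_none h', pairLeft_cons_of_none h',
      pairLeft_cons_of_none h]
    exact ⟨rfl, List.Perm.refl _⟩
  | some x' =>
    obtain ⟨h1, h2, h3⟩ := (nearestLeft_eq_some_iff hA).1 h'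
    by_cases hx' : x' < j
    · -- both elements compete for `x'`
      have h : nearestLeft A j = some x' :=
        (nearestLeft_eq_some_iff hA).2 ⟨h1, hx', fun x hx hxj => h3 x hx (by omega)⟩
      have h4 : nearestLeft (A.erase x') j = nearestLeft (A.erase x') j' := by
        cases h5 : nearestLeft (A.erase x') j' with
        | none =>
          rw [nearestLeft_eq_none_iff] at h5 ⊢
          exact fun x hx => hjj'.le.trans (h5 x hx)
        | some y =>
          rw [nearestLeft_eq_some_iff (hE _)] at h5 ⊢
          obtain ⟨h6, h7, h8⟩ := h5
          have h9 := h3 y ((hmem _ _).1 h6).2 h7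
          exact ⟨h6, by omega, fun x hx hxj => h8 x hx (by omega)⟩
      rw [pairLeft_cons_of_some h, pairLeft_cons_of_some h']
      cases h5 : nearestLeft (A.erase x') j' with
      | none =>
        rw [h5] at h4
        rw [pairLeft_cons_of_none h5, pairLeft_cons_of_none h4]
        exact ⟨rfl, List.Perm.refl _⟩
      | some y =>
        rw [h5] at h4
        rw [pairLeft_cons_of_some h5, pairLeft_cons_of_some h4]
        exact ⟨rfl, List.Perm.refl _⟩
    · cases h : nearestLeft A j with
      | none =>
        have h4 : nearestLeft (A.erase x') j = none := by
          rw [nearestLeft_eq_none_iff] at h ⊢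
          exact fun x hx => h x ((hmem _ _).1 hx).2
        rw [pairLeft_cons_of_none h, pairLeft_cons_of_some h', pairLeft_cons_of_some h',
          pairLeft_cons_of_none h4]
        exact ⟨rfl, List.Perm.refl _⟩
      | some x =>
        obtain ⟨h4, h5, h6⟩ := (nearestLeft_eq_some_iff hA).1 h
        have h7 : nearestLeft (A.erase x') j = some x :=
          (nearestLeft_eq_some_iff (hE _)).2 ⟨(hmem _ _).2 ⟨by omega, h4⟩, h5,
            fun y hy hyj => h6 y ((hmem _ _).1 hy).2 hyj⟩
        have h8 : nearestLeft (A.erase x) j' = some x' :=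
          (nearestLeft_eq_some_iff (hE _)).2 ⟨(hmem _ _).2 ⟨by omega, h1⟩, h2,
            fun y hy hyj => h3 y ((hmem _ _).1 hy).2 hyj⟩
        rw [pairLeft_cons_of_some h, pairLeft_cons_of_some h8, pairLeft_cons_of_some h',
          pairLeft_cons_of_some h7, List.erase_comm]
        exact ⟨rfl, List.Perm.swap _ _ _⟩

/-- The deleted elements do not depend on the order in which the elements are processed. -/
lemma pairLeft_perm {js js' : List ℕ} (h : js.Perm js') {A : List ℕ} (hA : A.Pairwise (· < ·)) :
    (pairLeft js A).2 = (pairLeft js' A).2 ∧ (pairLeft js A).1.Perm (pairLeft js' A).1 := by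
  induction h generalizing A with
  | nil => exact ⟨rfl, List.Perm.refl _⟩
  | cons j _ ih =>
    cases hj : nearestLeft A j with
    | none => rw [pairLeft_cons_of_none hj, pairLeft_cons_of_none hj]; exact ih hA
    | some i =>
      rw [pairLeft_cons_of_some hj, pairLeft_cons_of_some hj]
      have := ih (A := A.erase i) (hA.sublist List.erase_sublist)
      exact ⟨this.1, this.2.cons i⟩
  | swap j j' js =>
    rcases lt_trichotomy j j' with h | rfl | h
    · have := pairLeft_swap hA h js
      exact ⟨this.1.symm, this.2.symm⟩
    · exact ⟨rfl, List.Perm.refl _⟩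
    · exact pairLeft_swap hA h js
  | trans _ _ ih1 ih2 => exact ⟨(ih1 hA).1.trans (ih2 hA).1, (ih1 hA).2.trans (ih2 hA).2⟩

/-- The result of matching the elements of `js`, from left to right, to the nearest unused elements
of `A` on their left: `out` are the used elements of `A`, `rest` the unused ones, and `un` are the
unmatched elements of `js`. -/
structure IsMatching (A js out rest un : List ℕ) : Prop where
  perm : (out ++ rest).Perm A
  sublist : rest.Sublist A
  un_nodup : un.Nodup
  un_subset : ∀ y ∈ un, y ∈ js
  length_eq : out.length + un.length = js.length
  /-- No pair of matched elements encloses an unused element of `A`. -/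
  rest_eq : ∀ x ∈ rest, below out x + below un x = below js x
  /-- A matched element has its partner on its left, so that strictly more partners than matched
  elements precede it. -/
  matched : ∀ y ∈ js, y ∉ un → below js y + 1 ≤ below out y + below un y
  /-- To the left of an unmatched element every element of `A` is in use. -/
  unmatched : ∀ y ∈ un, below rest y = 0 ∧ below out y + below un y = below js y
  below_le : ∀ t, below js t ≤ below out t + below un t

lemma exists_isMatching_of_sorted {js : List ℕ} (hjs : js.Pairwise (· < ·)) {A : List ℕ}
    (hA : A.Pairwise (· < ·)) (hdisj : ∀ y ∈ js, y ∉ A) :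
    ∃ un, IsMatching A js (pairLeft js A).1 (pairLeft js A).2 un := by
  induction js generalizing A with
  | nil => exact ⟨[], by constructor <;> simp [pairLeft]⟩
  | cons j js ih =>
    obtain ⟨hj, hjs⟩ := List.pairwise_cons.1 hjs
    have hnd := hA.imp (S := (· ≠ ·)) fun h => Nat.ne_of_lt h
    have hjA : j ∉ A := hdisj j (by simp)
    have hjs0 : ∀ t, t ≤ j → below js t = 0 := fun t ht =>
      below_eq_zero fun i hi => by have := hj i hi; omega
    cases h : nearestLeft A j with
    | none =>
      obtain ⟨un, M⟩ := ih hjs hA fun y hy => hdisj y (by simp [hy])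
      rw [nearestLeft_eq_none_iff] at h
      have hrest : ∀ x ∈ (pairLeft js A).2, j < x := fun x hx => by
        have h1 := M.sublist.subset hx
        have := h x h1
        rcases this.eq_or_lt with rfl | h2
        · exact absurd h1 hjA
        · exact h2
      have hout : ∀ x ∈ (pairLeft js A).1, j ≤ x := fun x hx =>
        h x (M.perm.subset (List.mem_append_left _ hx))
      have hun : ∀ y ∈ un, j < y := fun y hy => hj y (M.un_subset y hy)
      refine ⟨j :: un, ?_⟩
      rw [pairLeft_cons_of_none (nearestLeft_eq_none_iff.2 h)]
      refine ⟨M.perm, M.sublist, List.nodup_cons.2 ⟨fun hc => (hun j hc).ne rfl, M.un_nodup⟩, ?_,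
        ?_, fun x hx => ?_, fun y hy hyu => ?_, fun y hy => ?_, fun t => ?_⟩
      · intro y hy
        rcases List.mem_cons.1 hy with rfl | hy
        · simp
        · simp [M.un_subset y hy]
      · have := M.length_eq
        simp only [List.length_cons]
        omega
      · have h1 := M.rest_eq x hx
        rw [below_cons, below_cons]
        omega
      · obtain ⟨h1, h2⟩ := not_or.1 (mt List.mem_cons.2 hyu)
        have h3 := M.matched y ((List.mem_cons.1 hy).resolve_left h1) h2
        rw [below_cons, below_cons]
        omega
      · rcases List.mem_cons.1 hy with rfl | hy
        · refine ⟨below_eq_zero fun i hi => (hrest i hi).le, ?_⟩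
          rw [below_cons, below_cons, below_eq_zero hout, below_eq_zero fun i hi => (hun i hi).le,
            hjs0 _ le_rfl]
          omega
        · have h1 := M.unmatched y hy
          refine ⟨h1.1, ?_⟩
          rw [below_cons, below_cons]
          omega
      · have h1 := M.below_le t
        rw [below_cons, below_cons]
        omega
    | some i =>
      obtain ⟨un, M⟩ := ih hjs (A := A.erase i) (hA.sublist List.erase_sublist)
        fun y hy hy' => hdisj y (by simp [hy]) (List.mem_of_mem_erase hy')
      obtain ⟨hi, hij, hmax⟩ := (nearestLeft_eq_some_iff hA).1 h
      have hun : ∀ y ∈ un, j < y := fun y hy => hj y (M.un_subset y hy)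
      refine ⟨un, ?_⟩
      rw [pairLeft_cons_of_some h]
      simp only []
      refine ⟨?_, M.sublist.trans List.erase_sublist, M.un_nodup, fun y hy => ?_, ?_,
        fun x hx => ?_, fun y hy hyu => ?_, fun y hy => ?_, fun t => ?_⟩
      · rw [List.cons_append]
        exact (M.perm.cons i).trans (List.perm_cons_erase hi).symm
      · simp [M.un_subset y hy]
      · have := M.length_eq
        simp only [List.length_cons]
        omega
      · have h1 := M.rest_eq x hx
        obtain ⟨h2, h3⟩ := (List.Nodup.mem_erase_iff hnd).1 (M.sublist.subset hx)
        have h4 := hmax x h3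
        have h5 : x ≠ j := fun hc => hjA (hc ▸ h3)
        rw [below_cons, below_cons]
        split_ifs <;> omega
      · rcases List.mem_cons.1 hy with rfl | hy
        · rw [below_cons, below_cons, hjs0 _ le_rfl]
          split_ifs <;> omega
        · have h3 := M.matched y hy hyu
          have := hj y hy
          rw [below_cons, below_cons]
          split_ifs <;> omega
      · have h1 := M.unmatched y hy
        have := hun y hy
        refine ⟨h1.1, ?_⟩
        rw [below_cons, below_cons]
        split_ifs <;> omega
      · have h1 := M.below_le t
        rw [below_cons, below_cons]
        split_ifs <;> omega

lemma exists_isMatching {js : List ℕ} (hjs : js.Nodup) {A : List ℕ}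
    (hA : A.Pairwise (· < ·)) (hdisj : ∀ y ∈ js, y ∉ A) :
    ∃ un, IsMatching A js (pairLeft js A).1 (pairLeft js A).2 un := by
  have hp : (js.mergeSort (· ≤ ·)).Perm js := List.mergeSort_perm _ _
  have hsorted : (js.mergeSort (· ≤ ·)).Pairwise (· < ·) := by
    have h1 : (js.mergeSort (· ≤ ·)).Pairwise (· ≤ ·) := List.pairwise_mergeSort' _ _
    have h2 : (js.mergeSort (· ≤ ·)).Nodup := hp.nodup_iff.2 hjs
    exact (h1.and h2).imp fun h => lt_of_le_of_ne h.1 h.2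
  obtain ⟨un, M⟩ := exists_isMatching_of_sorted hsorted hA
    fun y hy => hdisj y (hp.subset hy)
  obtain ⟨h1, h2⟩ := pairLeft_perm hp hA
  rw [h1] at M
  refine ⟨un, (h2.symm.append_right _).trans M.perm, M.sublist, M.un_nodup,
    fun y hy => hp.subset (M.un_subset y hy), ?_, fun x hx => ?_, fun y hy hyu => ?_,
    fun y hy => ?_, fun t => ?_⟩
  · rw [← h2.length_eq, ← hp.length_eq]; exact M.length_eq
  · rw [← below_eq_of_perm h2, ← below_eq_of_perm hp]; exact M.rest_eq x hx
  · rw [← below_eq_of_perm h2, ← below_eq_of_perm hp]; exact M.matched y (hp.symm.subset hy) hyu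
  · rw [← below_eq_of_perm h2, ← below_eq_of_perm hp]; exact M.unmatched y hy
  · rw [← below_eq_of_perm h2, ← below_eq_of_perm hp]; exact M.below_le t

lemma headPositions_sorted (β : List LowerInterval) (v : ℕ) :
    (headPositions β v).Pairwise (· < ·) :=
  List.pairwise_lt_range.filter _

lemma headPositions_nodup (β : List LowerInterval) (v : ℕ) : (headPositions β v).Nodup :=
  (headPositions_sorted β v).imp fun h => Nat.ne_of_lt h

lemma below_headPositions (β : List LowerInterval) (v t : ℕ) :
    below (headPositions β v) t = headCount β t v := by
  induction t with
  | zero => rw [below_zero, headCount_zero]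
  | succ t ih =>
    rw [below_succ (headPositions_nodup β v), ih]
    rcases lt_or_ge t β.length with ht | ht
    · rw [headCount_succ ht]
      simp [mem_headPositions, ht]
    · rw [headCount_of_le ht, headCount_of_le (show β.length ≤ t + 1 by omega), if_neg, add_zero]
      rw [mem_headPositions]
      omega

/-! ### The fixed and the remaining elements -/

/-- The fixed elements with head `p - s`. -/
def fixedAt (β : List LowerInterval) (p h s : ℕ) : List ℕ := fixedElements β p h (h + 1 - s)

/-- The remaining elements with head `p - s`. -/
def remainingAt (β : List LowerInterval) (p h s : ℕ) : List ℕ := remainingElements β p h (h - s)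

lemma fixedAt_top (β : List LowerInterval) (p h : ℕ) :
    fixedAt β p h (h + 1) = headPositions β (p - (h + 1)) := by
  rw [fixedAt, Nat.sub_self, fixedElements, Nat.sub_sub]

lemma pairLeft_fixedAt (β : List LowerInterval) {p h s : ℕ} (hhp : h < p) (hs : s ≤ h) :
    pairLeft (fixedAt β p h (s + 1)) (headPositions β (p - s)) =
      (fixedAt β p h s, remainingAt β p h s) := by
  rw [fixedAt, fixedAt, remainingAt, remainingElements, show h + 1 - s = h - s + 1 by omega,
    fixedElements, show h + 1 - (s + 1) = h - s by omega, show p - h + (h - s) = p - s by omega]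

lemma exists_isMatching_fixedAt (β : List LowerInterval) {p h s : ℕ} (hhp : h + 1 < p)
    (hs : s ≤ h) : ∃ un, IsMatching (headPositions β (p - s)) (fixedAt β p h (s + 1))
      (fixedAt β p h s) (remainingAt β p h s) un := by
  have key : ∀ c, c ≤ h + 1 → (fixedAt β p h (h + 1 - c)).Nodup ∧
      ∀ y ∈ fixedAt β p h (h + 1 - c), headAt β y = p - (h + 1 - c) := by
    intro c
    induction c with
    | zero =>
      intro _
      rw [Nat.sub_zero, fixedAt_top]
      exact ⟨headPositions_nodup _ _, fun y hy => (mem_headPositions.1 hy).2⟩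
    | succ c ih =>
      intro hc
      obtain ⟨h1, h2⟩ := ih (by omega)
      obtain ⟨un, M⟩ := exists_isMatching (js := fixedAt β p h (h + 1 - c))
        (A := headPositions β (p - (h - c))) h1 (headPositions_sorted _ _) (fun y hy hy' => by
          have := (mem_headPositions.1 hy').2
          have := h2 y hy
          omega)
      have e := pairLeft_fixedAt β (p := p) (h := h) (s := h - c) (by omega) (by omega)
      rw [show h - c + 1 = h + 1 - c by omega] at e
      rw [e] at M
      rw [show h + 1 - (c + 1) = h - c by omega]
      refine ⟨(List.nodup_append.1 (M.perm.nodup_iff.2 (headPositions_nodup _ _))).1,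
        fun y hy => ?_⟩
      exact (mem_headPositions.1 (M.perm.subset (List.mem_append_left _ hy))).2
  obtain ⟨h1, h2⟩ := key (h - s) (by omega)
  rw [show h + 1 - (h - s) = s + 1 by omega] at h1 h2
  obtain ⟨un, M⟩ := exists_isMatching (A := headPositions β (p - s)) h1 (headPositions_sorted _ _)
    (fun y hy hy' => by
      have := (mem_headPositions.1 hy').2
      have := h2 y hy
      omega)
  rw [pairLeft_fixedAt β (by omega) hs] at M
  exact ⟨un, M⟩

section

variable {β : List LowerInterval} {p h s : ℕ} (hhp : h + 1 < p)

include hhp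

lemma mem_fixedAt_or_remainingAt (hs : s ≤ h) {b : ℕ} :
    (b ∈ fixedAt β p h s ∨ b ∈ remainingAt β p h s) ↔ b < β.length ∧ headAt β b = p - s := by
  obtain ⟨un, M⟩ := exists_isMatching_fixedAt β hhp hs
  rw [← mem_headPositions, ← M.perm.mem_iff, List.mem_append]

lemma remainingAt_sorted (hs : s ≤ h) : (remainingAt β p h s).Pairwise (· < ·) := by
  obtain ⟨un, M⟩ := exists_isMatching_fixedAt β hhp hs
  exact (headPositions_sorted _ _).sublist M.sublist

lemma remainingAt_nodup (hs : s ≤ h) : (remainingAt β p h s).Nodup :=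
  (remainingAt_sorted hhp hs).imp fun h => Nat.ne_of_lt h

lemma fixedAt_nodup (hs : s ≤ h) : (fixedAt β p h s).Nodup := by
  obtain ⟨un, M⟩ := exists_isMatching_fixedAt β hhp hs
  exact (List.nodup_append.1 (M.perm.nodup_iff.2 (headPositions_nodup _ _))).1

lemma below_fixedAt_add (hs : s ≤ h) (t : ℕ) :
    below (fixedAt β p h s) t + below (remainingAt β p h s) t = headCount β t (p - s) := by
  obtain ⟨un, M⟩ := exists_isMatching_fixedAt β hhp hs
  rw [← below_append, below_eq_of_perm M.perm, below_headPositions]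

lemma below_fixedAt_le (hs : s ≤ h + 1) (t : ℕ) :
    below (fixedAt β p h s) t ≤ headCount β t (p - s) := by
  rcases hs.eq_or_lt with rfl | hs
  · rw [fixedAt_top, below_headPositions]
  · have := below_fixedAt_add (β := β) hhp (show s ≤ h by omega) t
    omega

lemma headAt_of_mem_fixedAt (hs : s ≤ h + 1) {b : ℕ} (hb : b ∈ fixedAt β p h s) :
    b < β.length ∧ headAt β b = p - s := by
  rcases hs.eq_or_lt with rfl | hs
  · rw [fixedAt_top] at hb
    exact mem_headPositions.1 hb
  · exact (mem_fixedAt_or_remainingAt hhp (by omega)).1 (Or.inl hb)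

lemma below_fixedAt_length (hs : s ≤ h + 1) :
    below (fixedAt β p h s) β.length = (fixedAt β p h s).length :=
  below_eq_length fun _ hi => (headAt_of_mem_fixedAt hhp hs hi).1

lemma below_remainingAt_length (hs : s ≤ h) :
    below (remainingAt β p h s) β.length = (remainingAt β p h s).length :=
  below_eq_length fun _ hi => ((mem_fixedAt_or_remainingAt hhp hs).1 (Or.inr hi)).1

/-- At the letters below `p`, the ballot condition provides an element to delete for every listed
element. -/
lemma isMatching_fixedAt (hb : IsBallot β (p - 1)) (hs1 : 1 ≤ s) (hs : s ≤ h) :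
    IsMatching (headPositions β (p - s)) (fixedAt β p h (s + 1))
      (fixedAt β p h s) (remainingAt β p h s) [] := by
  obtain ⟨un, M⟩ := exists_isMatching_fixedAt β hhp hs
  by_cases hun : un = []
  · exact hun ▸ M
  exfalso
  obtain ⟨y, hy⟩ := List.exists_mem_of_ne_nil un hun
  obtain ⟨h1, h2⟩ := M.unmatched y hy
  have hyF := M.un_subset y hy
  obtain ⟨hyl, hyh⟩ := headAt_of_mem_fixedAt hhp (show s + 1 ≤ h + 1 by omega) hyF
  have h3 := below_fixedAt_add (β := β) hhp hs y
  have h5 := headCount_succ hyl (p - s)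
  rw [if_neg (by omega)] at h5
  have h6 := hb.headCount_le (y + 1) (p - (s + 1)) (by omega) (by omega)
  rw [show p - (s + 1) + 1 = p - s by omega] at h6
  have h7 := below_fixedAt_le (β := β) hhp (show s + 1 ≤ h + 1 by omega) (y + 1)
  have h8 : below (fixedAt β p h (s + 1)) (y + 1) = below (fixedAt β p h (s + 1)) y + 1 := by
    rw [below_succ, if_pos hyF]
    rcases (show s + 1 ≤ h + 1 by omega).eq_or_lt with h9 | h9
    · rw [h9, fixedAt_top]; exact headPositions_nodup _ _
    · exact fixedAt_nodup hhp (by omega)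
  omega

variable (hb : IsBallot β (p - 1))
include hb

lemma length_fixedAt (hs1 : 1 ≤ s) (hs : s ≤ h + 1) :
    (fixedAt β p h s).length = headCount β β.length (p - (h + 1)) := by
  induction hs using Nat.decreasingInduction with
  | self =>
    rw [fixedAt_top, ← below_headPositions, below_eq_length fun _ hi => (mem_headPositions.1 hi).1]
  | of_succ s hs ih =>
    have := (isMatching_fixedAt hhp hb hs1 (by omega)).length_eq
    rw [List.length_nil, add_zero] at this
    rw [this]
    exact ih (by omega)

lemma below_fixedAt_succ_le (hs1 : 1 ≤ s) (hs : s ≤ h) (t : ℕ) :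
    below (fixedAt β p h (s + 1)) t ≤ below (fixedAt β p h s) t := by
  have := (isMatching_fixedAt hhp hb hs1 hs).below_le t
  simpa using this

lemma below_fixedAt_succ_lt (hs1 : 1 ≤ s) (hs : s ≤ h) {y : ℕ} (hy : y ∈ fixedAt β p h (s + 1)) :
    below (fixedAt β p h (s + 1)) y < below (fixedAt β p h s) y := by
  have := (isMatching_fixedAt hhp hb hs1 hs).matched y hy (by simp)
  simpa using this

lemma below_fixedAt_eq (hs1 : 1 ≤ s) (hs : s ≤ h) {x : ℕ} (hx : x ∈ remainingAt β p h s) :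
    below (fixedAt β p h s) x = below (fixedAt β p h (s + 1)) x := by
  have := (isMatching_fixedAt hhp hb hs1 hs).rest_eq x hx
  simpa using this

/-- The remaining elements satisfy the ballot condition. To the left of a remaining element, and in
the whole sequence, equally many elements are fixed at two consecutive letters. -/
lemma below_remainingAt_succ_le (hs1 : 1 ≤ s) (hs : s < h) {t : ℕ} (ht : t ≤ β.length) :
    below (remainingAt β p h (s + 1)) t ≤ below (remainingAt β p h s) t := by
  have key : ∀ t, below (fixedAt β p h s) t = below (fixedAt β p h (s + 1)) t →
      below (remainingAt β p h (s + 1)) t ≤ below (remainingAt β p h s) t := by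
    intro t h0
    have h1 := below_fixedAt_add (β := β) hhp (show s ≤ h by omega) t
    have h2 := below_fixedAt_add (β := β) hhp (show s + 1 ≤ h by omega) t
    have h3 := hb.headCount_le t (p - (s + 1)) (by omega) (by omega)
    rw [show p - (s + 1) + 1 = p - s by omega] at h3
    omega
  induction ht using Nat.decreasingInduction with
  | self =>
    refine key _ ?_
    rw [below_fixedAt_length hhp (by omega), below_fixedAt_length hhp (by omega),
      length_fixedAt hhp hb hs1 (by omega), length_fixedAt hhp hb (by omega) (by omega)]
  | of_succ t ht ih =>
    by_cases hx : t ∈ remainingAt β p h s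
    · exact key t (below_fixedAt_eq hhp hb hs1 hs.le hx)
    · have h1 := below_succ (remainingAt_nodup (β := β) hhp hs.le) t
      rw [if_neg hx] at h1
      have := below_mono (remainingAt β p h (s + 1)) (show t ≤ t + 1 by omega)
      omega

end

/-- The data of the procedure for a stretch of height `h`: each row `s + 1 ≤ h + 1` of the partition
of `p` is finally as long as the row `s` of the partition of `p - 1`. -/
structure StretchSetup (n p h : ℕ) (β : List LowerInterval) : Prop extends
    Setup n p (h + 1) β where
  lt : h + 1 < p
  fin : ∀ s, 1 ≤ s → s ≤ h → rows β p (s + 1) = headCount β β.length (p - s)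

namespace StretchSetup

variable {n p h : ℕ} {β : List LowerInterval} (S : StretchSetup n p h β)

include S

/-- All heads `p - s` up to the time `levelTime β p (s + 1)` are fixed. -/
lemma below_remainingAt_eq_zero {s t : ℕ} (hs1 : 1 ≤ s) (hs : s ≤ h)
    (ht : t ≤ levelTime β p (s + 1)) : below (remainingAt β p h s) t = 0 := by
  suffices key : below (remainingAt β p h s) (levelTime β p (s + 1)) = 0 by
    have := below_mono (remainingAt β p h s) ht
    omega
  clear ht
  induction hs using Nat.decreasingInduction with
  | self =>
    have h1 := S.headCount_levelTime le_rfl S.lt S.fin hs1 le_rfl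
    have h2 := below_fixedAt_add (β := β) S.lt le_rfl (levelTime β p (h + 1))
    have h3 := below_fixedAt_succ_le S.lt S.ballot hs1 le_rfl (levelTime β p (h + 1))
    rw [fixedAt_top, below_headPositions] at h3
    omega
  | of_succ s hs ih =>
    have hs : s + 1 ≤ h := hs
    have h1 := S.headCount_levelTime le_rfl S.lt S.fin hs1 (by omega)
    have h2 := below_fixedAt_add (β := β) (s := s) S.lt (by omega) (levelTime β p (s + 1))
    have h3 := below_fixedAt_succ_le S.lt S.ballot hs1 (by omega) (levelTime β p (s + 1))
    have h4 := S.levelTime_mono le_rfl S.lt S.fin (show 1 ≤ s + 1 by omega) hs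
    have h5 := ih (by omega)
    have h6 := below_mono (remainingAt β p h (s + 1)) h4
    have h7 := below_fixedAt_add (β := β) S.lt hs (levelTime β p (s + 1))
    omega

/-- A head `p - 1` whose interval starts a lane of `p` is fixed, and so are all heads `p - 1` to its
left. -/
lemma mem_fixedAt_one_of_startsLane {b : ℕ} (hb : StartsLane β p b) :
    b ∈ fixedAt β p h 1 ∧ below (fixedAt β p h 1) b = headCount β b (p - 1) := by
  obtain ⟨hbl, h1, h2, h3⟩ := S.startsLane_iff.1 hb
  rcases Nat.eq_zero_or_pos h with rfl | hpos
  · have := fixedAt_top β p 0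
    rw [zero_add] at this
    rw [this, below_headPositions, mem_headPositions]
    exact ⟨⟨hbl, by omega⟩, rfl⟩
  · have h4 := lt_levelTime hbl ⟨h1, h2, h3⟩
    have hpos : 1 ≤ h := hpos
    have h5 := S.levelTime_mono le_rfl S.lt S.fin le_rfl hpos
    have h6 := S.below_remainingAt_eq_zero le_rfl hpos (t := b + 1) (by omega)
    have h7 := below_mono (remainingAt β p h 1) (show b ≤ b + 1 by omega)
    have h8 := below_fixedAt_add (β := β) S.lt hpos b
    refine ⟨?_, by omega⟩
    refine ((mem_fixedAt_or_remainingAt S.lt hpos).2 ⟨hbl, by omega⟩).resolve_right fun hc => ?_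
    have := below_pos_of_mem hc (show b < b + 1 by omega)
    omega

/-- The matching at the letter `p`: the unmatched elements are the positions of the intervals with
head `p - 1` that start a lane of `p`. -/
lemma exists_isMatching_zero : ∃ un, IsMatching (headPositions β p) (fixedAt β p h 1)
    (fixedAt β p h 0) (remainingAt β p h 0) un ∧ (∀ t, t ∈ un ↔ StartsLane β p t) ∧
      ∀ t, t ≤ β.length → below un t = levelCount β p 1 t := by
  obtain ⟨un, M⟩ := exists_isMatching_fixedAt β S.lt (Nat.zero_le h)
  rw [Nat.sub_zero, zero_add] at M
  have step : ∀ t, t < β.length → below un t = levelCount β p 1 t →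
      (t ∈ un ↔ StartsLane β p t) := by
    intro t ht he
    have h1 := S.rows_add_levelCount ht.le (Nat.zero_le _) (by have := S.two_le; omega)
    rw [levelCount_zero_row, Nat.sub_zero, zero_add] at h1
    have h2 := below_fixedAt_add (β := β) S.lt (Nat.zero_le h) t
    rw [Nat.sub_zero] at h2
    constructor
    · intro htu
      obtain ⟨h3, h4⟩ := M.unmatched t htu
      have h5 := headAt_of_mem_fixedAt S.lt (by omega) (M.un_subset t htu)
      have h6 := below_fixedAt_le (β := β) S.lt (show 1 ≤ h + 1 by omega) t
      have hm := S.le_tailAt_of_le (s := 1) ht (by have := S.two_le; omega) (by omega)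
      rcases S.rowAt_cases (s := 1) ht hm (by have := S.two_le; omega) le_rfl with h7 | h7
      · exact S.startsLane_iff.2 ⟨ht, by have := S.two_le; omega, hm, h7.1⟩
      · omega
    · intro hs
      obtain ⟨h3, h4⟩ := S.mem_fixedAt_one_of_startsLane hs
      obtain ⟨_, h5, h6, h7⟩ := S.startsLane_iff.1 hs
      by_contra hc
      have h8 := M.matched t h3 hc
      rcases S.rowAt_cases ht h6 h5 le_rfl with h9 | h9 <;> omega
  have all : ∀ t, t ≤ β.length → below un t = levelCount β p 1 t := by
    intro t
    induction t with
    | zero => intro _; rw [below_zero, levelCount_zero]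
    | succ t ih =>
      intro ht
      have ih := ih (by omega)
      have h1 := step t ht ih
      rw [below_succ M.un_nodup, levelCount_succ, ih]
      rw [S.startsLane_iff] at h1
      simp only [h1, show t < β.length from ht, true_and]
  refine ⟨un, M, fun t => ?_, all⟩
  by_cases ht : t < β.length
  · exact step t ht (all t ht.le)
  · refine iff_of_false (fun hc => ht ?_) fun hc => ht (S.startsLane_iff.1 hc).1
    exact (headAt_of_mem_fixedAt S.lt (by omega) (M.un_subset t hc)).1

lemma rows_one_eq {t : ℕ} (ht : t ≤ β.length) :
    rows (β.take t) p 1 = headCount β t p + levelCount β p 1 t := by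
  have h1 := S.rows_add_levelCount ht (Nat.zero_le _) (by have := S.two_le; omega)
  rwa [levelCount_zero_row, Nat.sub_zero, zero_add, add_zero] at h1

lemma below_fixedAt_one_le {t : ℕ} (ht : t ≤ β.length) :
    below (fixedAt β p h 1) t ≤ below (fixedAt β p h 0) t + levelCount β p 1 t := by
  obtain ⟨un, M, _, h2⟩ := S.exists_isMatching_zero
  rw [← h2 t ht]
  exact M.below_le t

lemma below_fixedAt_one_lt {y : ℕ} (hy : y ∈ fixedAt β p h 1) (hy' : ¬ StartsLane β p y) :
    below (fixedAt β p h 1) y < below (fixedAt β p h 0) y + levelCount β p 1 y := by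
  obtain ⟨un, M, h1, h2⟩ := S.exists_isMatching_zero
  rw [← h2 y (headAt_of_mem_fixedAt S.lt (by omega) hy).1.le]
  exact M.matched y hy (mt (h1 y).1 hy')

lemma below_fixedAt_zero_eq {x : ℕ} (hx : x ∈ remainingAt β p h 0) :
    below (fixedAt β p h 0) x + levelCount β p 1 x = below (fixedAt β p h 1) x := by
  obtain ⟨un, M, _, h2⟩ := S.exists_isMatching_zero
  rw [← h2 x ((mem_fixedAt_or_remainingAt S.lt (Nat.zero_le h)).1 (Or.inr hx)).1.le]
  exact M.rest_eq x hx

lemma below_remainingAt_zero_of_startsLane {b : ℕ} (hb : StartsLane β p b) :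
    below (remainingAt β p h 0) b = 0 := by
  obtain ⟨un, M, h1, _⟩ := S.exists_isMatching_zero
  exact (M.unmatched b ((h1 b).2 hb)).1

lemma length_fixedAt_zero : (fixedAt β p h 0).length + levelCount β p 1 β.length =
    headCount β β.length (p - (h + 1)) := by
  obtain ⟨un, M, _, h2⟩ := S.exists_isMatching_zero
  rw [← h2 _ le_rfl, below_eq_length fun y hy =>
    (headAt_of_mem_fixedAt S.lt (by omega) (M.un_subset y hy)).1, M.length_eq,
    length_fixedAt S.lt S.ballot le_rfl (by omega)]

lemma below_remainingAt_one_le (hh : 1 ≤ h) {t : ℕ} (ht : t ≤ β.length) :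
    below (remainingAt β p h 1) t ≤ below (remainingAt β p h 0) t := by
  have key : ∀ t, t ≤ β.length → below (fixedAt β p h 0) t + levelCount β p 1 t =
      below (fixedAt β p h 1) t →
      below (remainingAt β p h 1) t ≤ below (remainingAt β p h 0) t := by
    intro t ht h0
    have h1 := below_fixedAt_add (β := β) S.lt (Nat.zero_le h) t
    have h2 := below_fixedAt_add (β := β) S.lt hh t
    have h3 := S.rows_one_eq ht
    have h4 := S.headCount_le_rows ht le_rfl (by omega) (by have := S.lt; omega)
    rw [Nat.sub_zero] at h1
    omega
  induction ht using Nat.decreasingInduction with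
  | self =>
    refine key _ le_rfl ?_
    rw [below_fixedAt_length S.lt (by omega), below_fixedAt_length S.lt (by omega),
      S.length_fixedAt_zero, length_fixedAt S.lt S.ballot le_rfl (by omega)]
  | of_succ t ht ih =>
    by_cases hx : t ∈ remainingAt β p h 0
    · exact key t ht.le (S.below_fixedAt_zero_eq hx)
    · have h1 := below_succ (remainingAt_nodup (β := β) S.lt (Nat.zero_le h)) t
      rw [if_neg hx] at h1
      have := below_mono (remainingAt β p h 1) (show t ≤ t + 1 by omega)
      omega

lemma below_remainingAt_anti {s : ℕ} (hs : s < h) {t : ℕ} (ht : t ≤ β.length) :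
    below (remainingAt β p h (s + 1)) t ≤ below (remainingAt β p h s) t := by
  rcases Nat.eq_zero_or_pos s with rfl | hs1
  · exact S.below_remainingAt_one_le hs ht
  · exact below_remainingAt_succ_le S.lt S.ballot hs1 hs ht

/-- The heads `p` to the left of an interval that starts a lane of `p` and has head `p - 1` are
fixed. -/
lemma mem_fixedElements_of_startsLane {b i : ℕ} (hb : StartsLane β p b)
    (hi : i ∈ headPositions β p) (hib : i < b) : i ∈ fixedElements β p h (h + 1) := by
  have h1 := S.below_remainingAt_zero_of_startsLane hb
  refine ((mem_fixedAt_or_remainingAt (s := 0) S.lt (Nat.zero_le h)).2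
    (by simpa using mem_headPositions.1 hi)).resolve_right fun hc => ?_
  have := below_pos_of_mem hc hib
  omega

theorem executable {k : ℕ}
    (hk : k + headCount β β.length (p - (h + 1)) ≤
      if h = 0 then rows β p 1 else headCount β β.length (p - h)) :
    Executable β p h k := by
  constructor
  · intro c hc
    have h1 := length_fixedAt (s := h + 1 - c) S.lt S.ballot (by omega) (by omega)
    rw [fixedAt, show h + 1 - (h + 1 - c) = c by omega] at h1
    rw [h1, ← below_headPositions, below_eq_length fun _ hi => (mem_headPositions.1 hi).1,
      Nat.sub_sub]
  · intro d hd
    have h1 := below_fixedAt_add (β := β) (s := h - d) S.lt (by omega) β.length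
    have h2 := below_remainingAt_length (β := β) (s := h - d) S.lt (by omega)
    have h3 := below_fixedAt_length (β := β) (s := h - d) S.lt (by omega)
    rw [remainingAt, show h - (h - d) = d by omega] at h2 h1
    rcases Nat.eq_zero_or_pos (h - d) with h0 | h0
    · have h4 := S.length_fixedAt_zero
      have h5 := S.rows_one_eq le_rfl
      rw [List.take_length] at h5
      rw [h0, Nat.sub_zero] at h1
      rw [h0] at h3
      split_ifs at hk
      · omega
      · have h6 := S.headCount_le_rows le_rfl (s := 1) le_rfl (by omega) (by have := S.lt; omega)
        have h7 := S.ballot.headCount_mono_letter β.length (v := p - h) (w := p - 1)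
          (by have := S.lt; omega) (by omega) le_rfl
        rw [List.take_length] at h6
        omega
    · have h4 := length_fixedAt (s := h - d) S.lt S.ballot h0 (by omega)
      have h7 := S.ballot.headCount_mono_letter β.length (v := p - h) (w := p - (h - d))
        (by have := S.lt; omega) (by omega) (by omega)
      rw [if_neg (by omega)] at hk
      omega

end StretchSetup

/-! ### Lengthening the first remaining elements -/

lemma mem_take_iff_below {l : List ℕ} (hl : l.Pairwise (· < ·)) {k x : ℕ} :
    x ∈ l.take k ↔ x ∈ l ∧ below l x < k := by
  induction l generalizing k with
  | nil => simp
  | cons a l ih =>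
    obtain ⟨h1, h2⟩ := List.pairwise_cons.1 hl
    cases k with
    | zero => simp
    | succ k =>
      rw [List.take_succ_cons, List.mem_cons, List.mem_cons, ih h2, below_cons]
      constructor
      · rintro (rfl | ⟨h3, h4⟩)
        · rw [below_eq_zero fun i hi => (h1 i hi).le]
          simp
        · have := h1 x h3
          exact ⟨Or.inr h3, by rw [if_pos this]; omega⟩
      · rintro ⟨rfl | h3, h4⟩
        · exact Or.inl rfl
        · have := h1 x h3
          rw [if_pos this] at h4
          exact Or.inr ⟨h3, by omega⟩

lemma below_eq_of_forall_notMem {l : List ℕ} {i j : ℕ} (hij : i ≤ j)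
    (h : ∀ x ∈ l, i ≤ x → j ≤ x) : below l i = below l j := by
  refine List.countP_congr fun x hx => ?_
  have := h x hx
  simp only [decide_eq_true_eq]
  omega

/-- The interval at position `t` is lengthened by the procedure for `k` boxes. -/
def IsLengthened (β : List LowerInterval) (p h k t : ℕ) : Prop :=
  ∃ s ≤ h, t ∈ remainingAt β p h s ∧ below (remainingAt β p h s) t < k

/-- The number of intervals with head `p - s`, among the first `t`, that are lengthened. -/
def movedCount (β : List LowerInterval) (p h k s t : ℕ) : ℕ :=
  if s ≤ h then min k (below (remainingAt β p h s) t) else 0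

lemma length_addNoncontributing (β : List LowerInterval) (p h k : ℕ) :
    (addNoncontributing β p h k).length = β.length := by
  simp [addNoncontributing]

section

variable {β : List LowerInterval} {p h : ℕ} (hhp : h + 1 < p) (k : ℕ)

include hhp

lemma addNoncontributing_getD {t : ℕ} (ht : t < β.length) [Decidable (IsLengthened β p h k t)] :
    (addNoncontributing β p h k).getD t (0, 0) =
      if IsLengthened β p h k t then (headAt β t - 1, tailAt β t)
      else (headAt β t, tailAt β t) := by
  have hiff : (∃ d ∈ Finset.range (h + 1), t ∈ (remainingElements β p h d).take k) ↔
      IsLengthened β p h k t := by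
    constructor
    · rintro ⟨d, hd, h1⟩
      have hd := Finset.mem_range.1 hd
      have e : remainingElements β p h d = remainingAt β p h (h - d) := by
        rw [remainingAt, show h - (h - d) = d by omega]
      rw [e, mem_take_iff_below (remainingAt_sorted hhp (by omega))] at h1
      exact ⟨h - d, by omega, h1⟩
    · rintro ⟨s, hs, h1⟩
      rw [← mem_take_iff_below (remainingAt_sorted hhp hs)] at h1
      exact ⟨h - s, Finset.mem_range.2 (by omega), h1⟩
  rw [List.getD_eq_getElem?_getD, addNoncontributing, List.getElem?_map, List.getElem?_zipIdx,
    getElem?_eq_some_headAt_tailAt ht]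
  simp only [Option.map_some, Option.getD_some, zero_add]
  by_cases hc : IsLengthened β p h k t
  · rw [if_pos hc, if_pos (hiff.2 hc)]
  · rw [if_neg hc, if_neg (mt hiff.1 hc)]

lemma tailAt_addNoncontributing {t : ℕ} (ht : t < β.length) :
    tailAt (addNoncontributing β p h k) t = tailAt β t := by
  classical
  rw [tailAt, addNoncontributing_getD hhp k ht]
  split_ifs <;> rfl

lemma headAt_addNoncontributing_of_not {t : ℕ} (ht : t < β.length)
    (hc : ¬ IsLengthened β p h k t) : headAt (addNoncontributing β p h k) t = headAt β t := by
  classical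
  rw [headAt, addNoncontributing_getD hhp k ht, if_neg hc]

lemma headAt_addNoncontributing_of_isLengthened {t : ℕ} (ht : t < β.length)
    (hc : IsLengthened β p h k t) : headAt (addNoncontributing β p h k) t = headAt β t - 1 := by
  classical
  rw [headAt, addNoncontributing_getD hhp k ht, if_pos hc]

lemma movedCount_succ_of_not {s t : ℕ} (hc : ¬ IsLengthened β p h k t) :
    movedCount β p h k s (t + 1) = movedCount β p h k s t := by
  unfold movedCount
  split_ifs with hs
  · rw [below_succ (remainingAt_nodup hhp hs)]
    split_ifs with h1
    · have : ¬ below (remainingAt β p h s) t < k := fun h2 => hc ⟨s, hs, h1, h2⟩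
      omega
    · rfl
  · rfl

lemma movedCount_succ_of_mem {s σ t : ℕ} (hσ : σ ≤ h)
    (h1 : t ∈ remainingAt β p h σ) (h2 : below (remainingAt β p h σ) t < k) :
    movedCount β p h k s (t + 1) = movedCount β p h k s t + if s = σ then 1 else 0 := by
  unfold movedCount
  by_cases hs : s ≤ h
  · rw [if_pos hs, if_pos hs, below_succ (remainingAt_nodup hhp hs)]
    by_cases hsσ : s = σ
    · subst hsσ
      rw [if_pos h1, if_pos rfl]
      omega
    · have : t ∉ remainingAt β p h s := fun hc => by
        have h3 := (mem_fixedAt_or_remainingAt hhp hs).1 (Or.inr hc)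
        have h4 := (mem_fixedAt_or_remainingAt hhp hσ).1 (Or.inr h1)
        omega
      rw [if_neg this, if_neg hsσ]
      rfl
  · rw [if_neg hs, if_neg hs, if_neg (by omega)]

/-- The effect of the procedure on the numbers of heads. -/
lemma headCount_addNoncontributing {s t : ℕ} (hs : s ≤ p) (ht : t ≤ β.length) :
    headCount (addNoncontributing β p h k) t (p - s) + movedCount β p h k s t =
      headCount β t (p - s) + if s = 0 then 0 else movedCount β p h k (s - 1) t := by
  induction t with
  | zero => simp [headCount_zero, movedCount, below_zero]
  | succ t ih =>
    have htl : t < β.length := ht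
    have ih := ih htl.le
    rw [headCount_succ htl, headCount_succ (by rwa [length_addNoncontributing])]
    by_cases hc : IsLengthened β p h k t
    · rw [headAt_addNoncontributing_of_isLengthened hhp k htl hc]
      obtain ⟨σ, hσ, h1, h2⟩ := hc
      rw [movedCount_succ_of_mem hhp k hσ h1 h2, movedCount_succ_of_mem hhp k hσ h1 h2]
      have h3 := ((mem_fixedAt_or_remainingAt hhp hσ).1 (Or.inr h1)).2
      rw [h3]
      split_ifs at ih ⊢ <;> omega
    · rw [headAt_addNoncontributing_of_not hhp k htl hc, movedCount_succ_of_not hhp k hc,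
        movedCount_succ_of_not hhp k hc]
      omega

end

/-- Two insertions with the same slot at the letter `w` agree at all greater letters, if the
partitions do. -/
lemma slot_congr {ρ ρ' : RowLengths} {a a' w : ℕ} (ha : a ≤ w) (ha' : a' ≤ w)
    (h : slot ρ a w = slot ρ' a' w) {v : ℕ} (hv : w ≤ v) (hρ : ∀ v, w < v → ρ v = ρ' v) :
    slot ρ a v = slot ρ' a' v := by
  induction v, hv using Nat.le_induction with
  | base => exact h
  | succ v hv ih =>
    rw [slot, slot, if_pos (by omega), if_pos (by omega), ih, hρ (v + 1) (by omega)]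

lemma slotRow_congr {ρ ρ' : RowLengths} {a a' w : ℕ} (ha : a ≤ w) (ha' : a' ≤ w)
    (h : slot ρ a w = slot ρ' a' w) {v : ℕ} (hv : w < v) (hρ : ∀ v, w < v → ρ v = ρ' v) :
    slotRow ρ a v = slotRow ρ' a' v := by
  rw [slotRow, slotRow, slot_congr ha ha' h (show w ≤ v - 1 by omega) hρ, hρ v hv]

namespace StretchSetup

variable {n p h : ℕ} {β : List LowerInterval} (S : StretchSetup n p h β) (k : ℕ)

include S

lemma fixedAt_mono_of_no_heads {σ i j : ℕ} (hσ : σ ≤ h) (hij : i < j) (hj : j ∈ remainingAt β p h σ)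
    (hbetween : ∀ x, i ≤ x → x < j → headAt β x = p - σ) : i ∉ fixedAt β p h σ := by
  intro hi
  have hjl := ((mem_fixedAt_or_remainingAt S.lt hσ).1 (Or.inr hj)).1
  have h1 : below (fixedAt β p h (σ + 1)) i = below (fixedAt β p h (σ + 1)) j := by
    refine below_eq_of_forall_notMem hij.le fun x hx hix => not_lt.1 fun hxj => ?_
    have h2 := (headAt_of_mem_fixedAt S.lt (by omega) hx).2
    have h3 := hbetween x hix hxj
    have := S.lt
    omega
  have h2 := below_succ (fixedAt_nodup (β := β) S.lt hσ) i
  rw [if_pos hi] at h2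
  have h3 := below_mono (fixedAt β p h σ) (show i + 1 ≤ j from hij)
  rcases Nat.eq_zero_or_pos σ with rfl | hσ1
  · have h4 := S.below_fixedAt_zero_eq hj
    have h5 := S.below_fixedAt_one_le (t := i) (by omega)
    have h6 := levelCount_mono β p 1 hij.le
    rw [zero_add] at h1
    omega
  · have h4 := below_fixedAt_eq S.lt S.ballot hσ1 hσ hj
    have h5 := below_fixedAt_succ_le S.lt S.ballot hσ1 hσ i
    omega

lemma isCascading_addNoncontributing : IsCascading n (addNoncontributing β p h k) := by
  have hlen := length_addNoncontributing β p h k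
  have hlt := S.lt
  constructor
  · intro I hI
    obtain ⟨t, ht⟩ := List.mem_iff_getElem?.1 hI
    have htl := (List.getElem?_eq_some_iff.1 ht).1
    rw [getElem?_eq_some_headAt_tailAt htl, Option.some.injEq] at ht
    rw [hlen] at htl
    have h1 := S.casc.1 _ (headAt_tailAt_mem htl)
    rw [← ht, tailAt_addNoncontributing hlt k htl]
    by_cases hc : IsLengthened β p h k t
    · rw [headAt_addNoncontributing_of_isLengthened hlt k htl hc]
      obtain ⟨σ, hσ, h2, _⟩ := hc
      have h3 := ((mem_fixedAt_or_remainingAt hlt hσ).1 (Or.inr h2)).2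
      simp only [] at h1 ⊢
      omega
    · rw [headAt_addNoncontributing_of_not hlt k htl hc]
      exact h1
  · rw [List.pairwise_iff_getElem]
    intro i j hi hj hij
    have e : ∀ t (ht : t < (addNoncontributing β p h k).length),
        (addNoncontributing β p h k)[t] =
          (headAt (addNoncontributing β p h k) t, tailAt (addNoncontributing β p h k) t) := by
      intro t ht
      have := getElem?_eq_some_headAt_tailAt ht
      rw [List.getElem?_eq_getElem ht, Option.some.injEq] at this
      exact this
    rw [e i hi, e j hj]
    rw [hlen] at hi hj
    rw [tailAt_addNoncontributing hlt k hi, tailAt_addNoncontributing hlt k hj]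
    simp only []
    rcases S.casc.tailAt_anti hij.le hj with h1 | ⟨h1, h2⟩
    · exact Or.inl h1
    refine Or.inr ⟨h1, ?_⟩
    have hi' : headAt (addNoncontributing β p h k) i ≤ headAt β i := by
      by_cases hc : IsLengthened β p h k i
      · rw [headAt_addNoncontributing_of_isLengthened hlt k hi hc]; omega
      · rw [headAt_addNoncontributing_of_not hlt k hi hc]
    by_cases hcj : IsLengthened β p h k j
    swap
    · rw [headAt_addNoncontributing_of_not hlt k hj hcj]
      omega
    rw [headAt_addNoncontributing_of_isLengthened hlt k hj hcj]
    rcases h2.eq_or_lt with h2 | h2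
    swap
    · omega
    -- an interval with the same head and tail before a lengthened one is lengthened, too
    have hci : IsLengthened β p h k i := by
      obtain ⟨σ, hσ, h3, h4⟩ := hcj
      have h5 := ((mem_fixedAt_or_remainingAt hlt hσ).1 (Or.inr h3)).2
      have h6 : i ∉ fixedAt β p h σ := by
        refine S.fixedAt_mono_of_no_heads hσ hij h3 fun x hix hxj => ?_
        have h7 := S.casc.tailAt_anti hix (hxj.trans hj)
        have h8 := S.casc.tailAt_anti hxj.le hj
        omega
      have h7 := ((mem_fixedAt_or_remainingAt hlt hσ).2 ⟨hi, by omega⟩).resolve_left h6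
      exact ⟨σ, hσ, h7, (below_mono _ hij.le).trans_lt h4⟩
    rw [headAt_addNoncontributing_of_isLengthened hlt k hi hci]
    omega

lemma isBallot_addNoncontributing : IsBallot (addNoncontributing β p h k) (p - 1) := by
  have hlen := length_addNoncontributing β p h k
  have hlt := S.lt
  have hcasc := S.isCascading_addNoncontributing k
  refine ⟨fun I hI => (hcasc.1 I hI).1, fun I hI => ?_, ?_⟩
  · obtain ⟨t, ht⟩ := List.mem_iff_getElem?.1 hI
    have htl := (List.getElem?_eq_some_iff.1 ht).1
    rw [getElem?_eq_some_headAt_tailAt htl, Option.some.injEq] at ht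
    rw [hlen] at htl
    rw [← ht, tailAt_addNoncontributing hlt k htl]
    exact S.le_tailAt htl
  · have key : ∀ t, t ≤ β.length → ∀ v, 1 ≤ v → v < p - 1 →
        headCount (addNoncontributing β p h k) t v ≤
          headCount (addNoncontributing β p h k) t (v + 1) := by
      intro t ht v hv hvp
      obtain ⟨s, rfl⟩ : ∃ s, v = p - (s + 2) := ⟨p - v - 2, by omega⟩
      rw [show p - (s + 2) + 1 = p - (s + 1) by omega]
      have h1 := headCount_addNoncontributing hlt k (s := s + 2) (by omega) ht
      have h2 := headCount_addNoncontributing hlt k (s := s + 1) (by omega) ht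
      rw [if_neg (by omega), show s + 2 - 1 = s + 1 by omega] at h1
      rw [if_neg (by omega), Nat.add_sub_cancel] at h2
      have h3 := S.ballot.headCount_le t (p - (s + 2)) hv hvp
      rw [show p - (s + 2) + 1 = p - (s + 1) by omega] at h3
      by_cases hs : s + 1 ≤ h
      · have h4 := below_fixedAt_add (β := β) hlt hs t
        have h5 := below_fixedAt_succ_le hlt S.ballot (show 1 ≤ s + 1 by omega) hs t
        have h6 := S.below_remainingAt_anti hs ht
        by_cases hs' : s + 2 ≤ h
        · have h7 := below_fixedAt_add (β := β) hlt hs' t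
          have h8 := S.below_remainingAt_anti (s := s + 1) hs' ht
          simp only [movedCount, hs, hs', show s ≤ h by omega, if_true] at h1 h2
          rw [show s + 1 + 1 = s + 2 by rfl] at h8 h5
          omega
        · have h7 : s + 2 = h + 1 := by omega
          rw [show s + 1 + 1 = s + 2 by rfl, h7, fixedAt_top, below_headPositions, ← h7] at h5
          simp only [movedCount, hs, hs', show s ≤ h by omega, if_true, if_false] at h1 h2
          omega
      · simp only [movedCount, hs, show ¬ s + 2 ≤ h by omega, if_false] at h1 h2
        omega
    intro t v hv hvp
    rcases le_total t β.length with ht | ht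
    · exact key t ht v hv hvp
    · rw [headCount_of_le (hlen.trans_le ht), headCount_of_le (hlen.trans_le ht), hlen]
      exact key _ le_rfl v hv hvp

lemma headAt_addNoncontributing_of_lt {t : ℕ} (ht : t < β.length) (hh : headAt β t + h < p) :
    headAt (addNoncontributing β p h k) t = headAt β t := by
  refine headAt_addNoncontributing_of_not S.lt k ht fun hc => ?_
  obtain ⟨σ, hσ, h2, _⟩ := hc
  have h3 := ((mem_fixedAt_or_remainingAt S.lt hσ).1 (Or.inr h2)).2
  omega

lemma setup_addNoncontributing : Setup n p (h + 1) (addNoncontributing β p h k) where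
  two_le := S.two_le
  casc := S.isCascading_addNoncontributing k
  ballot := S.isBallot_addNoncontributing k
  short t ht htail := by
    rw [length_addNoncontributing] at ht
    rw [tailAt_addNoncontributing S.lt k ht] at htail
    have := S.short t ht htail
    rw [S.headAt_addNoncontributing_of_lt k ht (by omega)]
    exact this

/-- The entries `p` go into the same rows as before. Just before an interval with head `p - s`
that is not lengthened, the comparison of the rows `s` of the partitions of `p - 1` and `p` has the
same outcome in both sequences. A lengthened interval with head `p - s` has its entry `p` in the row
`s + 1`; afterwards its head is `p - s - 1`, and its entry `p` lies in the row of the entry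
`p - 1`. -/
lemma rowAt_addNoncontributing {t : ℕ} (ht : t < β.length) (hm : p ≤ tailAt β t)
    (ha : headAt β t ≤ p)
    (hrows : rows ((addNoncontributing β p h k).take t) p = rows (β.take t) p) :
    rowAt (addNoncontributing β p h k) t p = rowAt β t p := by
  have hlt := S.lt
  have S' := S.setup_addNoncontributing k
  have ht' : t < (addNoncontributing β p h k).length := by rwa [length_addNoncontributing]
  have hm' : p ≤ tailAt (addNoncontributing β p h k) t := by
    rwa [tailAt_addNoncontributing hlt k ht]
  have ha1 := S.one_le_headAt ht
  have hR1 := S.rows_one_eq ht.le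
  by_cases hc : IsLengthened β p h k t
  · have hhead := headAt_addNoncontributing_of_isLengthened hlt k ht hc
    obtain ⟨σ, hσ, h1, h2⟩ := hc
    have h3 := ((mem_fixedAt_or_remainingAt hlt hσ).1 (Or.inr h1)).2
    have h4 := headCount_addNoncontributing hlt k (s := σ + 1) (by omega) ht.le
    rw [if_neg (by omega), Nat.add_sub_cancel] at h4
    have h5 := below_fixedAt_add (β := β) hlt hσ t
    have h6 : headCount β t (p - (σ + 1)) = below (fixedAt β p h (σ + 1)) t +
        if σ + 1 ≤ h then below (remainingAt β p h (σ + 1)) t else 0 := by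
      split_ifs with h7
      · exact (below_fixedAt_add hlt h7 t).symm
      · rw [show σ = h by omega, fixedAt_top, below_headPositions, add_zero]
    have h7 : rows (β.take t) p (σ + 1) ≤
        headCount (addNoncontributing β p h k) t (p - (σ + 1)) := by
      have h8 : rows (β.take t) p (σ + 1) =
          below (fixedAt β p h (σ + 1)) t + below (remainingAt β p h σ) t := by
        rcases Nat.eq_zero_or_pos σ with rfl | hσ1
        · have h9 := S.below_fixedAt_zero_eq h1
          rw [Nat.sub_zero] at h5
          rw [zero_add]
          omega
        · have h9 : levelTime β p (σ + 1) ≤ t := by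
            by_contra h9
            have h10 := S.below_remainingAt_eq_zero hσ1 hσ (t := t + 1) (by omega)
            have := below_pos_of_mem h1 (show t < t + 1 by omega)
            omega
          rw [S.rows_eq_of_levelTime_le le_rfl hlt S.fin hσ1 hσ ht.le h9, ← h5,
            below_fixedAt_eq hlt S.ballot hσ1 hσ h1]
      simp only [movedCount, hσ, if_true] at h4
      split_ifs at h4 h6 <;> omega
    have h8 : rowAt β t p = σ + 1 := by
      rcases Nat.eq_zero_or_pos σ with rfl | hσ1
      · have := rowAt_headAt β t
        rw [h3, Nat.sub_zero] at this
        exact this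
      · have h9 : levelTime β p (σ + 1) ≤ t := by
          by_contra h9
          have h10 := S.below_remainingAt_eq_zero hσ1 hσ (t := t + 1) (by omega)
          have := below_pos_of_mem h1 (show t < t + 1 by omega)
          omega
        exact (S.rowAt_and_slotAt_of_levelTime_le le_rfl hlt S.fin hσ1 hσ ht h9 (by omega)).2.1
    rcases S'.rowAt_cases ht' hm' (s := σ + 1) (by omega) (by omega) with h9 | h9
    · rw [h8, h9.1]
    · rw [hrows] at h9
      omega
  · have hhead := headAt_addNoncontributing_of_not hlt k ht hc
    rcases ha.eq_or_lt with ha | ha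
    · have e1 := rowAt_headAt β t
      have e2 := rowAt_headAt (addNoncontributing β p h k) t
      rw [hhead, ha] at e2
      rw [ha] at e1
      rw [e1, e2]
    obtain ⟨s, hs⟩ : ∃ s, headAt β t + s = p := ⟨p - headAt β t, by omega⟩
    have hs1 : 1 ≤ s := by omega
    have h4 := headCount_addNoncontributing hlt k (s := s) (by omega) ht.le
    rw [if_neg (by omega)] at h4
    have c' := S'.rowAt_cases ht' hm' (s := s) (by omega) hs1
    rw [hrows] at c'
    rcases S.rowAt_cases ht hm hs hs1 with ⟨h5, h6⟩ | ⟨h5, h6⟩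
    · -- before an interval with both entries in the row `s`, nothing has changed in this row
      have h7 := lt_levelTime ht ⟨hs, hm, h5⟩
      have h8 : movedCount β p h k s t = 0 := by
        unfold movedCount
        split_ifs with hsh
        · have := S.levelTime_mono le_rfl hlt S.fin hs1 hsh
          rw [S.below_remainingAt_eq_zero hs1 hsh (by omega)]
          omega
        · rfl
      have h9 : movedCount β p h k (s - 1) t = 0 := by
        unfold movedCount
        split_ifs with hsh
        · rcases hs1.eq_or_lt with rfl | hs2
          · rw [S.below_remainingAt_zero_of_startsLane (S.startsLane_iff.2 ⟨ht, hs, hm, h5⟩)]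
            omega
          · rw [S.below_remainingAt_eq_zero (s := s - 1) (by omega) hsh
              (by rw [Nat.sub_add_cancel hs1]; omega)]
            omega
        · rfl
      omega
    · suffices h7 : headCount (addNoncontributing β p h k) t (p - s) < rows (β.take t) p s by omega
      by_cases h8 : movedCount β p h k (s - 1) t = 0
      · omega
      have hsh : s - 1 ≤ h := by
        by_contra h9
        exact h8 (by rw [movedCount, if_neg h9])
      have h9 := below_fixedAt_add (β := β) hlt hsh t
      have h10 : headCount β t (p - s) = below (fixedAt β p h s) t +
          if s ≤ h then below (remainingAt β p h s) t else 0 := by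
        split_ifs with h7
        · exact (below_fixedAt_add hlt h7 t).symm
        · rw [show s = h + 1 by omega, fixedAt_top, below_headPositions, add_zero]
      -- `δ` accounts for the unmatched elements at the letter `p`
      obtain ⟨δ, hδ1, hδ2, hδ3⟩ : ∃ δ, rows (β.take t) p s =
          below (fixedAt β p h (s - 1)) t + δ + below (remainingAt β p h (s - 1)) t ∧
          below (fixedAt β p h s) t ≤ below (fixedAt β p h (s - 1)) t + δ ∧
          (t ∈ fixedAt β p h s →
            below (fixedAt β p h s) t < below (fixedAt β p h (s - 1)) t + δ) := by
        rcases hs1.eq_or_lt with rfl | hs2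
        · refine ⟨levelCount β p 1 t, ?_, S.below_fixedAt_one_le ht.le,
            fun h11 => S.below_fixedAt_one_lt h11 fun h12 => ?_⟩
          · rw [Nat.sub_self, Nat.sub_zero] at h9
            rw [Nat.sub_self]
            omega
          · have := S.startsLane_iff.1 h12
            omega
        · have h11 : levelTime β p s ≤ t := by
            by_contra h11
            apply h8
            rw [movedCount, if_pos hsh, S.below_remainingAt_eq_zero (by omega) hsh
              (by rw [Nat.sub_add_cancel hs1]; omega)]
            omega
          have h12 := S.rows_eq_of_levelTime_le le_rfl hlt S.fin (s := s - 1) (by omega) hsh ht.le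
            (by rw [Nat.sub_add_cancel hs1]; exact h11)
          have h13 := below_fixedAt_succ_le hlt S.ballot (s := s - 1) (by omega) hsh t
          rw [Nat.sub_add_cancel hs1] at h12 h13
          refine ⟨0, by omega, by omega, fun h14 => ?_⟩
          have := below_fixedAt_succ_lt hlt S.ballot (s := s - 1) (y := t) (by omega) hsh
            (by rwa [Nat.sub_add_cancel hs1])
          rw [Nat.sub_add_cancel hs1] at this
          omega
      by_cases hF : t ∈ fixedAt β p h s
      · have h11 := hδ3 hF
        by_cases hs' : s ≤ h
        · have h12 := S.below_remainingAt_anti (s := s - 1) (by omega) ht.le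
          rw [Nat.sub_add_cancel hs1] at h12
          simp only [movedCount, hsh, hs', if_true] at h4 h10
          omega
        · simp only [movedCount, hsh, hs', if_true, if_false] at h4 h10
          omega
      · have hs' : s ≤ h := by
          by_contra h11
          apply hF
          rw [show s = h + 1 by omega, fixedAt_top, mem_headPositions]
          exact ⟨ht, by omega⟩
        have hR := ((mem_fixedAt_or_remainingAt hlt hs').2 ⟨ht, by omega⟩).resolve_left hF
        have h12 := S.below_remainingAt_anti (s := s - 1) (t := t + 1) (by omega) ht
        rw [Nat.sub_add_cancel hs1, below_succ (remainingAt_nodup hlt hs'),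
          below_succ (remainingAt_nodup hlt hsh), if_pos hR, if_neg] at h12
        · have h13 : ¬ below (remainingAt β p h s) t < k := fun h14 => hc ⟨s, hs', hR, h14⟩
          simp only [movedCount, hsh, hs', if_true] at h4 h10
          omega
        · intro h14
          have := ((mem_fixedAt_or_remainingAt hlt hsh).1 (Or.inr h14)).2
          omega

end StretchSetup

/-! ### The partitions after the lengthening -/

namespace StretchSetup

variable {n p h : ℕ} {β : List LowerInterval} (S : StretchSetup n p h β) (k : ℕ)

include S

lemma headAt_addNoncontributing_of_gt {t : ℕ} (ht : t < β.length) (hh : p < headAt β t) :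
    headAt (addNoncontributing β p h k) t = headAt β t := by
  refine headAt_addNoncontributing_of_not S.lt k ht fun hc => ?_
  obtain ⟨σ, hσ, h2, _⟩ := hc
  have h3 := ((mem_fixedAt_or_remainingAt S.lt hσ).1 (Or.inr h2)).2
  omega

lemma headAt_addNoncontributing_le {t : ℕ} (ht : t < β.length) :
    headAt (addNoncontributing β p h k) t ≤ headAt β t := by
  by_cases hc : IsLengthened β p h k t
  · rw [headAt_addNoncontributing_of_isLengthened S.lt k ht hc]
    omega
  · rw [headAt_addNoncontributing_of_not S.lt k ht hc]

lemma headAt_addNoncontributing_le_iff {t v : ℕ} (ht : t < β.length) (hv : p ≤ v) :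
    headAt (addNoncontributing β p h k) t ≤ v ↔ headAt β t ≤ v := by
  rcases le_or_gt (headAt β t) p with ha | ha
  · have := S.headAt_addNoncontributing_le k ht
    omega
  · rw [S.headAt_addNoncontributing_of_gt k ht ha]

lemma rowAt_and_slotAt_addNoncontributing_of_rows {t v : ℕ} (ht : t < β.length) (hv : p ≤ v)
    (hm : v ≤ tailAt β t) (ha : headAt β t ≤ v)
    (hrows : ∀ v, p ≤ v →
      rows ((addNoncontributing β p h k).take t) v = rows (β.take t) v) :
    rowAt (addNoncontributing β p h k) t v = rowAt β t v ∧
      slotAt (addNoncontributing β p h k) t v = slotAt β t v := by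
  have ha' := (S.headAt_addNoncontributing_le_iff k ht hv).2 ha
  rcases le_or_gt (headAt β t) p with hap | hap
  · have hap' := (S.headAt_addNoncontributing_le_iff k ht le_rfl).2 hap
    have e1 := S.rowAt_addNoncontributing k ht (hv.trans hm) hap (hrows p le_rfl)
    have e2 : slotAt (addNoncontributing β p h k) t p = slotAt β t p := by
      rw [slotAt_eq hap', slotAt_eq hap, e1, hrows p le_rfl]
    have e3 : slotAt (addNoncontributing β p h k) t v = slotAt β t v :=
      slot_congr hap' hap e2 hv fun w hw => hrows w hw.le
    refine ⟨?_, e3⟩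
    rcases hv.eq_or_lt with rfl | hv
    · exact e1
    · exact slotRow_congr hap' hap e2 hv fun w hw => hrows w hw.le
  · have e1 := S.headAt_addNoncontributing_of_gt k ht hap
    have e2 : slotAt (addNoncontributing β p h k) t (headAt β t) = slotAt β t (headAt β t) := by
      have e3 := slotAt_headAt (addNoncontributing β p h k) t
      rw [e1] at e3
      rw [e3, slotAt_headAt, hrows _ hap.le]
    refine ⟨?_, slot_congr e1.le le_rfl e2 ha fun w hw => hrows w (by omega)⟩
    rcases ha.eq_or_lt with hav | hav
    · have e3 := rowAt_headAt (addNoncontributing β p h k) t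
      rw [e1] at e3
      rw [← hav, e3, rowAt_headAt]
    · exact slotRow_congr e1.le le_rfl e2 hav fun w hw => hrows w (by omega)

/-- The partitions from the `p`-th on go through the same shapes as before. -/
lemma rows_take_addNoncontributing {t : ℕ} (ht : t ≤ β.length) :
    ∀ v, p ≤ v → rows ((addNoncontributing β p h k).take t) v = rows (β.take t) v := by
  induction t with
  | zero =>
    intro v _
    simp
  | succ t ih =>
    have htl : t < β.length := ht
    have ih := ih htl.le
    intro v hv
    funext s
    rw [rows_take_succ_apply (by rwa [length_addNoncontributing]), rows_take_succ_apply htl,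
      ih v hv, tailAt_addNoncontributing S.lt k htl]
    have h1 := S.headAt_addNoncontributing_le_iff k htl hv
    by_cases hc : headAt β t ≤ v ∧ v ≤ tailAt β t
    · rw [(S.rowAt_and_slotAt_addNoncontributing_of_rows k htl hv hc.2 hc.1 ih).1]
      simp only [h1]
    · rw [if_neg (by tauto), if_neg (by tauto)]

lemma slotAt_addNoncontributing {t v : ℕ} (ht : t < β.length) (hv : p ≤ v)
    (hm : v ≤ tailAt β t) (ha : headAt β t ≤ v) :
    slotAt (addNoncontributing β p h k) t v = slotAt β t v :=
  (S.rowAt_and_slotAt_addNoncontributing_of_rows k ht hv hm ha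
    (S.rows_take_addNoncontributing k ht.le)).2

lemma rows_addNoncontributing {v : ℕ} (hv : p ≤ v) :
    rows (addNoncontributing β p h k) v = rows β v := by
  have := S.rows_take_addNoncontributing k le_rfl v hv
  rwa [List.take_length, ← length_addNoncontributing β p h k, List.take_length] at this

lemma headCount_addNoncontributing_of_lt {s t : ℕ} (hs : h + 1 < s) (hsp : s ≤ p)
    (ht : t ≤ β.length) :
    headCount (addNoncontributing β p h k) t (p - s) = headCount β t (p - s) := by
  have h1 := headCount_addNoncontributing S.lt k hsp ht
  simp only [movedCount, show ¬ s ≤ h by omega, show ¬ s - 1 ≤ h by omega, if_false] at h1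
  split_ifs at h1 <;> omega

lemma slotAt_addNoncontributing_of_tail {t : ℕ} (ht : t < β.length) (hm : tailAt β t = p - 1) :
    slotAt (addNoncontributing β p h k) t (p - 1) = slotAt β t (p - 1) := by
  have h1 := S.short t ht hm
  have h2 := S.one_le_headAt ht
  have h3 := S.headAt_addNoncontributing_of_lt k ht (by omega)
  rw [(S.isBallot_addNoncontributing k).slotAt_eq (by rwa [length_addNoncontributing])
    (by omega) le_rfl, S.ballot.slotAt_eq ht (by omega) le_rfl, h3]
  have := S.headCount_addNoncontributing_of_lt k (s := p - headAt β t) (t := t) (by omega)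
    (by omega) ht.le
  rwa [show p - (p - headAt β t) = headAt β t by omega] at this

lemma rigging_addNoncontributing (v l : ℕ) :
    rigging (addNoncontributing β p h k) v l = rigging β v l := by
  unfold rigging
  rw [length_addNoncontributing]
  refine Finset.sum_congr rfl fun t ht => ?_
  have ht : t < β.length := Finset.mem_range.1 ht
  have hm := S.le_tailAt ht
  have e : slotAt (addNoncontributing β p h k) t (tailAt β t) = slotAt β t (tailAt β t) := by
    rcases hm.eq_or_lt with h1 | h1
    · rw [← h1, S.slotAt_addNoncontributing_of_tail k ht h1.symm]
    · exact S.slotAt_addNoncontributing k ht (by omega) le_rfl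
        (S.casc.1 _ (headAt_tailAt_mem ht)).2.1
  rw [tailAt_addNoncontributing S.lt k ht, e]

lemma riggedConfig_addNoncontributing {v : ℕ} (hv : p ≤ v) :
    riggedConfig n (addNoncontributing β p h k) v = riggedConfig n β v := by
  rw [riggedConfig_eq (S.isCascading_addNoncontributing k), riggedConfig_eq S.casc,
    S.rows_addNoncontributing k hv]
  congr 1
  funext l
  exact S.rigging_addNoncontributing k v l

/-- If at least `k` elements remain at each letter, the `(p - 1)`-st partition gains `k` boxes in
its row `h + 1`. -/
lemma rows_pred_addNoncontributing (hk : ∀ s ≤ h, k ≤ (remainingAt β p h s).length) {s : ℕ}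
    (hs : 1 ≤ s) : rows (addNoncontributing β p h k) (p - 1) s =
      rows β (p - 1) s + if s = h + 1 then k else 0 := by
  have h2 := S.two_le
  rw [(S.isBallot_addNoncontributing k).rows_eq le_rfl hs, S.ballot.rows_eq le_rfl hs,
    Nat.sub_add_cancel (by omega), length_addNoncontributing]
  rcases le_or_gt s p with hsp | hsp
  swap
  · have := S.lt
    rw [show p - s = 0 by omega, (S.isBallot_addNoncontributing k).headCount_zero_letter,
      S.ballot.headCount_zero_letter, if_neg (by omega)]
  have hmoved : ∀ σ, movedCount β p h k σ β.length = if σ ≤ h then k else 0 := by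
    intro σ
    unfold movedCount
    split_ifs with hσ
    · have := hk σ hσ
      rw [below_remainingAt_length S.lt hσ]
      omega
    · rfl
  have h1 := headCount_addNoncontributing S.lt k hsp (le_refl β.length)
  rw [if_neg (by omega), hmoved, hmoved] at h1
  split_ifs at h1 ⊢ <;> omega


end StretchSetup

/-! ### Conditions of a plateau in terms of row lengths -/

/-- The length of a column is determined by the rows down to the next one. -/
lemma length_lane_congr {β γ : List LowerInterval} (hβ : AreIntervals β) (hγ : AreIntervals γ)
    {i v : ℕ} (hi : 1 ≤ i) (h : ∀ s, 1 ≤ s → s ≤ (lanes γ i v).length + 1 →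
      (i ≤ rows γ v s ↔ i ≤ rows β v s)) : (lanes β i v).length = (lanes γ i v).length := by
  have h1 : ∀ s, 1 ≤ s → s ≤ (lanes γ i v).length + 1 →
      (s ≤ (lanes γ i v).length ↔ s ≤ (lanes β i v).length) := fun s hs hs' => by
    rw [le_length_lane_iff hγ hi hs, le_length_lane_iff hβ hi hs, h s hs hs']
  have h2 := h1 ((lanes γ i v).length + 1) (by omega) le_rfl
  rcases Nat.eq_zero_or_pos (lanes γ i v).length with h0 | h0
  · omega
  · have h3 := h1 (lanes γ i v).length h0 (by omega)
    omega

lemma length_lane_eq_of_rows_eq {β γ : List LowerInterval} (hβ : AreIntervals β)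
    (hγ : AreIntervals γ) {i v : ℕ} (hi : 1 ≤ i) (h : rows γ v = rows β v) :
    (lanes β i v).length = (lanes γ i v).length :=
  length_lane_congr hβ hγ hi fun s _ _ => by rw [h]

/-- In a ballot sequence, the lane that ends with an interval of tail `p - 1` and head `a` has
length `p - a`. -/
lemma IsBallot.isPlateau {β : List LowerInterval} {p : ℕ} (hb : IsBallot β (p - 1)) (hp : 2 ≤ p)
    (hβ : AreIntervals β) {q r : ℕ∞}
    (h1 : ∀ i, 1 ≤ i → lanes β i p ≠ [] → ((lanes β i (p - 1)).length : ℕ∞) < q →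
      (lanes β i (p - 1)).length + 1 = (lanes β i p).length)
    (h2 : ∀ t < β.length, tailAt β t = p - 1 → r < ((p - headAt β t : ℕ) : ℕ∞)) :
    IsPlateau β p q r := by
  refine ⟨h1, fun i _ _ hr he => ?_, fun v _ hv i _ he => ?_⟩
  · obtain ⟨t, ht, h3, _, h5⟩ := (endsAtRightEndpoint_iff hβ).1 he
    have h6 := hβ _ (headAt_tailAt_mem ht)
    simp only [] at h6
    rw [hb.rowAt_eq ht (by omega) le_rfl, Nat.sub_add_cancel (by omega)] at h5
    rw [h5] at hr
    exact absurd (h2 t ht h3) (not_lt.2 hr)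
  · obtain ⟨t, ht, h3, _⟩ := (endsAtRightEndpoint_iff hβ).1 he
    have := hb.le_tail _ (headAt_tailAt_mem ht)
    simp only [] at this
    omega

lemma IsPlateau.lt_of_tailAt_eq {n : ℕ} {β : List LowerInterval} {p : ℕ} (hp : 2 ≤ p)
    (hβ : IsCascading n β) (hb : IsBallot β (p - 1)) {q r : ℕ∞} (h : IsPlateau β p q r) {t : ℕ}
    (ht : t < β.length) (hm : tailAt β t = p - 1) : r < ((p - headAt β t : ℕ) : ℕ∞) := by
  have h6 := hβ.areIntervals _ (headAt_tailAt_mem ht)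
  simp only [] at h6
  have h1 := hβ.endsAtRightEndpoint_iff.2 ⟨t, ht, hm, rfl⟩
  have h2 := (lane_getElem?_eq_some_iff hβ.areIntervals (u := slotAt β t (p - 1) + 1)
    (s := rowAt β t (p - 1) - 1)).2
    ⟨ht, by omega, hm.ge, rfl, Nat.sub_add_cancel (one_le_rowAt _ _ _)⟩
  obtain ⟨t', ht', h3, h4, h5⟩ := (endsAtRightEndpoint_iff hβ.areIntervals).1 h1
  have h8 : t' = t := by
    rcases lt_trichotomy t' t with h9 | h9 | h9
    · have := hβ.slotAt_lt_slotAt h9 ht h3 hm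
      omega
    · exact h9
    · have := hβ.slotAt_lt_slotAt h9 ht' hm h3
      omega
  have h7 : lanes β (slotAt β t (p - 1) + 1) (p - 1) ≠ [] := by
    intro h8
    rw [h8] at h2
    simp at h2
  by_contra hc
  refine h.2.1 _ (by omega) h7 ?_ h1
  rw [h5, h8, hb.rowAt_eq ht (by omega) le_rfl, Nat.sub_add_cancel (by omega)]
  exact not_lt.1 hc

/-- An interval with tail `p - 1` comes in a lane left of the end of every row of the `(p - 1)`-st
partition that is at least as high as the one containing its entry `p - 1`. -/
lemma IsBallot.slotAt_lt_rows {β : List LowerInterval} {p : ℕ} (hb : IsBallot β (p - 1)) {t s : ℕ}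
    (hs : 1 ≤ s) (ht : t < β.length) (hm : headAt β t + s ≤ p) :
    slotAt β t (p - 1) < rows β (p - 1) s := by
  have ha := hb.one_le_head _ (headAt_tailAt_mem ht)
  simp only [] at ha
  rw [hb.slotAt_eq ht (by omega) le_rfl, hb.rows_eq le_rfl hs]
  have h1 := hb.headCount_mono_letter β.length ha
    (show headAt β t ≤ p - 1 + 1 - s by omega) (by omega)
  have h2 := headCount_mono β (show t + 1 ≤ β.length from ht) (headAt β t)
  rw [headCount_succ ht, if_pos rfl] at h2
  omega

/-! ### Adding noncontributing boxes -/

lemma riggedPartition_congr_rows {f f' : ℕ → ℕ} (h : ∀ s, 1 ≤ s → f s = f' s) (g : ℕ → ℤ) :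
    riggedPartition f g = riggedPartition f' g := by
  have e : firstRow f 0 = firstRow f' 0 := by
    unfold firstRow
    congr 1
    ext s
    exact and_congr_right fun hs => by rw [h s hs]
  rw [riggedPartition, riggedPartition, e, riggedRows, riggedRows]
  congr 1
  exact Multiset.map_congr rfl fun s _ => by rw [h (s + 1) (by omega)]

lemma IsRowList.add {f f' : ℕ → ℕ} (h : IsRowList f) {b k : ℕ}
    (hb : b = 1 ∨ f b + k ≤ f (b - 1))
    (hf' : ∀ s, 1 ≤ s → f' s = if s = b then f b + k else f s) : IsRowList f' := by
  constructor
  · intro s t hs hst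
    rw [hf' s hs, hf' t (hs.trans hst)]
    have h1 := h.anti s t hs hst
    split_ifs with h2 h3 h3
    · exact le_rfl
    · rcases hb with hb | hb
      · omega
      · have h4 := h.anti s (b - 1) hs (by omega)
        omega
    · rw [h3] at h1
      omega
    · exact h1
  · obtain ⟨K, hK⟩ := h.fin
    refine ⟨max K b, fun s hs => ?_⟩
    rw [hf' s (by omega), if_neg (by omega), hK s (by omega)]

lemma addNoncontributingBox_riggedPartition {f f' : ℕ → ℕ} {g : ℕ → ℤ} (h : IsRowList f)
    (hg : g 0 = 0) {b : ℕ} (hb : 1 ≤ b) (hf' : IsRowList f')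
    (hff' : ∀ s, 1 ≤ s → f' s = if s = b then f b + 1 else f s) (hgb : g (f b + 1) = g (f b)) :
    addNoncontributingBox b (riggedPartition f g) = riggedPartition f' g := by
  have h1 := cons_map_erase_riggedPartition h hb (g := g) (g' := g) (φ := id) rfl
    (fun _ _ _ _ => rfl) rfl hf' hff'
  rw [Multiset.map_id, hgb] at h1
  rw [addNoncontributingBox, row_riggedPartition h hg hb]
  exact h1

lemma iterate_addNoncontributingBox_riggedPartition {f : ℕ → ℕ} {g : ℕ → ℤ} (h : IsRowList f)
    (hg : g 0 = 0) {b : ℕ} (hb : 1 ≤ b) (hgb : ∀ l, f b ≤ l → g l = g (f b)) {k : ℕ}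
    (hk : b = 1 ∨ f b + k ≤ f (b - 1)) {f' : ℕ → ℕ}
    (hff' : ∀ s, 1 ≤ s → f' s = if s = b then f b + k else f s) :
    (addNoncontributingBox b)^[k] (riggedPartition f g) = riggedPartition f' g := by
  induction k generalizing f' with
  | zero =>
    refine riggedPartition_congr_rows (fun s hs => ?_) g
    rw [hff' s hs]
    split_ifs with h1
    · rw [h1, add_zero]
    · rfl
  | succ k ih =>
    have h1 : ∀ s, 1 ≤ s → (fun s => if s = b then f b + k else f s) s =
      if s = b then f b + k else f s := fun s _ => rfl
    have hk' : b = 1 ∨ f b + k ≤ f (b - 1) := by omega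
    rw [Function.iterate_succ_apply', ih hk' h1]
    refine addNoncontributingBox_riggedPartition (h.add hk' h1) hg hb (h.add hk hff')
      (fun s hs => ?_) ?_
    · rw [hff' s hs]
      simp only [if_true]
      split_ifs <;> omega
    · simp only [if_true]
      rw [hgb _ (by omega), hgb (f b + k) (by omega)]

namespace StretchSetup

variable {n p h : ℕ} {β : List LowerInterval} (S : StretchSetup n p h β) (k : ℕ)

include S

lemma riggedConfig_pred_addNoncontributing (hk : ∀ s ≤ h, k ≤ (remainingAt β p h s).length)
    (hroom : h = 0 ∨ rows β (p - 1) (h + 1) + k ≤ rows β (p - 1) h) :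
    riggedConfig n (addNoncontributing β p h k) (p - 1) =
      (addNoncontributingBox (h + 1))^[k] (riggedConfig n β (p - 1)) := by
  rw [riggedConfig_eq (S.isCascading_addNoncontributing k), riggedConfig_eq S.casc]
  have e : rigging (addNoncontributing β p h k) (p - 1) = rigging β (p - 1) :=
    funext fun l => S.rigging_addNoncontributing k (p - 1) l
  rw [e]
  symm
  refine iterate_addNoncontributingBox_riggedPartition ((isRowSystem_rows β).isRowList _)
    (rigging_zero_right _ _) (by omega) (fun l hl => ?_) ?_ fun s hs => ?_
  · refine rigging_eq_of_le S.ballot.le_tail (fun t ht hm => ?_) hl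
    rw [hm]
    exact S.ballot.slotAt_lt_rows (by omega) ht (S.short t ht hm).le
  · rw [Nat.add_sub_cancel]
    omega
  · rw [S.rows_pred_addNoncontributing k hk hs]
    split_ifs with h1
    · rw [h1]
    · rfl

lemma isPlateau_addNoncontributing {q r : ℕ∞} (hplat : IsPlateau β p q r) (hq : (h : ℕ∞) ≤ q)
    (hk : ∀ s ≤ h, k ≤ (remainingAt β p h s).length) :
    IsPlateau (addNoncontributing β p h k) p h r := by
  have hβ := S.casc.areIntervals
  have hγ := (S.isCascading_addNoncontributing k).areIntervals
  refine (S.isBallot_addNoncontributing k).isPlateau S.two_le hγ (fun i hi hne hlt => ?_)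
    fun t ht hm => ?_
  · have e1 := length_lane_eq_of_rows_eq hβ hγ hi (S.rows_addNoncontributing k le_rfl)
    have hlt' : (lanes (addNoncontributing β p h k) i (p - 1)).length < h := by exact_mod_cast hlt
    have e2 : (lanes β i (p - 1)).length = (lanes (addNoncontributing β p h k) i (p - 1)).length :=
      length_lane_congr hβ hγ hi fun s hs hs' => by
        rw [S.rows_pred_addNoncontributing k hk hs, if_neg (by omega), add_zero]
    have h1 := hplat.1 i hi
      (by rw [← List.length_pos_iff, e1]; exact List.length_pos_iff.2 hne)
      (by rw [e2]; exact hlt.trans_le hq)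
    omega
  · rw [length_addNoncontributing] at ht
    rw [tailAt_addNoncontributing S.lt k ht] at hm
    rw [S.headAt_addNoncontributing_of_lt k ht (by have := S.short t ht hm; omega)]
    exact hplat.lt_of_tailAt_eq S.two_le S.casc S.ballot ht hm

end StretchSetup

/-! ### Appending short intervals -/

lemma headCount_append_singleton (β : List LowerInterval) (I : LowerInterval) (v : ℕ) :
    headCount (β ++ [I]) (β ++ [I]).length v =
      headCount β β.length v + if I.1 = v then 1 else 0 := by
  rw [headCount, headCount, List.take_length, List.take_length, List.filter_append,
    List.length_append]
  by_cases h : I.1 = v <;> simp [h]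

lemma headCount_append_of_le (β γ : List LowerInterval) {t : ℕ} (ht : t ≤ β.length) (v : ℕ) :
    headCount (β ++ γ) t v = headCount β t v := by
  rw [headCount, headCount, List.take_append_of_le_length ht]

/-- A contributing box depends only on the partition that receives it. -/
lemma addContributingBox_congr {l b : ℕ} {R R' : RiggedConfig} (hl : R l = R' l) {x : ℕ}
    (hx : R x = R' x) : addContributingBox l b R x = addContributingBox l b R' x := by
  simp only [addContributingBox, hl]
  rw [hx]

/-- The common assumptions for appending intervals that add boxes to the row `b` of the
`(p - 1)`-st partition: every interval with tail `p - 1` has its entry `p - 1` in the row `b` or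
below. -/
structure AppendSetup (n p b : ℕ) (β : List LowerInterval) : Prop where
  two_le : 2 ≤ p
  le : p ≤ n + 1
  one_le : 1 ≤ b
  lt : b < p
  casc : IsCascading n β
  ballot : IsBallot β (p - 1)
  short : ∀ t < β.length, tailAt β t = p - 1 → headAt β t + b ≤ p

namespace AppendSetup

variable {n p b : ℕ} {β : List LowerInterval} (S : AppendSetup n p b β)

include S

/-- There is room for one more box in the row `b` of the `(p - 1)`-st partition. -/
lemma append_singleton
    (hroom : b = 1 ∨ headCount β β.length (p - b) < headCount β β.length (p - b + 1)) :
    AppendSetup n p b (β ++ [(p - b, p - 1)]) where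
  two_le := S.two_le
  le := S.le
  one_le := S.one_le
  lt := S.lt
  casc := by
    have h1 := S.one_le
    have h2 := S.lt
    have h3 := S.le
    constructor
    · intro I hI
      rcases List.mem_append.1 hI with hI | hI
      · exact S.casc.1 I hI
      · rw [List.mem_singleton.1 hI]
        simp only []
        omega
    · refine List.pairwise_append.2 ⟨S.casc.2, List.pairwise_singleton _ _, fun I hI J hJ => ?_⟩
      rw [List.mem_singleton.1 hJ]
      obtain ⟨t, ht⟩ := List.mem_iff_getElem?.1 hI
      have htl := (List.getElem?_eq_some_iff.1 ht).1
      rw [getElem?_eq_some_headAt_tailAt htl, Option.some.injEq] at ht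
      have h4 := S.ballot.le_tail I hI
      have h5 := S.short t htl
      rw [← ht] at h4 ⊢
      simp only [] at h4 ⊢
      omega
  ballot := by
    have h1 := S.one_le
    have h2 := S.lt
    refine ⟨fun I hI => ?_, fun I hI => ?_, fun t v hv hvp => ?_⟩
    · rcases List.mem_append.1 hI with hI | hI
      · exact S.ballot.one_le_head I hI
      · rw [List.mem_singleton.1 hI]
        simp only []
        omega
    · rcases List.mem_append.1 hI with hI | hI
      · exact S.ballot.le_tail I hI
      · rw [List.mem_singleton.1 hI]
    · rcases le_or_gt t β.length with ht | ht
      · rw [headCount_append_of_le _ _ ht, headCount_append_of_le _ _ ht]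
        exact S.ballot.headCount_le t v hv hvp
      · have e : (β ++ [(p - b, p - 1)]).length ≤ t := by simpa using ht
        have h3 := S.ballot.headCount_le β.length v hv hvp
        rw [headCount_of_le e, headCount_of_le e, headCount_append_singleton,
          headCount_append_singleton]
        simp only []
        by_cases hv' : v = p - b
        · rw [hv'] at h3 hvp ⊢
          rw [if_pos rfl, if_neg (by omega)]
          omega
        · rw [if_neg (by omega)]
          omega
  short t ht hm := by
    rw [List.length_append, List.length_singleton] at ht
    rcases Nat.lt_succ_iff_lt_or_eq.1 ht with ht | rfl
    · rw [tailAt_append _ _ ht] at hm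
      rw [headAt_append _ _ ht]
      exact S.short t ht hm
    · have := S.lt
      rw [headAt_length]
      simp only []
      omega

/-- The slot of the appended interval at its tail. -/
lemma slot_eq_rows
    (hroom : b = 1 ∨ headCount β β.length (p - b) < headCount β β.length (p - b + 1)) :
    slot (rows β) (p - b) (p - 1) = rows β (p - 1) b := by
  have h1 := S.one_le
  have h2 := S.lt
  have h3 := (S.append_singleton hroom).ballot.slotAt_eq (t := β.length) (by simp) (v := p - 1)
    (by rw [headAt_length]; simp only []; omega) le_rfl
  rw [slotAt_length, headAt_length, headCount_append_of_le _ _ le_rfl] at h3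
  rw [S.ballot.rows_eq le_rfl h1, Nat.sub_add_cancel (by omega)]
  exact h3

lemma riggedConfig_append_singleton
    (hroom : b = 1 ∨ headCount β β.length (p - b) < headCount β β.length (p - b + 1))
    {x : ℕ} (hx : p - 1 ≤ x) : riggedConfig n (β ++ [(p - b, p - 1)]) x =
      addContributingBox (p - 1) b (riggedConfig n β) x := by
  have h1 := S.one_le
  have h2 := S.lt
  have S' := S.append_singleton hroom
  have hf := (isRowSystem_rows β).isRowList (p - 1)
  have hrow : row (riggedConfig n β (p - 1)) b =
      (rows β (p - 1) b, rigging β (p - 1) (rows β (p - 1) b)) := by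
    rw [riggedConfig_eq S.casc, row_riggedPartition hf (rigging_zero_right _ _) h1]
  have hrig := fun v l => rigging_append_singleton β (p - b, p - 1) v l
  simp only [S.slot_eq_rows hroom] at hrig
  rw [riggedConfig_eq S'.casc, addContributingBox]
  simp only [hrow]
  rcases hx.eq_or_lt with rfl | hx
  · have hrig' : ∀ l, rigging (β ++ [(p - b, p - 1)]) (p - 1) l = rigging β (p - 1) l -
        if rows β (p - 1) b < l then 1 else 0 := fun l => by
      rw [hrig, if_neg (show ¬ (p - 1 + 1 = p - 1 ∧ rows β (p - 1) b < l) by omega)]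
      simp [sub_eq_add_neg]
    rw [if_pos rfl, riggedConfig_eq S.casc]
    symm
    refine cons_map_erase_riggedPartition hf h1 rfl (fun s hs _ _ => ?_) ?_
      ((isRowSystem_rows _).isRowList _) fun s hs => ?_
    · rw [hrig']
      split_ifs <;> simp
    · rw [hrig', if_pos (Nat.lt_succ_self _),
        rigging_eq_of_le (d := rows β (p - 1) b) S.ballot.le_tail (fun t ht hm => ?_)
        (Nat.le_succ _)]
      · rw [hm]
        exact S.ballot.slotAt_lt_rows h1 ht (S.short t ht hm)
    · rw [S'.ballot.rows_eq le_rfl hs, S.ballot.rows_eq le_rfl hs, S.ballot.rows_eq le_rfl h1,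
        headCount_append_singleton, Nat.sub_add_cancel (by omega)]
      simp only []
      by_cases hsb : s = b
      · rw [hsb, if_pos rfl, if_pos rfl]
      · rw [if_neg (by omega), if_neg hsb, add_zero]
  · have hrows : rows (β ++ [(p - b, p - 1)]) x = rows β x := by
      funext s
      rw [rows_append_singleton, insertRow_of_gt hx]
    rw [if_neg (by omega), hrows, riggedConfig_eq S.casc]
    split_ifs with hxp
    · symm
      refine map_riggedPartition _ fun s hs _ => ?_
      rw [hrig]
      simp only [← hxp, show p - 1 ≠ x by omega, true_and, false_and, if_false]
      split_ifs <;> simp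
    · congr 1
      funext l
      rw [hrig, if_neg (by omega), if_neg (by omega)]
      simp

end AppendSetup

lemma appendCopies_succ (β : List LowerInterval) (a m k : ℕ) :
    appendCopies β a m (k + 1) = appendCopies β a m k ++ [(a, m)] := by
  rw [appendCopies, appendCopies, List.replicate_succ', List.append_assoc]

lemma length_appendCopies (β : List LowerInterval) (a m k : ℕ) :
    (appendCopies β a m k).length = β.length + k := by
  simp [appendCopies]

lemma headCount_appendCopies (β : List LowerInterval) (a m k v : ℕ) :
    headCount (appendCopies β a m k) (appendCopies β a m k).length v =
      headCount β β.length v + if a = v then k else 0 := by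
  induction k with
  | zero => simp [appendCopies]
  | succ k ih =>
    rw [appendCopies_succ, headCount_append_singleton, ih]
    simp only []
    split_ifs <;> omega

lemma rows_appendCopies_of_lt (β : List LowerInterval) (a k : ℕ) {m x : ℕ} (hx : m < x) :
    rows (appendCopies β a m k) x = rows β x := by
  induction k with
  | zero => simp [appendCopies]
  | succ k ih =>
    rw [appendCopies_succ, ← ih]
    funext s
    rw [rows_append_singleton, insertRow_of_gt hx]

namespace AppendSetup

variable {n p b k : ℕ} {β : List LowerInterval} (S : AppendSetup n p b β)
  (hroom : b = 1 ∨ headCount β β.length (p - b) + k ≤ headCount β β.length (p - b + 1))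

include S hroom

lemma appendCopies : AppendSetup n p b (appendCopies β (p - b) (p - 1) k) := by
  induction k with
  | zero => simpa [_root_.appendCopies] using S
  | succ k ih =>
    rw [appendCopies_succ]
    refine (ih (by omega)).append_singleton ?_
    rw [headCount_appendCopies, headCount_appendCopies, if_pos rfl, if_neg (by omega)]
    omega

lemma riggedConfig_appendCopies {x : ℕ} (hx : p - 1 ≤ x) :
    riggedConfig n (_root_.appendCopies β (p - b) (p - 1) k) x =
      (addContributingBox (p - 1) b)^[k] (riggedConfig n β) x := by
  induction k generalizing x with
  | zero => simp [_root_.appendCopies]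
  | succ k ih =>
    have hroom' : b = 1 ∨ headCount β β.length (p - b) + k ≤ headCount β β.length (p - b + 1) := by
      omega
    rw [appendCopies_succ, Function.iterate_succ_apply',
      (S.appendCopies hroom').riggedConfig_append_singleton ?_ hx]
    · exact addContributingBox_congr (ih hroom' le_rfl) (ih hroom' hx)
    · rw [headCount_appendCopies, headCount_appendCopies, if_pos rfl, if_neg (by omega)]
      omega

lemma riggedConfig_appendCopies_of_lt {x : ℕ} (hx : p < x) :
    riggedConfig n (_root_.appendCopies β (p - b) (p - 1) k) x = riggedConfig n β x := by
  have := S.two_le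
  rw [S.riggedConfig_appendCopies hroom (by omega)]
  clear hroom
  induction k with
  | zero => rfl
  | succ k ih =>
    rw [Function.iterate_succ_apply']
    simp only [addContributingBox, show x ≠ p - 1 by omega, show x ≠ p - 1 + 1 by omega, if_false]
    exact ih

lemma map_fst_riggedConfig_appendCopies :
    (riggedConfig n (_root_.appendCopies β (p - b) (p - 1) k) p).map Prod.fst =
      (riggedConfig n β p).map Prod.fst := by
  rw [riggedConfig_eq (S.appendCopies hroom).casc, riggedConfig_eq S.casc,
    rows_appendCopies_of_lt _ _ _ (show p - 1 < p by have := S.two_le; omega)]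
  exact map_fst_riggedPartition _ _ _

lemma rows_pred_appendCopies {s : ℕ} (hs : 1 ≤ s) :
    rows (_root_.appendCopies β (p - b) (p - 1) k) (p - 1) s =
      rows β (p - 1) s + if s = b then k else 0 := by
  have h1 := S.one_le
  have h2 := S.lt
  rw [(S.appendCopies hroom).ballot.rows_eq le_rfl hs, S.ballot.rows_eq le_rfl hs,
    headCount_appendCopies]
  congr 1
  by_cases hsb : s = b
  · rw [if_pos hsb, if_pos (by omega)]
  · rw [if_neg hsb, if_neg (by omega)]

/-- The columns that receive a box end at a right endpoint. -/
lemma endsAtRightEndpoint_appendCopies {i : ℕ} (h1 : rows β (p - 1) b < i)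
    (h2 : i ≤ rows β (p - 1) b + k) :
    EndsAtRightEndpoint (_root_.appendCopies β (p - b) (p - 1) k) i (p - 1) := by
  have hb := S.one_le
  have hbp := S.lt
  obtain ⟨j, rfl⟩ : ∃ j, i = rows β (p - 1) b + j + 1 := ⟨i - (rows β (p - 1) b + 1), by omega⟩
  have S' := S.appendCopies hroom
  have e : _root_.appendCopies β (p - b) (p - 1) k =
      _root_.appendCopies β (p - b) (p - 1) (j + 1) ++
        List.replicate (k - (j + 1)) (p - b, p - 1) := by
    rw [_root_.appendCopies, _root_.appendCopies, List.append_assoc,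
      List.replicate_append_replicate, show j + 1 + (k - (j + 1)) = k by omega]
  have hl : (_root_.appendCopies β (p - b) (p - 1) j).length <
      (_root_.appendCopies β (p - b) (p - 1) (j + 1)).length := by
    rw [length_appendCopies, length_appendCopies]
    omega
  have hl' : (_root_.appendCopies β (p - b) (p - 1) j).length <
      (_root_.appendCopies β (p - b) (p - 1) k).length := by
    rw [length_appendCopies, length_appendCopies]
    omega
  have hhead : headAt (_root_.appendCopies β (p - b) (p - 1) k)
      (_root_.appendCopies β (p - b) (p - 1) j).length = p - b := by
    rw [e, headAt_append _ _ hl, appendCopies_succ, headAt_length]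
  have htail : tailAt (_root_.appendCopies β (p - b) (p - 1) k)
      (_root_.appendCopies β (p - b) (p - 1) j).length = p - 1 := by
    rw [e, tailAt_append _ _ hl, appendCopies_succ, tailAt_length]
  refine S'.casc.endsAtRightEndpoint_iff.2 ⟨_, hl', htail, ?_⟩
  rw [S'.ballot.slotAt_eq hl' (by omega) le_rfl, hhead, e, headCount_append_of_le _ _ hl.le,
    appendCopies_succ, headCount_append_of_le _ _ le_rfl, headCount_appendCopies, if_pos rfl,
    S.ballot.rows_eq le_rfl hb, Nat.sub_add_cancel (by omega)]

lemma length_lane_pred_appendCopies {i : ℕ} (hi : 1 ≤ i)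
    (h : ¬ (rows β (p - 1) b < i ∧ i ≤ rows β (p - 1) b + k) ∨
      (lanes (_root_.appendCopies β (p - b) (p - 1) k) i (p - 1)).length < b) :
    (lanes β i (p - 1)).length =
      (lanes (_root_.appendCopies β (p - b) (p - 1) k) i (p - 1)).length := by
  have hγ := (S.appendCopies hroom).casc.areIntervals
  refine length_lane_congr S.casc.areIntervals hγ hi fun s hs _ => ?_
  have h1 := S.rows_pred_appendCopies hroom hs
  by_cases hsb : s = b
  · rw [if_pos hsb] at h1
    rcases h with h | h
    · rw [hsb] at h1 ⊢
      omega
    · have h2 := mt (le_length_lane_iff hγ hi hs (v := p - 1)).2 (by omega)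
      omega
  · rw [if_neg hsb] at h1
    omega

lemma length_lane_appendCopies {i : ℕ} (hi : 1 ≤ i) :
    (lanes β i p).length = (lanes (_root_.appendCopies β (p - b) (p - 1) k) i p).length :=
  length_lane_eq_of_rows_eq S.casc.areIntervals (S.appendCopies hroom).casc.areIntervals hi
    (rows_appendCopies_of_lt _ _ _ (show p - 1 < p by have := S.two_le; omega))

lemma lt_of_tailAt_appendCopies {t : ℕ}
    (ht : t < (_root_.appendCopies β (p - b) (p - 1) k).length)
    (hm : tailAt (_root_.appendCopies β (p - b) (p - 1) k) t = p - 1) {r : ℕ} (hr : r < b) :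
    (r : ℕ∞) < ((p - headAt (_root_.appendCopies β (p - b) (p - 1) k) t : ℕ) : ℕ∞) := by
  have := (S.appendCopies hroom).short t ht hm
  exact_mod_cast (show r < p - headAt _ t by omega)

lemma isPlateau_appendCopies {q r : ℕ∞} (hplat : IsPlateau β p q r) {r' : ℕ} (hr' : r' < b) :
    IsPlateau (_root_.appendCopies β (p - b) (p - 1) k) p (min q b) r' := by
  have S' := S.appendCopies hroom
  refine S'.ballot.isPlateau S.two_le S'.casc.areIntervals (fun i hi hne hlt => ?_)
    fun t ht hm => S.lt_of_tailAt_appendCopies hroom ht hm hr'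
  have e1 := S.length_lane_appendCopies hroom hi
  have e2 := S.length_lane_pred_appendCopies hroom hi
    (Or.inr (by exact_mod_cast hlt.trans_le (min_le_right _ _)))
  rw [← e1, ← e2]
  refine hplat.1 i hi ?_ (by rw [e2]; exact hlt.trans_le (min_le_left _ _))
  rw [← List.length_pos_iff, e1]
  exact List.length_pos_iff.2 hne

lemma noncontributingFree_appendCopies {q r : ℕ∞} (hplat : IsPlateau β p q r) :
    NoncontributingFree (_root_.appendCopies β (p - b) (p - 1) k) p q := by
  intro i hi hne hends hlt
  have e1 := S.length_lane_appendCopies hroom hi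
  have e2 := S.length_lane_pred_appendCopies hroom hi
    (Or.inl fun h => hends (S.endsAtRightEndpoint_appendCopies hroom h.1 h.2))
  rw [← e1, ← e2]
  refine hplat.1 i hi ?_ (by rw [e2]; exact hlt)
  rw [← List.length_pos_iff, e1]
  exact List.length_pos_iff.2 hne

/-- If the new boxes are added to columns to the right of the `p`-th partition, then the first
condition of a plateau is preserved. -/
lemma isPlateau_appendCopies_of_le {q r : ℕ∞} (hplat : IsPlateau β p q r) {r' : ℕ} (hr' : r' < b)
    (hle : rows β p 1 ≤ rows β (p - 1) b) :
    IsPlateau (_root_.appendCopies β (p - b) (p - 1) k) p q r' := by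
  have S' := S.appendCopies hroom
  refine S'.ballot.isPlateau S.two_le S'.casc.areIntervals (fun i hi hne hlt => ?_)
    fun t ht hm => S.lt_of_tailAt_appendCopies hroom ht hm hr'
  have h1 := (lane_ne_nil_iff S'.casc.areIntervals hi).1 hne
  rw [rows_appendCopies_of_lt _ _ _ (show p - 1 < p by have := S.two_le; omega)] at h1
  have e1 := S.length_lane_appendCopies hroom hi
  have e2 := S.length_lane_pred_appendCopies hroom hi (Or.inl (by omega))
  rw [← e1, ← e2]
  exact hplat.1 i hi ((lane_ne_nil_iff S.casc.areIntervals hi).2 h1) (by rw [e2]; exact hlt)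

end AppendSetup

/-! ### Stretches -/

lemma stretchLength_zero_riggedConfig {n : ℕ} {β : List LowerInterval} (hβ : IsCascading n β)
    (p : ℕ) : stretchLength (riggedConfig n β) p 0 = rows β p 1 - rows β (p - 1) 1 := by
  have hrow := fun v => row_riggedPartition ((isRowSystem_rows β).isRowList v)
    (rigging_zero_right β v) (le_refl 1)
  rw [stretchLength, riggedConfig_eq hβ, riggedConfig_eq hβ, hrow, hrow]

lemma stretchLength_riggedConfig {n : ℕ} {β : List LowerInterval} (hβ : IsCascading n β)
    (p : ℕ) {h : ℕ} (hh : 1 ≤ h) : stretchLength (riggedConfig n β) p h =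
      rows β (p - 1) h - rows β (p - 1) (h + 1) := by
  have hf := (isRowSystem_rows β).isRowList (p - 1)
  have hg := rigging_zero_right β (p - 1)
  obtain ⟨h, rfl⟩ : ∃ h', h = h' + 1 := ⟨h - 1, by omega⟩
  rw [stretchLength, riggedConfig_eq hβ, row_riggedPartition hf hg (by omega),
    row_riggedPartition hf hg (by omega)]

/-- Above a nonempty stretch of height `h < min q r`, the row `s + 1` of the `p`-th partition is as
long as the row `s` of the `(p - 1)`-st partition: the last column of this row has height at most
`h`, so that the first condition of a plateau applies to it. -/
lemma IsPlateau.stretchSetup {n p h : ℕ} {β : List LowerInterval} {q r : ℕ∞} (hp : 2 ≤ p)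
    (hβ : IsCascading n β) (hb : IsBallot β (p - 1)) (hplat : IsPlateau β p q r)
    (hhp : h + 1 < p) (hz : 0 < stretchLength (riggedConfig n β) p h) (hq : (h : ℕ∞) < q)
    (hr : (h : ℕ∞) < r) : StretchSetup n p h β := by
  have S : Setup n p (h + 1) β := by
    refine ⟨hp, hβ, hb, fun t ht hm => ?_⟩
    have h1 := hplat.lt_of_tailAt_eq hp hβ hb ht hm
    have h2 := (Order.add_one_le_of_lt hr).trans_lt h1
    have h3 : h + 1 < p - headAt β t := by exact_mod_cast h2
    omega
  refine ⟨S, hhp, fun s hs hsh => ?_⟩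
  have H := isRowSystem_rows β
  have h0 := S.rows_succ_le_headCount le_rfl hs
  have e0 := S.rows_pred le_rfl hs
  have h1 := S.headCount_le_rows le_rfl (s := 1) le_rfl (by omega) (by omega)
  have e1 := S.rows_pred le_rfl (s := 1) le_rfl
  rw [List.take_length] at h0 e0 h1 e1
  refine le_antisymm h0 ?_
  rw [stretchLength_riggedConfig hβ p (hs.trans hsh)] at hz
  have h2 := H.anti_le (p - 1) hs hsh
  have h3 := H.anti_le (p - 1) le_rfl hs
  have hi : 1 ≤ rows β (p - 1) s := by omega
  have hint := hβ.areIntervals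
  have h4 := (le_length_lane_iff hint hi hs).2 (le_refl (rows β (p - 1) s))
  have h5 := mt (le_length_lane_iff hint (v := p - 1) hi (show 1 ≤ h + 1 by omega)).1 (by omega)
  have h6 := hplat.1 _ hi ((lane_ne_nil_iff hint hi).2 (by omega))
    (lt_of_le_of_lt (by exact_mod_cast (show _ ≤ h by omega)) hq)
  rw [← e0]
  exact (le_length_lane_iff hint hi (by omega)).1 (by omega)

theorem mainTheorem7 (n p : ℕ) (hp : 2 ≤ p) (hpn : p ≤ n + 1) (β : List LowerInterval)
    (hβ : IsCascading n β) (q r : ℕ∞) (hstar : IsStarPlateau β (p - 1))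
    (hplat : IsPlateau β p q r) :
    -- noncontributing boxes beneath the stretch of height `h`
    (∀ h k : ℕ, h < maxRows n (p - 1) → 0 < stretchLength (riggedConfig n β) p h →
      (h : ℕ∞) < min q r → k ≤ stretchLength (riggedConfig n β) p h →
        Executable β p h k ∧
        IsCascading n (addNoncontributing β p h k) ∧
        IsStarPlateau (addNoncontributing β p h k) (p - 1) ∧
        IsPlateau (addNoncontributing β p h k) p h r ∧
        riggedConfig n (addNoncontributing β p h k) (p - 1) =
          (addNoncontributingBox (h + 1))^[k] (riggedConfig n β (p - 1)) ∧
        ∀ x, p ≤ x → riggedConfig n (addNoncontributing β p h k) x = riggedConfig n β x) ∧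
    -- the positions of the heads `p - 1, p - 2, …` in `β`
    (∀ h : ℕ, h < maxRows n (p - 1) → 0 < stretchLength (riggedConfig n β) p h →
      (h : ℕ∞) < min q r →
        (∃ j : ℕ → ℕ,
          (∀ d, 1 ≤ d → d ≤ h →
            IsLeast {i : ℕ | i ≤ β.length ∧
              (d = 1 → ∀ b, StartsLane β p b → b < i) ∧
              (2 ≤ d → j (d - 1) ≤ i) ∧
              headCount β i (p - d) ≤ headCount β i (p - d - 1)} (j d)) ∧
          ∀ d, 1 ≤ d → d ≤ h → ∀ b ∈ headPositions β (p - d), j d ≤ b →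
            ∃ u, 1 ≤ u ∧ (∀ v, p - d ≤ v → v ≤ p → b ∈ lanes β u v) ∧
              (lanes β u p)[d]? = some b ∧ (lanes β u (p - 1))[d - 1]? = some b) ∧
        ∀ b, StartsLane β p b → ∀ i ∈ headPositions β p, i < b →
          i ∈ fixedElements β p h (h + 1)) ∧
    -- contributing boxes beneath the stretch of height `h`
    (∀ h k : ℕ, h < maxRows n (p - 1) → 0 < stretchLength (riggedConfig n β) p h →
      (h : ℕ∞) < r → k ≤ stretchLength (riggedConfig n β) p h →
        IsCascading n (appendCopies β (p - h - 1) (p - 1) k) ∧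
        IsStarPlateau (appendCopies β (p - h - 1) (p - 1) k) (p - 1) ∧
        IsPlateau (appendCopies β (p - h - 1) (p - 1) k) p (min q (h + 1)) h ∧
        NoncontributingFree (appendCopies β (p - h - 1) (p - 1) k) p q ∧
        (∀ x, p - 1 ≤ x → riggedConfig n (appendCopies β (p - h - 1) (p - 1) k) x =
          (addContributingBox (p - 1) (h + 1))^[k] (riggedConfig n β) x) ∧
        (∀ x, p < x → riggedConfig n (appendCopies β (p - h - 1) (p - 1) k) x =
          riggedConfig n β x) ∧
        (riggedConfig n (appendCopies β (p - h - 1) (p - 1) k) p).map Prod.fst =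
          (riggedConfig n β p).map Prod.fst) ∧
    -- contributing boxes in the top row
    (∀ N : ℕ,
        IsCascading n (appendCopies β (p - 1) (p - 1) N) ∧
        IsStarPlateau (appendCopies β (p - 1) (p - 1) N) (p - 1) ∧
        IsPlateau (appendCopies β (p - 1) (p - 1) N) p (min q 1) 0 ∧
        ((row (riggedConfig n β p) 1).1 ≤ (row (riggedConfig n β (p - 1)) 1).1 →
          IsPlateau (appendCopies β (p - 1) (p - 1) N) p q 0) ∧
        NoncontributingFree (appendCopies β (p - 1) (p - 1) N) p q ∧
        (∀ x, p - 1 ≤ x → riggedConfig n (appendCopies β (p - 1) (p - 1) N) x =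
          (addContributingBox (p - 1) 1)^[N] (riggedConfig n β) x) ∧
        (∀ x, p < x → riggedConfig n (appendCopies β (p - 1) (p - 1) N) x =
          riggedConfig n β x) ∧
        (riggedConfig n (appendCopies β (p - 1) (p - 1) N) p).map Prod.fst =
          (riggedConfig n β p).map Prod.fst) := by
  have htail := hplat.le_tail hβ
  have hb := hstar.isBallot hβ htail
  have hheight : ∀ h, h < maxRows n (p - 1) → h + 1 < p := fun h hh => by
    have := hh.trans_le (min_le_right _ _)
    omega
  have hends : ∀ t < β.length, tailAt β t = p - 1 → r < ((p - headAt β t : ℕ) : ℕ∞) :=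
    fun t ht hm => hplat.lt_of_tailAt_eq hp hβ hb ht hm
  refine ⟨fun h k hh hz hqr hk => ?_, fun h hh hz hqr => ?_, fun h k hh hz hr hk => ?_,
    fun N => ?_⟩
  · obtain ⟨hq, hr⟩ := lt_min_iff.1 hqr
    have hhp := hheight h hh
    have S := hplat.stretchSetup hp hβ hb hhp hz hq hr
    have e : ∀ s, 1 ≤ s → rows β (p - 1) s = headCount β β.length (p - s) := fun s hs => by
      rw [hb.rows_eq le_rfl hs, Nat.sub_add_cancel (by omega)]
    have hlen : k + headCount β β.length (p - (h + 1)) ≤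
        if h = 0 then rows β p 1 else headCount β β.length (p - h) := by
      rw [← e (h + 1) (by omega)]
      split_ifs with h0
      · rw [h0, stretchLength_zero_riggedConfig hβ] at hk hz
        rw [h0, zero_add]
        omega
      · rw [stretchLength_riggedConfig hβ p (by omega)] at hk hz
        rw [← e h (by omega)]
        omega
    have hex := S.executable hlen
    have hk' : ∀ s ≤ h, k ≤ (remainingAt β p h s).length := fun s _ => hex.2 _ (Nat.sub_le h s)
    refine ⟨hex, S.isCascading_addNoncontributing k,
      (S.isBallot_addNoncontributing k).isStarPlateau
        (S.isCascading_addNoncontributing k).areIntervals,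
      S.isPlateau_addNoncontributing k hplat hq.le hk',
      S.riggedConfig_pred_addNoncontributing k hk' ?_,
      fun x hx => S.riggedConfig_addNoncontributing k hx⟩
    rw [e (h + 1) (by omega)]
    rcases Nat.eq_zero_or_pos h with h0 | h0
    · exact Or.inl h0
    · rw [if_neg (by omega)] at hlen
      rw [e h h0]
      omega
  · obtain ⟨hq, hr⟩ := lt_min_iff.1 hqr
    have S := hplat.stretchSetup hp hβ hb (hheight h hh) hz hq hr
    exact ⟨S.exists_initial_segments le_rfl S.lt S.fin,
      fun b hb i hi hib => S.mem_fixedElements_of_startsLane hb hi hib⟩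
  · have hhp := hheight h hh
    have S : AppendSetup n p (h + 1) β :=
      ⟨hp, hpn, by omega, hhp, hβ, hb, fun t ht hm => by
        have h1 := hr.trans (hends t ht hm)
        have h2 : h < p - headAt β t := by exact_mod_cast h1
        omega⟩
    have hroom : h + 1 = 1 ∨
        headCount β β.length (p - (h + 1)) + k ≤ headCount β β.length (p - (h + 1) + 1) := by
      rcases Nat.eq_zero_or_pos h with h0 | h0
      · omega
      · rw [stretchLength_riggedConfig hβ p h0, hb.rows_eq le_rfl h0,
          hb.rows_eq le_rfl (by omega)] at hk hz
        rw [show p - 1 + 1 - (h + 1) = p - (h + 1) by omega,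
          show p - 1 + 1 - h = p - (h + 1) + 1 by omega] at hk hz
        omega
    rw [Nat.sub_sub]
    have S' := S.appendCopies hroom
    refine ⟨S'.casc, S'.ballot.isStarPlateau S'.casc.areIntervals, ?_,
      S.noncontributingFree_appendCopies hroom hplat,
      fun x hx => S.riggedConfig_appendCopies hroom hx,
      fun x hx => S.riggedConfig_appendCopies_of_lt hroom hx,
      S.map_fst_riggedConfig_appendCopies hroom⟩
    have := S.isPlateau_appendCopies hroom hplat (Nat.lt_succ_self h)
    rwa [Nat.cast_add, Nat.cast_one] at this
  · have S : AppendSetup n p 1 β :=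
      ⟨hp, hpn, le_rfl, by omega, hβ, hb, fun t ht hm => by
        have := hβ.areIntervals _ (headAt_tailAt_mem ht)
        simp only [] at this
        omega⟩
    have hroom : 1 = 1 ∨
        headCount β β.length (p - 1) + N ≤ headCount β β.length (p - 1 + 1) := Or.inl rfl
    have S' := S.appendCopies hroom
    refine ⟨S'.casc, S'.ballot.isStarPlateau S'.casc.areIntervals, ?_, fun hle => ?_,
      S.noncontributingFree_appendCopies hroom hplat,
      fun x hx => S.riggedConfig_appendCopies hroom hx,
      fun x hx => S.riggedConfig_appendCopies_of_lt hroom hx,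
      S.map_fst_riggedConfig_appendCopies hroom⟩
    · exact_mod_cast S.isPlateau_appendCopies hroom hplat Nat.one_pos
    · have hrow := fun v => row_riggedPartition ((isRowSystem_rows β).isRowList v)
        (rigging_zero_right β v) (le_refl 1)
      rw [riggedConfig_eq hβ, riggedConfig_eq hβ, hrow, hrow] at hle
      exact_mod_cast S.isPlateau_appendCopies_of_le hroom hplat Nat.one_pos hle
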